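/- Work in two-sorted first-order logic over the language $\mathcal L^2_A=\{0,1,+,\cdot,|\ |;=_1,=_2,\le,\in\}$ of bounded arithmetic (numbers, and strings, i.e. finite sets of numbers; $|X|$ is the length of $X$, and $X(i)$ means $i\in X$). The theory $\mathbf{V\#L}$ is axiomatized by the basic axioms 2-BASIC for the symbols of the language together with * $\Sigma^B_0$-COMP: $\exists Y\,(|Y|\le y\wedge\forall x<y\,(Y(x)\leftrightarrow\varphi(x)))$ for every formula $\varphi$ all of whose quantifiers are bounded number quantifiers and in which $Y$ is not free; * String Multiplication: $\forall X,Y\,\exists Z\,(Z=X\cdot Y)$ for natural numbers written in binary; * Matrix Powering: $\forall X\,\forall t\,\exists Y\,(Y=X^t)$ for square matrices $X$ of binary integers and numbers $t$. Here $Z=X\cdot Y$ is expressed by the existence of a string coding the partial sums of the school method, and $Y=X^t$ by the existence of a string coding the sequence $X^0,\dots,X^t$ of powers (with the sums in the matrix products given by strings of partial sums). $\mathbf{V\#L}$ proves a formula if the formula is a logical consequence of these axioms. In $\mathbf{V\#L}$ the Pfaffian of a skew symmetric $2m\times2m$ integer matrix ($m\ge1$) is defined by the following Berkowitz-type algorithm.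 Let $J$ be the block diagonal matrix with diagonal blocks $\begin{pmatrix}0&1\\-1&0\end{pmatrix}$. For a skew symmetric $2d\times 2d$ matrix $$C=\begin{pmatrix}0&c_{12}&R\\-c_{12}&0&-{}^tS\\-{}^tR&S&M\end{pmatrix}$$ let $P_C$ be the $(d+1)\times d$ lower triangular Toeplitz matrix with first column $(1,\ c_{12},\ RJS,\ RJ(MJ)S,\ \dots,\ RJ(MJ)^{d-2}S)$. The coefficient vector $\bar p_C=(p_d,\dots,p_0)$ is $(1,c_{12})$ if $d=1$ and $\bar p_C=P_C\,\bar p_M$ if $d>1$; and $\mathrm{pf}(A)=p_0$ is the last entry of $\bar p_A$. **Theorem.** $\mathbf{V\#L}$ proves: for all numbers $n,k$ with $1\le k<2n$, if $I[k]$ denotes the $2n\times 2n$ identity matrix with rows $k$ and $k+1$ swapped, then the $4n\times4n$ matrix below exists, its Pfaffian is defined, and $$\mathrm{pf}\begin{pmatrix}0&I[k]\\-I[k]&0\end{pmatrix}=(-1)^{n+1}.$$ -/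

import Mathlib

universe u

namespace BoundedArith

/-! ## Two-sorted first-order logic over the language of bounded arithmetic

The language has a number sort and a string sort (strings are finite sets of numbers), the symbols
`0, 1, +, ·, ≤` on numbers, the length `|X|` of a string, membership `t ∈ X` (also written `X(t)`),
and equality on both sorts. Variables of each sort are named by natural numbers. -/

/-- Number terms. The only string terms are string variables. -/
inductive NumTerm : Type
  | var (x : ℕ)
  | zero
  | one
  | add (s t : NumTerm)
  | mul (s t : NumTerm)
  | len (X : ℕ)

/-- Formulas of two-sorted first-order logic. -/
inductive Formula : Type
  | eqNum (s t : NumTerm)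
  | eqStr (X Y : ℕ)
  | le (s t : NumTerm)
  | mem (t : NumTerm) (X : ℕ)
  | neg (φ : Formula)
  | and (φ ψ : Formula)
  | or (φ ψ : Formula)
  | allNum (x : ℕ) (φ : Formula)
  | exNum (x : ℕ) (φ : Formula)
  | allStr (X : ℕ) (φ : Formula)
  | exStr (X : ℕ) (φ : Formula)

/-- Structures for the language. The number sort is inhabited by `zero`. -/
structure TwoSorted : Type (u + 1) where
  Num : Type u
  Str : Type u
  str_nonempty : Nonempty Str
  zero : Num
  one : Num
  add : Num → Num → Num
  mul : Num → Num → Num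
  len : Str → Num
  le : Num → Num → Prop
  mem : Num → Str → Prop

/-- The value of a number term under an assignment `v`, `w` of the two sorts of variables. -/
def NumTerm.eval (M : TwoSorted.{u}) (v : ℕ → M.Num) (w : ℕ → M.Str) : NumTerm → M.Num
  | .var x => v x
  | .zero => M.zero
  | .one => M.one
  | .add s t => M.add (s.eval M v w) (t.eval M v w)
  | .mul s t => M.mul (s.eval M v w) (t.eval M v w)
  | .len X => M.len (w X)

/-- Tarski's truth definition. -/
def Formula.Sat (M : TwoSorted.{u}) : Formula → (ℕ → M.Num) → (ℕ → M.Str) → Prop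
  | .eqNum s t, v, w => s.eval M v w = t.eval M v w
  | .eqStr X Y, _, w => w X = w Y
  | .le s t, v, w => M.le (s.eval M v w) (t.eval M v w)
  | .mem t X, v, w => M.mem (t.eval M v w) (w X)
  | .neg φ, v, w => ¬ φ.Sat M v w
  | .and φ ψ, v, w => φ.Sat M v w ∧ ψ.Sat M v w
  | .or φ ψ, v, w => φ.Sat M v w ∨ ψ.Sat M v w
  | .allNum x φ, v, w => ∀ a : M.Num, φ.Sat M (Function.update v x a) w
  | .exNum x φ, v, w => ∃ a : M.Num, φ.Sat M (Function.update v x a) w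
  | .allStr X φ, v, w => ∀ A : M.Str, φ.Sat M v (Function.update w X A)
  | .exStr X φ, v, w => ∃ A : M.Str, φ.Sat M v (Function.update w X A)

/-- A formula is valid in `M` if it holds under all assignments (that is, its universal closure
holds). -/
def Formula.ValidIn (φ : Formula) (M : TwoSorted.{u}) : Prop :=
  ∀ (v : ℕ → M.Num) (w : ℕ → M.Str), φ.Sat M v w

/-- `T ⊢ φ`: `φ` belongs to the theory axiomatized by `T`, i.e. it is a logical consequence of `T`
(by the completeness theorem this is the same as having a formal proof from `T`). -/
def Proves (T : Set Formula) (φ : Formula) : Prop :=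
  ∀ M : TwoSorted.{u}, (∀ ψ ∈ T, ψ.ValidIn M) → φ.ValidIn M

/-! ### The class of bounded formulas without string quantifiers -/

/-- The number variable `x` occurs in the term. -/
def NumTerm.HasVar (x : ℕ) : NumTerm → Prop
  | .var y => y = x
  | .zero => False
  | .one => False
  | .add s t => s.HasVar x ∨ t.HasVar x
  | .mul s t => s.HasVar x ∨ t.HasVar x
  | .len _ => False

/-- The string variable `X` occurs in the term. -/
def NumTerm.HasStr (X : ℕ) : NumTerm → Prop
  | .var _ => False
  | .zero => False
  | .one => False
  | .add s t => s.HasStr X ∨ t.HasStr X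
  | .mul s t => s.HasStr X ∨ t.HasStr X
  | .len Y => Y = X

/-- The string variable `X` occurs free in the formula. -/
def Formula.FreeStr (X : ℕ) : Formula → Prop
  | .eqNum s t => s.HasStr X ∨ t.HasStr X
  | .eqStr Y Z => Y = X ∨ Z = X
  | .le s t => s.HasStr X ∨ t.HasStr X
  | .mem t Y => t.HasStr X ∨ Y = X
  | .neg φ => φ.FreeStr X
  | .and φ ψ => φ.FreeStr X ∨ ψ.FreeStr X
  | .or φ ψ => φ.FreeStr X ∨ ψ.FreeStr X
  | .allNum _ φ => φ.FreeStr X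
  | .exNum _ φ => φ.FreeStr X
  | .allStr Y φ => Y ≠ X ∧ φ.FreeStr X
  | .exStr Y φ => Y ≠ X ∧ φ.FreeStr X

/-- `φ → ψ`. -/
def Formula.imp (φ ψ : Formula) : Formula := .or (.neg φ) ψ

/-- `φ ↔ ψ`. -/
def Formula.iff (φ ψ : Formula) : Formula := .and (φ.imp ψ) (ψ.imp φ)

/-- `s < t`, that is, `s ≤ t` and `s ≠ t`. -/
def Formula.lt (s t : NumTerm) : Formula := .and (.le s t) (.neg (.eqNum s t))

/-- The formulas in which every quantifier is a bounded number quantifier `∀ x ≤ t` or `∃ x ≤ t`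
(with `x` not occurring in `t`); string variables may occur, but are not quantified. -/
inductive IsSigmaB0 : Formula → Prop
  | eqNum (s t : NumTerm) : IsSigmaB0 (.eqNum s t)
  | eqStr (X Y : ℕ) : IsSigmaB0 (.eqStr X Y)
  | le (s t : NumTerm) : IsSigmaB0 (.le s t)
  | mem (t : NumTerm) (X : ℕ) : IsSigmaB0 (.mem t X)
  | neg {φ : Formula} : IsSigmaB0 φ → IsSigmaB0 (.neg φ)
  | and {φ ψ : Formula} : IsSigmaB0 φ → IsSigmaB0 ψ → IsSigmaB0 (.and φ ψ)
  | or {φ ψ : Formula} : IsSigmaB0 φ → IsSigmaB0 ψ → IsSigmaB0 (.or φ ψ)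
  | allLe {x : ℕ} {t : NumTerm} {φ : Formula} : ¬ t.HasVar x → IsSigmaB0 φ →
      IsSigmaB0 (.allNum x (Formula.imp (.le (.var x) t) φ))
  | exLe {x : ℕ} {t : NumTerm} {φ : Formula} : ¬ t.HasVar x → IsSigmaB0 φ →
      IsSigmaB0 (.exNum x (.and (.le (.var x) t) φ))

/-- The comprehension axiom `∃ Y (|Y| ≤ y ∧ ∀ x < y (Y(x) ↔ φ))`. -/
def comprehension (x y Y : ℕ) (φ : Formula) : Formula :=
  .exStr Y (.and (.le (.len Y) (.var y))
    (.allNum x (Formula.imp (Formula.lt (.var x) (.var y)) (Formula.iff (.mem (.var x) Y) φ))))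

/-! ### Writing formulas with Lean binders

A `Form` is a formula scheme that receives the first unused names `a`, `b` of a number variable and
of a string variable; a quantifier takes the first unused name, so no variable is ever captured.
A closed `Form` becomes a formula by starting with the names `0`, `0`. -/

/-- Formulas that receive the first unused variable names. -/
abbrev Form : Type := ℕ → ℕ → Formula

namespace Form

def eq (s t : NumTerm) : Form := fun _ _ => .eqNum s t
def eqS (X Y : ℕ) : Form := fun _ _ => .eqStr X Y
def le (s t : NumTerm) : Form := fun _ _ => .le s t
def lt (s t : NumTerm) : Form := fun _ _ => Formula.lt s t
def mem (t : NumTerm) (X : ℕ) : Form := fun _ _ => .mem t X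
def not (p : Form) : Form := fun a b => .neg (p a b)
def and (p q : Form) : Form := fun a b => .and (p a b) (q a b)
def or (p q : Form) : Form := fun a b => .or (p a b) (q a b)
def imp (p q : Form) : Form := fun a b => Formula.imp (p a b) (q a b)
def iff (p q : Form) : Form := fun a b => Formula.iff (p a b) (q a b)

end Form

/-- `∀ x`, for a number variable. -/
def allN (f : NumTerm → Form) : Form := fun a b => .allNum a (f (.var a) (a + 1) b)
/-- `∃ x`, for a number variable. -/
def exN (f : NumTerm → Form) : Form := fun a b => .exNum a (f (.var a) (a + 1) b)
/-- `∀ X`, for a string variable. -/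
def allS (f : ℕ → Form) : Form := fun a b => .allStr b (f b a (b + 1))
/-- `∃ X`, for a string variable. -/
def exS (f : ℕ → Form) : Form := fun a b => .exStr b (f b a (b + 1))

/-- The formula denoted by a closed `Form`. -/
def Form.close (p : Form) : Formula := p 0 0

instance : Zero NumTerm := ⟨.zero⟩
instance : One NumTerm := ⟨.one⟩
instance : Add NumTerm := ⟨.add⟩
instance : Mul NumTerm := ⟨.mul⟩
instance : OfNat NumTerm 2 := ⟨.add .one .one⟩

infix:50 " =ₒ " => Form.eq
infix:50 " ≤ₒ " => Form.le
infix:50 " <ₒ " => Form.lt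
infix:50 " ∈ₒ " => Form.mem
prefix:max "¬ₒ" => Form.not
infixr:35 " ∧ₒ " => Form.and
infixr:30 " ∨ₒ " => Form.or
infixr:25 " →ₒ " => Form.imp
infix:20 " ↔ₒ " => Form.iff

/-! ### Basic axioms -/

/-- The axioms 2-BASIC: B1–B12, L1, L2 and extensionality for strings. -/
def basicAxioms : Set Formula :=
  { (allN fun x => ¬ₒ(x + 1 =ₒ 0)).close,
    (allN fun x => allN fun y => x + 1 =ₒ y + 1 →ₒ x =ₒ y).close,
    (allN fun x => x + 0 =ₒ x).close,
    (allN fun x => allN fun y => x + (y + 1) =ₒ (x + y) + 1).close,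
    (allN fun x => x * 0 =ₒ 0).close,
    (allN fun x => allN fun y => x * (y + 1) =ₒ x * y + x).close,
    (allN fun x => allN fun y => (x ≤ₒ y ∧ₒ y ≤ₒ x) →ₒ x =ₒ y).close,
    (allN fun x => allN fun y => x ≤ₒ x + y).close,
    (allN fun x => 0 ≤ₒ x).close,
    (allN fun x => allN fun y => x ≤ₒ y ∨ₒ y ≤ₒ x).close,
    (allN fun x => allN fun y => x ≤ₒ y ↔ₒ x <ₒ y + 1).close,
    (allN fun x => ¬ₒ(x =ₒ 0) →ₒ exN fun y => y ≤ₒ x ∧ₒ y + 1 =ₒ x).close,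
    (allS fun X => allN fun y => y ∈ₒ X →ₒ y <ₒ .len X).close,
    (allS fun X => allN fun y => y + 1 =ₒ .len X →ₒ y ∈ₒ X).close,
    (allS fun X => allS fun Y =>
      (NumTerm.len X =ₒ .len Y ∧ₒ allN fun i => i <ₒ .len X →ₒ (i ∈ₒ X ↔ₒ i ∈ₒ Y)) →ₒ
        Form.eqS X Y).close }

/-! ### Binary arithmetic on strings

`Bits` is a string given by its bits: a formula with one distinguished number argument. `Vec` and
`Mat` are vectors and matrices of such strings. All indices of vectors and matrices start at `1`. -/

abbrev Bits : Type := NumTerm → Form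
abbrev Vec : Type := NumTerm → Bits
abbrev Mat : Type := NumTerm → NumTerm → Bits

/-- The pairing function `⟨s, t⟩ = (s + t)(s + t + 1) + 2 t`. -/
def pair (s t : NumTerm) : NumTerm := (s + t) * (s + t + 1) + 2 * t

/-- The string `X` itself. -/
def str (X : ℕ) : Bits := fun b => b ∈ₒ X
/-- The `i`-th row `X^[i]` of the string `X`. -/
def row (X : ℕ) : Vec := fun i b => pair i b ∈ₒ X
/-- The matrix coded by the string `X`; its entry `(i, j)` has the bits `X(⟨⟨i, j⟩, b⟩)`. -/
def mat (X : ℕ) : Mat := fun i j b => pair (pair i j) b ∈ₒ X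
/-- The `s`-th matrix in the sequence of matrices coded by the string `X`. -/
def matSeq (X : ℕ) (s : NumTerm) : Mat := fun i j b => pair (pair (pair s i) j) b ∈ₒ X

/-- The bits agree. -/
def same (P Q : Bits) : Form := allN fun b => P b ↔ₒ Q b

/-- The number with binary digits `P` is positive (some digit is `1`). -/
def nonzero (P : Bits) : Form := exN fun b => P b

def xor (p q : Form) : Form := (p ∧ₒ ¬ₒq) ∨ₒ (¬ₒp ∧ₒ q)

/-- The carry into position `i` when the natural numbers `P` and `Q` are added in binary. -/
def carry (P Q : Bits) (i : NumTerm) : Form :=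
  exN fun k => k <ₒ i ∧ₒ P k ∧ₒ Q k ∧ₒ allN fun j => (k <ₒ j ∧ₒ j <ₒ i) →ₒ (P j ∨ₒ Q j)

/-- `P + Q = R` for natural numbers in binary. -/
def natAdd (P Q R : Bits) : Form :=
  allN fun i => R i ↔ₒ xor (xor (P i) (Q i)) (carry P Q i)

/-- `2 ^ i · P`. -/
def shift (P : Bits) (i : NumTerm) : Bits := fun b => exN fun c => b =ₒ i + c ∧ₒ P c

/-- The zero string; it represents the natural number and the integer `0`. -/
def zeroBits : Bits := fun _ => ¬ₒ(Form.eq 0 0)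

/-- `P · Q = R` for natural numbers in binary, by the school method: the partial sums
`W^[i] = ∑_{j < i} Q(j) · 2 ^ j · P` form a string `W`, and `R = W^[l]`, where `Q` has no digits from
position `l` on. -/
def natMul (P Q R : Bits) : Form :=
  exS fun W => exN fun l =>
    (allN fun i => l ≤ₒ i →ₒ ¬ₒ(Q i)) ∧ₒ
    same (row W 0) zeroBits ∧ₒ
    (allN fun i => i <ₒ l →ₒ natAdd (row W i) (fun b => Q i ∧ₒ shift P i b) (row W (i + 1))) ∧ₒ
    same R (row W l)

/-! ### Integers

An integer is a string whose bit `0` is the sign (`1` for negative), and whose bits `1, 2, …` are the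
binary digits of the absolute value; the sign of `0` is positive. -/

/-- The absolute value. -/
def mag (P : Bits) : Bits := fun b => P (b + 1)

/-- `P` represents an integer (there is no negative zero). -/
def isInt (P : Bits) : Form := P 0 →ₒ nonzero (mag P)

/-- The integer `1`. -/
def oneBits : Bits := fun b => b =ₒ 1

/-- The integer `(-1) ^ e`. -/
def negOnePow (e : NumTerm) : Bits := fun b =>
  b =ₒ 1 ∨ₒ (b =ₒ 0 ∧ₒ exN fun h => e =ₒ 2 * h + 1)

/-- The integer `-P`. -/
def negBits (P : Bits) : Bits := fun b =>
  (b =ₒ 0 ∧ₒ ¬ₒ(P 0) ∧ₒ nonzero (mag P)) ∨ₒ (¬ₒ(b =ₒ 0) ∧ₒ P b)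

/-- `P + Q = R` for integers. -/
def intAdd (P Q R : Bits) : Form :=
  isInt R ∧ₒ
    (((P 0 ↔ₒ Q 0) ∧ₒ (R 0 ↔ₒ P 0) ∧ₒ natAdd (mag P) (mag Q) (mag R)) ∨ₒ
      (¬ₒ(P 0 ↔ₒ Q 0) ∧ₒ
        (((R 0 ↔ₒ P 0) ∧ₒ natAdd (mag R) (mag Q) (mag P)) ∨ₒ
          ((R 0 ↔ₒ Q 0) ∧ₒ natAdd (mag R) (mag P) (mag Q)))))

/-- `P · Q = R` for integers. -/
def intMul (P Q R : Bits) : Form :=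
  isInt R ∧ₒ natMul (mag P) (mag Q) (mag R) ∧ₒ
    (nonzero (mag R) →ₒ (R 0 ↔ₒ xor (P 0) (Q 0)))

/-! ### Integer matrices -/

/-- `1 ≤ i ≤ l`. -/
def inRange (i l : NumTerm) : Form := 1 ≤ₒ i ∧ₒ i ≤ₒ l

/-- `R = ∑_{1 ≤ r ≤ l} x_r · y_r`, with a string `T` of partial sums. -/
def dot (l : NumTerm) (x y : Vec) (R : Bits) : Form :=
  exS fun T =>
    same (row T 0) zeroBits ∧ₒ
    (allN fun r => r <ₒ l →ₒ exS fun U =>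
      intMul (x (r + 1)) (y (r + 1)) (str U) ∧ₒ intAdd (row T r) (str U) (row T (r + 1))) ∧ₒ
    same R (row T l)

/-- `X Y = Z` for an `a × b` matrix `X`, a `b × c` matrix `Y` and an `a × c` matrix `Z`. -/
def matMul (a b c : NumTerm) (X Y Z : Mat) : Form :=
  allN fun i => allN fun j => (inRange i a ∧ₒ inRange j c) →ₒ
    dot b (fun r => X i r) (fun r => Y r j) (Z i j)

/-- The `a × b` matrices `X` and `Y` are equal. -/
def sameMat (a b : NumTerm) (X Y : Mat) : Form :=
  allN fun i => allN fun j => (inRange i a ∧ₒ inRange j b) →ₒ same (X i j) (Y i j)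

/-- All entries of the `a × b` matrix `X` represent integers. -/
def isIntMat (a b : NumTerm) (X : Mat) : Form :=
  allN fun i => allN fun j => (inRange i a ∧ₒ inRange j b) →ₒ isInt (X i j)

/-- The identity matrix. -/
def idMat : Mat := fun i j b => i =ₒ j ∧ₒ oneBits b

/-- `Y = X ^ t` for `m × m` matrices, with a string `W` coding the sequence of powers
`X ^ 0, …, X ^ t`. -/
def matPow (m : NumTerm) (X : Mat) (t : NumTerm) (Y : Mat) : Form :=
  exS fun W =>
    sameMat m m (matSeq W 0) idMat ∧ₒ
    (allN fun s => s <ₒ t →ₒ matMul m m m (matSeq W s) X (matSeq W (s + 1))) ∧ₒ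
    sameMat m m Y (matSeq W t)

/-! ### The theory V#L -/

/-- String multiplication: `∀ X, Y ∃ Z (Z = X · Y)`. -/
def stringMultiplication : Formula :=
  (allS fun X => allS fun Y => exS fun Z => natMul (str X) (str Y) (str Z)).close

/-- Matrix powering: `∀ X ∀ t ∃ Y (Y = X ^ t)`, for `m × m` integer matrices `X`. -/
def matrixPowering : Formula :=
  (allN fun m => allN fun t => allS fun X => isIntMat m m (mat X) →ₒ
    exS fun Y => matPow m (mat X) t (mat Y)).close

/-- The theory V#L. -/
def VSharpL : Set Formula :=
  basicAxioms ∪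
  {ψ | ∃ (x y Y : ℕ) (φ : Formula), x ≠ y ∧ IsSigmaB0 φ ∧ ¬ φ.FreeStr Y ∧
    ψ = comprehension x y Y φ} ∪
  {stringMultiplication, matrixPowering}

/-! ### The Pfaffian in V#L, by the Berkowitz-type algorithm -/

/-- The matrix `J`, block diagonal with blocks `(0 1; -1 0)`. -/
def matJ : Mat := fun i j b =>
  (exN fun h => i =ₒ 2 * h + 1 ∧ₒ j =ₒ 2 * h + 2 ∧ₒ oneBits b) ∨ₒ
  (exN fun h => i =ₒ 2 * h + 2 ∧ₒ j =ₒ 2 * h + 1 ∧ₒ negBits oneBits b)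

/-- The matrix obtained by removing the first `p` rows and columns. -/
def minor (p : NumTerm) (A : Mat) : Mat := fun i j => A (p + i) (p + j)

/-- `Z = R J (M J) ^ t S`, for the block decomposition
`C = (0, c₁₂, R; -c₁₂, 0, -Sᵀ; -Rᵀ, S, M)` where `M` is `e × e`. -/
def berkowitzEntry (e : NumTerm) (C : Mat) (t : NumTerm) (Z : Bits) : Form :=
  exS fun MJ => exS fun G => exS fun RJ => exS fun V =>
    matMul e e e (minor 2 C) matJ (mat MJ) ∧ₒ
    matPow e (mat MJ) t (mat G) ∧ₒ
    matMul 1 e e (fun _ j => C 1 (2 + j)) matJ (mat RJ) ∧ₒ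
    matMul 1 e e (mat RJ) (mat G) (mat V) ∧ₒ
    matMul 1 e 1 (mat V) (fun i _ => C (2 + i) 2) (fun _ _ => Z)

/-- `P` is the `(d + 1) × d` matrix `P_C` of the algorithm for the `2d × 2d` matrix `C`: it is lower
triangular Toeplitz, with first column `1, c₁₂, R J S, R J (M J) S, …, R J (M J) ^ (d - 2) S`. -/
def berkowitzMat (d : NumTerm) (C P : Mat) : Form :=
  allN fun i => allN fun j => (inRange i (d + 1) ∧ₒ inRange j d) →ₒ
    ((i <ₒ j →ₒ same (P i j) zeroBits) ∧ₒ
     (i =ₒ j →ₒ same (P i j) oneBits) ∧ₒ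
     (i =ₒ j + 1 →ₒ same (P i j) (C 1 2)) ∧ₒ
     (allN fun t => allN fun e => (i =ₒ j + 2 + t ∧ₒ e + 2 =ₒ 2 * d) →ₒ
        berkowitzEntry e C t (P i j)))

/-- `Z` is the Pfaffian of the `2m × 2m` skew symmetric matrix `A` (`m ≥ 1`). The string `Q` codes
the Pfaffian coefficients: its row `s` is the coefficient vector `(p_d, …, p_0)` (`d = m - s`) of
the matrix `C_s` that is left of `A` without the first `2s` rows and columns. It is `(1, a₁₂)` for a
`2 × 2` matrix, and the product of `P_{C_s}` with the coefficient vector of `C_{s+1}` otherwise.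
The Pfaffian is the last coefficient of `C_0 = A`. -/
def pfaffian (m : NumTerm) (A : Mat) (Z : Bits) : Form :=
  exS fun Q =>
    (allN fun s => s + 1 =ₒ m →ₒ
      (same (mat Q s 1) oneBits ∧ₒ same (mat Q s 2) (minor (2 * s) A 1 2))) ∧ₒ
    (allN fun s => allN fun d => (s + d =ₒ m ∧ₒ 2 ≤ₒ d) →ₒ
      exS fun P =>
        berkowitzMat d (minor (2 * s) A) (mat P) ∧ₒ
        matMul (d + 1) d 1 (mat P) (fun i _ => mat Q (s + 1) i) (fun i _ => mat Q s i)) ∧ₒ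
    same Z (mat Q 0 (m + 1))

/-! ### The claim -/

/-- The matrix `I[k]`: the identity matrix with the rows `k` and `k + 1` swapped. -/
def swapMat (k : NumTerm) : Mat := fun i j b =>
  (i =ₒ k ∧ₒ idMat (k + 1) j b) ∨ₒ
  (i =ₒ k + 1 ∧ₒ idMat k j b) ∨ₒ
  (¬ₒ(i =ₒ k) ∧ₒ ¬ₒ(i =ₒ k + 1) ∧ₒ idMat i j b)

/-- The block matrix `(0 X; Y 0)` with blocks of size `N × N`. -/
def antidiagBlock (N : NumTerm) (X Y : Mat) : Mat := fun i j b =>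
  (exN fun h => i ≤ₒ N ∧ₒ 1 ≤ₒ h ∧ₒ j =ₒ N + h ∧ₒ X i h b) ∨ₒ
  (exN fun h => j ≤ₒ N ∧ₒ 1 ≤ₒ h ∧ₒ i =ₒ N + h ∧ₒ Y h j b)

/-- The matrix `(0 I[k]; -I[k] 0)` of size `4n × 4n`. -/
def blockSwap (n k : NumTerm) : Mat :=
  antidiagBlock (2 * n) (swapMat k) (fun i j => negBits (swapMat k i j))

/-- The sentence: for all `n`, `k` with `1 ≤ k < 2n`, the matrix `(0 I[k]; -I[k] 0)` exists (as a
string), its Pfaffian is defined, and the Pfaffian is `(-1) ^ (n + 1)`. -/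
def pfaffianBlockSwap : Formula :=
  (allN fun n => allN fun k => (1 ≤ₒ k ∧ₒ k <ₒ 2 * n) →ₒ
    ((exS fun A => sameMat (2 * (2 * n)) (2 * (2 * n)) (mat A) (blockSwap n k)) ∧ₒ
     (allS fun A => sameMat (2 * (2 * n)) (2 * (2 * n)) (mat A) (blockSwap n k) →ₒ
        ((exS fun Z => pfaffian (2 * n) (mat A) (str Z)) ∧ₒ
         (allS fun Z => pfaffian (2 * n) (mat A) (str Z) →ₒ
            same (str Z) (negOnePow (n + 1))))))).close

end BoundedArith

set_option linter.unusedSectionVars false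

/-! Logical consequence is checked in an arbitrary model `M` of the theory, where the sentence
unfolds to `PfaffianBlockSwap M`. Comprehension for bounded formulas yields bounded induction, hence
the ordered semiring of numbers; beyond that, only matrix powering is needed. The argument is
arranged so that every product evaluated explicitly has a factor 0, 1 or -1, and so that no sum of
two large integers ever has to be evaluated.

Put N = 2n, let τ be the transposition of k and k + 1, and let C_s be what is left of the matrix
without its first 2s rows and columns. For s ≥ n this is zero. For s < n one has c₁₂ = 0, the row R
has a single 1 in column N + τ(2s+1), and the column S a single -1 in row N + τ(2s+2), in the
numbering of the full matrix. Multiplication by J and by M J sends a unit row to plus or minus a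
unit row or to 0, so R J (M J)^t S is found by following one row. A row N + q has its only entry in
column τ(q), and dies if that column has been removed. The outcome (`berkowitzEntry_iff_stageEntry`)
is nonzero for at most one t: 1 at t = 0 if k = 2s+1; nothing if k = 2s; -1 at t = 2 if k = 2s+2,
the path running through 2s+3 and 2s+4; and -1 at t = 0 otherwise.

So the Toeplitz matrix of stage s is the identity plus ε_s times one lower diagonal at distance δ_s,
which is 2 or 4 (`berkowitzMat_iff`), and the Pfaffian is the last coordinate produced by p_s(i) =
p_{s+1}(i) + ε_s p_{s+1}(i - δ_s) (`isPfaffian_iff`). This multiplies the polynomials 1 + ε_s x^δ_s.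
The middle coefficients grow like binomial coefficients, but the last nonzero one is the product of
the nonzero ε_s, at a position given by the sum of their δ_s, which is N. Among the factors there
are always n - 1 signs -1: for odd k one stage has sign 1, for even k the stage k/2 drops out and
the stage treated after it shifts by 4. This gives (-1)^(n+1) (`IsRecursion.last_eq`).

That the coefficient vectors exist is a separate matter, since their middle entries are not given by
a bounded formula. The transposed Toeplitz matrices are placed above the diagonal of one large block
matrix, and the first rows of its powers list the vectors (`exists_isRecursion`). The sums in the
power and in the recursion differ in length and in the order of the factors, but have at most two
nonzero terms each, so `dot_iff_intAdd` turns both into the same single addition. -/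

namespace BoundedArith

/-! ### The meaning of the formulas in a structure -/

/-- Implication, in the form in which it is built into formulas. -/
def rimp (p q : Prop) : Prop := ¬ p ∨ q
/-- Equivalence, in the form in which it is built into formulas. -/
def riff (p q : Prop) : Prop := rimp p q ∧ rimp q p

@[simp] theorem rimp_iff (p q : Prop) : rimp p q ↔ (p → q) := imp_iff_not_or.symm
@[simp] theorem riff_iff (p q : Prop) : riff p q ↔ (p ↔ q) := by
  simp only [riff, rimp_iff]; exact iff_def.symm

section Semantics
variable {M : TwoSorted.{u}}

instance : Zero M.Num := ⟨M.zero⟩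
instance : One M.Num := ⟨M.one⟩
instance : Add M.Num := ⟨M.add⟩
instance : Mul M.Num := ⟨M.mul⟩
instance : LE M.Num := ⟨M.le⟩
instance : LT M.Num := ⟨fun a b => M.le a b ∧ ¬ a = b⟩
instance : Membership M.Num M.Str := ⟨fun X a => M.mem a X⟩

variable (M) in
/-- Digit sequences of numbers in binary, inside a structure. -/
abbrev Digits : Type u := M.Num → Prop

def npair (s t : M.Num) : M.Num := (s + t) * (s + t + 1) + (1 + 1) * t

def dStr (X : M.Str) : Digits M := fun b => b ∈ X
def dRow (X : M.Str) (i : M.Num) : Digits M := fun b => npair i b ∈ X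
def dMat (X : M.Str) (i j : M.Num) : Digits M := fun b => npair (npair i j) b ∈ X
def dMatSeq (X : M.Str) (s i j : M.Num) : Digits M :=
  fun b => npair (npair (npair s i) j) b ∈ X

def Same (P Q : Digits M) : Prop := ∀ b, riff (P b) (Q b)
def Nonzero (P : Digits M) : Prop := ∃ b, P b
def rxor (p q : Prop) : Prop := (p ∧ ¬ q) ∨ (¬ p ∧ q)
def Carry (P Q : Digits M) (i : M.Num) : Prop :=
  ∃ k, k < i ∧ P k ∧ Q k ∧ ∀ j, rimp (k < j ∧ j < i) (P j ∨ Q j)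
def NatAdd (P Q R : Digits M) : Prop :=
  ∀ i, riff (R i) (rxor (rxor (P i) (Q i)) (Carry P Q i))
def dShift (P : Digits M) (i : M.Num) : Digits M := fun b => ∃ c, b = i + c ∧ P c
def dZero : Digits M := fun _ => ¬ ((0 : M.Num) = 0)
def NatMul (P Q R : Digits M) : Prop :=
  ∃ W : M.Str, ∃ l : M.Num,
    (∀ i, rimp (l ≤ i) (¬ Q i)) ∧ Same (dRow W 0) dZero ∧
    (∀ i, rimp (i < l) (NatAdd (dRow W i) (fun b => Q i ∧ dShift P i b) (dRow W (i + 1)))) ∧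
    Same R (dRow W l)

def dMag (P : Digits M) : Digits M := fun b => P (b + 1)
def IsInt (P : Digits M) : Prop := rimp (P 0) (Nonzero (dMag P))
def dOne : Digits M := fun b => b = 1
def dNegOnePow (e : M.Num) : Digits M := fun b =>
  b = 1 ∨ (b = 0 ∧ ∃ h, e = (1 + 1) * h + 1)
def dNeg (P : Digits M) : Digits M := fun b =>
  (b = 0 ∧ ¬ P 0 ∧ Nonzero (dMag P)) ∨ (¬ b = 0 ∧ P b)
def IntAdd (P Q R : Digits M) : Prop :=
  IsInt R ∧
    ((riff (P 0) (Q 0) ∧ riff (R 0) (P 0) ∧ NatAdd (dMag P) (dMag Q) (dMag R)) ∨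
      (¬ riff (P 0) (Q 0) ∧
        ((riff (R 0) (P 0) ∧ NatAdd (dMag R) (dMag Q) (dMag P)) ∨
          (riff (R 0) (Q 0) ∧ NatAdd (dMag R) (dMag P) (dMag Q)))))
def IntMul (P Q R : Digits M) : Prop :=
  IsInt R ∧ NatMul (dMag P) (dMag Q) (dMag R) ∧
    rimp (Nonzero (dMag R)) (riff (R 0) (rxor (P 0) (Q 0)))
def InRange (i l : M.Num) : Prop := 1 ≤ i ∧ i ≤ l
def Dot (l : M.Num) (x y : M.Num → Digits M) (R : Digits M) : Prop :=
  ∃ T : M.Str, Same (dRow T 0) dZero ∧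
    (∀ r, rimp (r < l) (∃ U : M.Str,
      IntMul (x (r + 1)) (y (r + 1)) (dStr U) ∧ IntAdd (dRow T r) (dStr U) (dRow T (r + 1)))) ∧
    Same R (dRow T l)
abbrev DMat (M : TwoSorted.{u}) := M.Num → M.Num → Digits M
def MatMul (a b c : M.Num) (X Y Z : DMat M) : Prop :=
  ∀ i j, rimp (InRange i a ∧ InRange j c) (Dot b (fun r => X i r) (fun r => Y r j) (Z i j))
def SameMat (a b : M.Num) (X Y : DMat M) : Prop :=
  ∀ i j, rimp (InRange i a ∧ InRange j b) (Same (X i j) (Y i j))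
def IsIntMat (a b : M.Num) (X : DMat M) : Prop :=
  ∀ i j, rimp (InRange i a ∧ InRange j b) (IsInt (X i j))
def dIdMat : DMat M := fun i j b => i = j ∧ dOne b
def MatPow (m : M.Num) (X : DMat M) (t : M.Num) (Y : DMat M) : Prop :=
  ∃ W : M.Str, SameMat m m (dMatSeq W 0) dIdMat ∧
    (∀ s, rimp (s < t) (MatMul m m m (dMatSeq W s) X (dMatSeq W (s + 1)))) ∧
    SameMat m m Y (dMatSeq W t)
def dMatJ : DMat M := fun i j b =>
  (∃ h, i = (1 + 1) * h + 1 ∧ j = (1 + 1) * h + (1 + 1) ∧ dOne b) ∨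
  (∃ h, i = (1 + 1) * h + (1 + 1) ∧ j = (1 + 1) * h + 1 ∧ dNeg dOne b)
def dMinor (p : M.Num) (A : DMat M) : DMat M := fun i j => A (p + i) (p + j)
def BerkowitzEntry (e : M.Num) (C : DMat M) (t : M.Num) (Z : Digits M) : Prop :=
  ∃ MJ G RJ V : M.Str,
    MatMul e e e (dMinor (1 + 1) C) dMatJ (dMat MJ) ∧
    MatPow e (dMat MJ) t (dMat G) ∧
    MatMul 1 e e (fun _ j => C 1 ((1 + 1) + j)) dMatJ (dMat RJ) ∧
    MatMul 1 e e (dMat RJ) (dMat G) (dMat V) ∧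
    MatMul 1 e 1 (dMat V) (fun i _ => C ((1 + 1) + i) (1 + 1)) (fun _ _ => Z)
def BerkowitzMat (d : M.Num) (C P : DMat M) : Prop :=
  ∀ i j, rimp (InRange i (d + 1) ∧ InRange j d)
    (rimp (i < j) (Same (P i j) dZero) ∧
     rimp (i = j) (Same (P i j) dOne) ∧
     rimp (i = j + 1) (Same (P i j) (C 1 (1 + 1))) ∧
     (∀ t e, rimp (i = j + (1 + 1) + t ∧ e + (1 + 1) = (1 + 1) * d)
        (BerkowitzEntry e C t (P i j))))
def IsPfaffian (m : M.Num) (A : DMat M) (Z : Digits M) : Prop :=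
  ∃ Q : M.Str,
    (∀ s, rimp (s + 1 = m)
      (Same (dMat Q s 1) dOne ∧ Same (dMat Q s (1 + 1)) (dMinor ((1 + 1) * s) A 1 (1 + 1)))) ∧
    (∀ s d, rimp (s + d = m ∧ 1 + 1 ≤ d)
      (∃ P : M.Str, BerkowitzMat d (dMinor ((1 + 1) * s) A) (dMat P) ∧
        MatMul (d + 1) d 1 (dMat P) (fun i _ => dMat Q (s + 1) i) (fun i _ => dMat Q s i))) ∧
    Same Z (dMat Q 0 (m + 1))
def dSwapMat (k : M.Num) : DMat M := fun i j b =>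
  (i = k ∧ dIdMat (k + 1) j b) ∨
  (i = k + 1 ∧ dIdMat k j b) ∨
  (¬ i = k ∧ ¬ i = k + 1 ∧ dIdMat i j b)
def dAntidiag (N : M.Num) (X Y : DMat M) : DMat M := fun i j b =>
  (∃ h, i ≤ N ∧ 1 ≤ h ∧ j = N + h ∧ X i h b) ∨
  (∃ h, j ≤ N ∧ 1 ≤ h ∧ i = N + h ∧ Y h j b)
def dBlockSwap (n k : M.Num) : DMat M :=
  dAntidiag ((1 + 1) * n) (dSwapMat k) (fun i j => dNeg (dSwapMat k i j))

variable (M) in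
def PfaffianBlockSwap : Prop :=
  ∀ n k : M.Num, rimp (1 ≤ k ∧ k < (1 + 1) * n)
    ((∃ A : M.Str, SameMat ((1 + 1) * ((1 + 1) * n)) ((1 + 1) * ((1 + 1) * n)) (dMat A)
        (dBlockSwap n k)) ∧
     (∀ A : M.Str, rimp (SameMat ((1 + 1) * ((1 + 1) * n)) ((1 + 1) * ((1 + 1) * n)) (dMat A)
          (dBlockSwap n k))
        ((∃ Z : M.Str, IsPfaffian ((1 + 1) * n) (dMat A) (dStr Z)) ∧
         (∀ Z : M.Str, rimp (IsPfaffian ((1 + 1) * n) (dMat A) (dStr Z))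
            (Same (dStr Z) (dNegOnePow (n + 1)))))))

-- The relations above copy the formulas connective by connective, with `rimp` and `riff` in place
-- of → and ↔, so Tarski's definition unfolds to them definitionally and all variable names
-- disappear here.
set_option maxRecDepth 100000 in
theorem sat_pfaffianBlockSwap (v : ℕ → M.Num) (w : ℕ → M.Str) :
    pfaffianBlockSwap.Sat M v w ↔ PfaffianBlockSwap M := by
  rfl

theorem sat_matrixPowering (v : ℕ → M.Num) (w : ℕ → M.Str) :
    matrixPowering.Sat M v w ↔
      ∀ (m t : M.Num) (X : M.Str), rimp (IsIntMat m m (dMat X))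
        (∃ Y : M.Str, MatPow m (dMat X) t (dMat Y)) := by
  rfl

end Semantics

/-! ### Definability by bounded formulas -/

/-- Models of the theory. -/
class VModel (M : TwoSorted.{u}) : Prop where
  valid : ∀ ψ ∈ VSharpL, ψ.ValidIn M

section Definability
variable {M : TwoSorted.{u}}

/-- Contexts: finite lists of numbers, in the form of nested pairs. -/
class Ctx (M : outParam TwoSorted.{u}) (Γ : Type u) where
  depth : ℕ
  enc : Γ → ℕ → M.Num

instance : Ctx M M.Num := ⟨1, fun z _ => z⟩
instance {Γ : Type u} [Ctx M Γ] : Ctx M (Γ × M.Num) :=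
  ⟨Ctx.depth Γ + 1, fun z i => if i = Ctx.depth Γ then z.2 else Ctx.enc z.1 i⟩

/-- The assignment `v` interprets the context variables, which have even names, by `z`, and the
parameters, which have odd names, by `pn`. -/
def Agree {Γ : Type u} [Ctx M Γ] (pn : ℕ → M.Num) (z : Γ) (v : ℕ → M.Num) : Prop :=
  (∀ i < Ctx.depth Γ, v (2 * i) = Ctx.enc z i) ∧ ∀ i, v (2 * i + 1) = pn i

variable {Γ : Type u} [Ctx M Γ]

/-- Functions given by terms with parameters. -/
class DTerm (f : Γ → M.Num) : Prop where
  out : ∃ S : List M.Num, ∀ pn : ℕ → M.Num, (∀ c ∈ S, ∃ i, pn i = c) →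
    ∃ t : NumTerm, (∀ i, Ctx.depth Γ ≤ i → ¬ t.HasVar (2 * i)) ∧ (∀ X, ¬ t.HasStr X) ∧
      ∀ z v w, Agree pn z v → t.eval M v w = f z

/-- Predicates given by bounded formulas with parameters. -/
class Def (p : Γ → Prop) : Prop where
  out : ∃ (S : List M.Num) (L : List M.Str), ∀ (pn : ℕ → M.Num) (pw : ℕ → M.Str),
    (∀ c ∈ S, ∃ i, pn i = c) → (∀ c ∈ L, ∃ i, pw i = c) →
    ∃ φ : Formula, IsSigmaB0 φ ∧ ¬ φ.FreeStr 0 ∧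
      ∀ z v w, Agree pn z v → (∀ i, w (i + 1) = pw i) → (φ.Sat M v w ↔ p z)

instance DTerm.const (c : M.Num) : DTerm (fun _ : Γ => c) := by
  refine ⟨[c], fun pn h => ?_⟩
  obtain ⟨i, hi⟩ := h c (by simp)
  refine ⟨.var (2 * i + 1), fun j _ => ?_, fun X => id, fun z v w hv => ?_⟩
  · simp only [NumTerm.HasVar]; omega
  · simp [NumTerm.eval, hv.2, hi]

instance DTerm.self : DTerm (fun z : M.Num => z) := by
  refine ⟨[], fun pn _ => ⟨.var 0, fun j hj => ?_, fun X => id, fun z v w hv => ?_⟩⟩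
  · simp only [NumTerm.HasVar]; change 1 ≤ j at hj; omega
  · exact hv.1 0 Nat.zero_lt_one

instance DTerm.snd : DTerm (fun z : Γ × M.Num => z.2) := by
  refine ⟨[], fun pn _ => ⟨.var (2 * Ctx.depth Γ), fun j hj => ?_, fun X => id,
    fun z v w hv => ?_⟩⟩
  · simp only [NumTerm.HasVar]; change Ctx.depth Γ + 1 ≤ j at hj; omega
  · refine (hv.1 _ (Nat.lt_succ_self _)).trans ?_
    simp [Ctx.enc]

theorem Agree.fst {pn : ℕ → M.Num} {z : Γ × M.Num} {v : ℕ → M.Num} (h : Agree pn z v) :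
    Agree pn z.1 v := by
  refine ⟨fun i hi => (h.1 i (Nat.lt_succ_of_lt hi)).trans ?_, h.2⟩
  simp [Ctx.enc, hi.ne]

theorem Agree.update {pn : ℕ → M.Num} {z : Γ} {v : ℕ → M.Num} (h : Agree pn z v) (a : M.Num) :
    Agree pn (z, a) (Function.update v (2 * Ctx.depth Γ) a) := by
  refine ⟨fun i hi => ?_, fun i => ?_⟩
  · change i < Ctx.depth Γ + 1 at hi
    by_cases h' : i = Ctx.depth Γ
    · subst h'; simp [Ctx.enc]
    · rw [Function.update_of_ne (by omega), h.1 i (by omega)]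
      simp [Ctx.enc, h']
  · rw [Function.update_of_ne (by omega), h.2]

theorem DTerm.fst {f : Γ → M.Num} (hf : DTerm f) : DTerm (fun z : Γ × M.Num => f z.1) := by
  obtain ⟨S, h⟩ := hf.out
  refine ⟨S, fun pn hp => ?_⟩
  obtain ⟨t, h1, h2, h3⟩ := h pn hp
  exact ⟨t, fun i hi => h1 i (Nat.le_of_succ_le hi), h2, fun z v w hv => h3 _ _ _ hv.fst⟩

section
variable {Γ : Type u} [Ctx M Γ]
instance : DTerm (fun z : M.Num × M.Num => z.1) := DTerm.self.fst
instance : DTerm (fun z : (M.Num × M.Num) × M.Num => z.1.1) := DTerm.self.fst.fst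
instance : DTerm (fun z : ((M.Num × M.Num) × M.Num) × M.Num => z.1.1.1) := DTerm.self.fst.fst.fst
instance : DTerm (fun z : (Γ × M.Num) × M.Num => z.1.2) := DTerm.snd.fst
instance : DTerm (fun z : ((Γ × M.Num) × M.Num) × M.Num => z.1.1.2) := DTerm.snd.fst.fst
instance : DTerm (fun z : (((Γ × M.Num) × M.Num) × M.Num) × M.Num => z.1.1.1.2) :=
  DTerm.snd.fst.fst.fst
instance : DTerm (fun z : ((((Γ × M.Num) × M.Num) × M.Num) × M.Num) × M.Num => z.1.1.1.1.2) :=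
  DTerm.snd.fst.fst.fst.fst
instance : DTerm (fun z : (((((Γ × M.Num) × M.Num) × M.Num) × M.Num) × M.Num) × M.Num =>
    z.1.1.1.1.1.2) := DTerm.snd.fst.fst.fst.fst.fst
instance : DTerm (fun z : ((((((Γ × M.Num) × M.Num) × M.Num) × M.Num) × M.Num) × M.Num) × M.Num =>
    z.1.1.1.1.1.1.2) := DTerm.snd.fst.fst.fst.fst.fst.fst
end

/-- `DTerm` demands a term for every naming that covers the listed parameters. Hence both parts can
be built over one naming that covers the concatenated lists, and no renaming of variables is ever
necessary. -/
theorem DTerm.map₂ {f g : Γ → M.Num} (hf : DTerm f) (hg : DTerm g)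
    (o : NumTerm → NumTerm → NumTerm) (o' : M.Num → M.Num → M.Num)
    (h1 : ∀ s t x, (o s t).HasVar x ↔ s.HasVar x ∨ t.HasVar x)
    (h2 : ∀ s t x, (o s t).HasStr x ↔ s.HasStr x ∨ t.HasStr x)
    (h3 : ∀ s t v w, (o s t).eval M v w = o' (s.eval M v w) (t.eval M v w)) :
    DTerm (fun z => o' (f z) (g z)) := by
  obtain ⟨S, hf⟩ := hf.out
  obtain ⟨S', hg⟩ := hg.out
  refine ⟨S ++ S', fun pn hp => ?_⟩
  obtain ⟨s, a1, a2, a3⟩ := hf pn fun c hc => hp c (by simp [hc])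
  obtain ⟨t, b1, b2, b3⟩ := hg pn fun c hc => hp c (by simp [hc])
  refine ⟨o s t, fun i hi => ?_, fun X => ?_, fun z v w hv => ?_⟩
  · rw [h1]; exact fun h => h.elim (a1 i hi) (b1 i hi)
  · rw [h2]; exact fun h => h.elim (a2 X) (b2 X)
  · rw [h3, a3 z v w hv, b3 z v w hv]

instance DTerm.add {f g : Γ → M.Num} [hf : DTerm f] [hg : DTerm g] :
    DTerm (fun z => f z + g z) :=
  hf.map₂ hg .add M.add (fun _ _ _ => Iff.rfl) (fun _ _ _ => Iff.rfl) (fun _ _ _ _ => rfl)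

instance DTerm.mul {f g : Γ → M.Num} [hf : DTerm f] [hg : DTerm g] :
    DTerm (fun z => f z * g z) :=
  hf.map₂ hg .mul M.mul (fun _ _ _ => Iff.rfl) (fun _ _ _ => Iff.rfl) (fun _ _ _ _ => rfl)

instance DTerm.npair {f g : Γ → M.Num} [DTerm f] [DTerm g] :
    DTerm (fun z => npair (f z) (g z)) := by
  unfold BoundedArith.npair; infer_instance

theorem Def.of_terms {f g : Γ → M.Num} (hf : DTerm f) (hg : DTerm g)
    (o : NumTerm → NumTerm → Formula) (o' : M.Num → M.Num → Prop)
    (h1 : ∀ s t, IsSigmaB0 (o s t))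
    (h2 : ∀ s t X, (o s t).FreeStr X ↔ s.HasStr X ∨ t.HasStr X)
    (h3 : ∀ s t v w, (o s t).Sat M v w ↔ o' (s.eval M v w) (t.eval M v w)) :
    Def (fun z => o' (f z) (g z)) := by
  obtain ⟨S, hf⟩ := hf.out
  obtain ⟨S', hg⟩ := hg.out
  refine ⟨S ++ S', [], fun pn pw hp _ => ?_⟩
  obtain ⟨s, a1, a2, a3⟩ := hf pn fun c hc => hp c (by simp [hc])
  obtain ⟨t, b1, b2, b3⟩ := hg pn fun c hc => hp c (by simp [hc])
  refine ⟨o s t, h1 s t, ?_, fun z v w hv _ => ?_⟩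
  · rw [h2]; exact fun h => h.elim (a2 0) (b2 0)
  · rw [h3, a3 z v w hv, b3 z v w hv]

instance Def.eq {f g : Γ → M.Num} [hf : DTerm f] [hg : DTerm g] : Def (fun z => f z = g z) :=
  .of_terms hf hg .eqNum (· = ·) .eqNum (fun _ _ _ => Iff.rfl) (fun _ _ _ _ => Iff.rfl)

instance Def.le {f g : Γ → M.Num} [hf : DTerm f] [hg : DTerm g] : Def (fun z => f z ≤ g z) :=
  .of_terms hf hg .le M.le .le (fun _ _ _ => Iff.rfl) (fun _ _ _ _ => Iff.rfl)

instance Def.mem {f : Γ → M.Num} [hf : DTerm f] (X : M.Str) : Def (fun z => f z ∈ X) := by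
  obtain ⟨S, hf⟩ := hf.out
  refine ⟨S, [X], fun pn pw hp hw => ?_⟩
  obtain ⟨s, a1, a2, a3⟩ := hf pn hp
  obtain ⟨i, hi⟩ := hw X (by simp)
  refine ⟨.mem s (i + 1), .mem _ _, ?_, fun z v w hv hw' => ?_⟩
  · simp [Formula.FreeStr, a2]
  · simp only [Formula.Sat, a3 z v w hv, hw', hi]; rfl

instance Def.not {p : Γ → Prop} [hp : Def p] : Def (fun z => ¬ p z) := by
  obtain ⟨S, L, hp⟩ := hp.out
  refine ⟨S, L, fun pn pw h h' => ?_⟩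
  obtain ⟨φ, h1, h2, h3⟩ := hp pn pw h h'
  exact ⟨.neg φ, .neg h1, h2, fun z v w hv hw => not_congr (h3 z v w hv hw)⟩

instance Def.and {p q : Γ → Prop} [hp : Def p] [hq : Def q] : Def (fun z => p z ∧ q z) := by
  obtain ⟨S, L, hp⟩ := hp.out
  obtain ⟨S', L', hq⟩ := hq.out
  refine ⟨S ++ S', L ++ L', fun pn pw h h' => ?_⟩
  obtain ⟨φ, a1, a2, a3⟩ := hp pn pw (fun c hc => h c (by simp [hc])) fun c hc => h' c (by simp [hc])
  obtain ⟨ψ, b1, b2, b3⟩ := hq pn pw (fun c hc => h c (by simp [hc])) fun c hc => h' c (by simp [hc])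
  exact ⟨.and φ ψ, .and a1 b1, fun h => h.elim a2 b2,
    fun z v w hv hw => and_congr (a3 z v w hv hw) (b3 z v w hv hw)⟩

theorem Def.congr {p q : Γ → Prop} (hp : Def p) (h : ∀ z, p z ↔ q z) : Def q := by
  rwa [show q = p from funext fun z => propext (h z).symm]

instance Def.or {p q : Γ → Prop} [hp : Def p] [hq : Def q] : Def (fun z => p z ∨ q z) :=
  Def.congr (p := fun z => ¬ (¬ p z ∧ ¬ q z)) inferInstance fun z => by tauto

instance Def.imp {p q : Γ → Prop} [hp : Def p] [hq : Def q] : Def (fun z => p z → q z) :=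
  Def.congr (p := fun z => ¬ p z ∨ q z) inferInstance fun z => by tauto

instance Def.iff {p q : Γ → Prop} [hp : Def p] [hq : Def q] : Def (fun z => p z ↔ q z) :=
  Def.congr (p := fun z => (p z → q z) ∧ (q z → p z)) inferInstance fun z => by tauto

instance Def.lt {f g : Γ → M.Num} [hf : DTerm f] [hg : DTerm g] : Def (fun z => f z < g z) :=
  Def.congr (p := fun z => f z ≤ g z ∧ ¬ f z = g z) inferInstance fun _ => Iff.rfl

instance Def.const (p : Prop) : Def (fun _ : Γ => p) := by
  refine ⟨[M.zero], [], fun pn pw h _ => ?_⟩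
  by_cases hp : p
  · refine ⟨.eqNum .zero .zero, .eqNum _ _, by simp [Formula.FreeStr, NumTerm.HasStr], ?_⟩
    simp [Formula.Sat, hp]
  · refine ⟨.neg (.eqNum .zero .zero), .neg (.eqNum _ _),
      by simp [Formula.FreeStr, NumTerm.HasStr], ?_⟩
    simp [Formula.Sat, hp]

/-- The bound variable receives the first even name outside the context. Terms over the context do
not contain it, so the quantifier is a legitimate bounded one and the value of the bound survives
the update. -/
instance Def.ball {t : Γ → M.Num} {p : Γ → M.Num → Prop} [ht : DTerm t]
    [hp : Def (fun z : Γ × M.Num => p z.1 z.2)] : Def (fun z => ∀ a, a ≤ t z → p z a) := by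
  obtain ⟨S, ht⟩ := ht.out
  obtain ⟨S', L, hp⟩ := hp.out
  refine ⟨S ++ S', L, fun pn pw h h' => ?_⟩
  obtain ⟨s, a1, a2, a3⟩ := ht pn fun c hc => h c (by simp [hc])
  obtain ⟨φ, b1, b2, b3⟩ := hp pn pw (fun c hc => h c (by simp [hc])) h'
  have hs : ∀ (v : ℕ → M.Num) (z : Γ) (w : ℕ → M.Str) (a : M.Num), Agree pn z v →
      s.eval M (Function.update v (2 * Ctx.depth Γ) a) w = t z := fun v z w a hv => by
    rw [← a3 z v w hv]
    have : ∀ s : NumTerm, ¬ s.HasVar (2 * Ctx.depth Γ) →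
        s.eval M (Function.update v (2 * Ctx.depth Γ) a) w = s.eval M v w := by
      intro s
      induction s with
      | var x => intro hx; exact Function.update_of_ne hx _ _
      | zero => intro _; rfl
      | one => intro _; rfl
      | add s t hs ht =>
        intro hx; simp only [NumTerm.HasVar, not_or] at hx; simp only [NumTerm.eval, hs hx.1, ht hx.2]
      | mul s t hs ht =>
        intro hx; simp only [NumTerm.HasVar, not_or] at hx; simp only [NumTerm.eval, hs hx.1, ht hx.2]
      | len X => intro _; rfl
    exact this s (a1 _ le_rfl)
  refine ⟨_, .allLe (a1 _ le_rfl) b1, ?_, fun z v w hv hw => ?_⟩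
  · simp [Formula.FreeStr, Formula.imp, NumTerm.HasStr, a2, b2]
  · refine forall_congr' fun a => ?_
    refine (imp_iff_not_or.symm.trans (imp_congr ?_ (b3 (z, a) _ w (hv.update a) hw)))
    simp only [Formula.Sat, hs v z w a hv, NumTerm.eval, Function.update_self]
    rfl

instance Def.bex {t : Γ → M.Num} {p : Γ → M.Num → Prop} [ht : DTerm t]
    [hp : Def (fun z : Γ × M.Num => p z.1 z.2)] : Def (fun z => ∃ a, a ≤ t z ∧ p z a) :=
  Def.congr (p := fun z => ¬ ∀ a, a ≤ t z → ¬ p z a) inferInstance fun z => by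
    simp only [not_forall, not_not, exists_prop]

instance (c : M.Num) : DTerm (fun z : M.Num => npair c z) :=
  .npair (f := fun _ => c) (g := fun z => z)
instance (X : M.Str) : Def (fun z : M.Num => z ∈ X) := .mem (f := fun z => z) X

variable [VModel M]

theorem comprehension_le (p : M.Num → Prop) [hp : Def p] (y : M.Num) :
    ∃ Y : M.Str, M.len Y ≤ y ∧ ∀ x, x < y → (x ∈ Y ↔ p x) := by
  obtain ⟨S, L, hp⟩ := hp.out
  obtain ⟨X₀⟩ := M.str_nonempty
  have h1 : ∀ c ∈ S, ∃ i, S.getD i M.zero = c := fun c hc => by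
    obtain ⟨i, hi, rfl⟩ := List.getElem_of_mem hc
    exact ⟨i, by simp [hi]⟩
  have h2 : ∀ c ∈ L, ∃ i, L.getD i X₀ = c := fun c hc => by
    obtain ⟨i, hi, rfl⟩ := List.getElem_of_mem hc
    exact ⟨i, by simp [hi]⟩
  obtain ⟨φ, a1, a2, a3⟩ := hp (fun i => S.getD i M.zero) (fun i => L.getD i X₀) h1 h2
  -- Number variable 0 is the element and 2 carries the bound `y`; `Agree` leaves the even names
  -- from 2 on unconstrained, so the truth value of `φ` is not affected. String name 0 is reserved
  -- for the new set, since string parameters start at 1.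
  have hax := VModel.valid (comprehension 0 2 0 φ)
    (Or.inl (Or.inr ⟨0, 2, 0, φ, by decide, a1, a2, rfl⟩))
    (fun i => if i = 2 then y else S.getD (i / 2) M.zero)
    (fun i => L.getD (i - 1) X₀)
  obtain ⟨Y, hY, hx⟩ := hax
  refine ⟨Y, hY, fun x hxy => ?_⟩
  have hx := (riff_iff _ _).1 ((rimp_iff _ _).1 (hx x) hxy)
  refine Iff.trans (Iff.trans Iff.rfl hx) (a3 x _ _ ?_ ?_)
  · refine ⟨fun i hi => ?_, fun i => ?_⟩
    · change i < 1 at hi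
      obtain rfl : i = 0 := by omega
      rfl
    · rw [Function.update_of_ne (by omega)]
      have : (2 * i + 1) / 2 = i := by omega
      rw [if_neg (by omega), this]
  · intro i
    rw [Function.update_of_ne (by omega)]; rfl

end Definability

/-! ### Arithmetic in a model: bounded induction and the ordered semiring of numbers. -/

section Arithmetic
variable {M : TwoSorted.{u}} [hM : VModel M]

theorem valid_basic {ψ : Formula} (h : ψ ∈ basicAxioms) : ψ.ValidIn M :=
  VModel.valid ψ (Or.inl (Or.inl h))

namespace Num

def nil : ℕ → M.Num := fun _ => 0
noncomputable def nilS : ℕ → M.Str := fun _ => Classical.choice M.str_nonempty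

theorem add_one_ne_zero' (x : M.Num) : x + 1 ≠ 0 :=
  valid_basic (M := M) (ψ := (allN fun x => ¬ₒ(x + 1 =ₒ 0)).close)
    (by simp [basicAxioms]) nil nilS x

theorem add_one_inj {x y : M.Num} (h : x + 1 = y + 1) : x = y :=
  (rimp_iff _ _).1 (valid_basic (M := M)
    (ψ := (allN fun x => allN fun y => x + 1 =ₒ y + 1 →ₒ x =ₒ y).close)
    (by simp [basicAxioms]) nil nilS x y) h

theorem add_zero' (x : M.Num) : x + 0 = x :=
  valid_basic (M := M) (ψ := (allN fun x => x + 0 =ₒ x).close)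
    (by simp [basicAxioms]) nil nilS x

theorem add_succ (x y : M.Num) : x + (y + 1) = (x + y) + 1 :=
  valid_basic (M := M) (ψ := (allN fun x => allN fun y => x + (y + 1) =ₒ (x + y) + 1).close)
    (by simp [basicAxioms]) nil nilS x y

theorem mul_zero' (x : M.Num) : x * 0 = 0 :=
  valid_basic (M := M) (ψ := (allN fun x => x * 0 =ₒ 0).close)
    (by simp [basicAxioms]) nil nilS x

theorem mul_succ (x y : M.Num) : x * (y + 1) = x * y + x :=
  valid_basic (M := M) (ψ := (allN fun x => allN fun y => x * (y + 1) =ₒ x * y + x).close)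
    (by simp [basicAxioms]) nil nilS x y

theorem le_antisymm' {x y : M.Num} (h : x ≤ y) (h' : y ≤ x) : x = y :=
  (rimp_iff _ _).1 (valid_basic (M := M)
    (ψ := (allN fun x => allN fun y => (x ≤ₒ y ∧ₒ y ≤ₒ x) →ₒ x =ₒ y).close)
    (by simp [basicAxioms]) nil nilS x y) ⟨h, h'⟩

theorem le_add (x y : M.Num) : x ≤ x + y :=
  valid_basic (M := M) (ψ := (allN fun x => allN fun y => x ≤ₒ x + y).close)
    (by simp [basicAxioms]) nil nilS x y

theorem zero_le' (x : M.Num) : 0 ≤ x :=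
  valid_basic (M := M) (ψ := (allN fun x => 0 ≤ₒ x).close)
    (by simp [basicAxioms]) nil nilS x

theorem le_total' (x y : M.Num) : x ≤ y ∨ y ≤ x :=
  valid_basic (M := M) (ψ := (allN fun x => allN fun y => x ≤ₒ y ∨ₒ y ≤ₒ x).close)
    (by simp [basicAxioms]) nil nilS x y

theorem le_iff_lt_succ {x y : M.Num} : x ≤ y ↔ x < y + 1 :=
  (riff_iff _ _).1 (valid_basic (M := M)
    (ψ := (allN fun x => allN fun y => x ≤ₒ y ↔ₒ x <ₒ y + 1).close)
    (by simp [basicAxioms]) nil nilS x y)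

theorem exists_pred {x : M.Num} (h : x ≠ 0) : ∃ y, y + 1 = x := by
  obtain ⟨y, -, hy⟩ := (rimp_iff _ _).1 (valid_basic (M := M)
    (ψ := (allN fun x => ¬ₒ(x =ₒ 0) →ₒ exN fun y => y ≤ₒ x ∧ₒ y + 1 =ₒ x).close)
    (by simp [basicAxioms]) nil nilS x) h
  exact ⟨y, hy⟩

end Num

theorem Str.lt_len {X : M.Str} {y : M.Num} (h : y ∈ X) : y < M.len X :=
  (rimp_iff _ _).1 (valid_basic (M := M)
    (ψ := (allS fun X => allN fun y => y ∈ₒ X →ₒ y <ₒ .len X).close)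
    (by simp [basicAxioms]) Num.nil Num.nilS X y) h

theorem Str.mem_of_succ_eq_len {X : M.Str} {y : M.Num} (h : y + 1 = M.len X) : y ∈ X :=
  (rimp_iff _ _).1 (valid_basic (M := M)
    (ψ := (allS fun X => allN fun y => y + 1 =ₒ .len X →ₒ y ∈ₒ X).close)
    (by simp [basicAxioms]) Num.nil Num.nilS X y) h

namespace Num

theorem le_refl' (x : M.Num) : x ≤ x := (le_total' x x).elim id id

theorem le_succ_iff {x y : M.Num} : x ≤ y + 1 ↔ x ≤ y ∨ x = y + 1 := by
  by_cases h : x = y + 1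
  · subst h; exact ⟨fun _ => Or.inr rfl, fun _ => le_refl' _⟩
  · simp only [h, or_false]
    exact ⟨fun h' => le_iff_lt_succ.2 ⟨h', h⟩, fun h' => (le_iff_lt_succ.1 h').1⟩

/-- Totality, antisymmetry and `le_iff_lt_succ` are enough here. Transitivity of ≤ becomes available
only after induction. -/
theorem succ_le_of_lt {x y : M.Num} (h : x < y) : x + 1 ≤ y := by
  rcases le_total' (x + 1) y with h' | h'
  · exact h'
  · by_cases he : y = x + 1
    · rw [he]; exact le_refl' _
    · exact absurd (le_antisymm' h.1 (le_iff_lt_succ.2 ⟨h', he⟩)) h.2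

theorem le_of_succ_le {x y : M.Num} (h : x + 1 ≤ y) : x ≤ y := by
  rcases le_total' x y with h' | h'
  · exact h'
  · have := le_iff_lt_succ.1 h'
    exact absurd (le_antisymm' this.1 h) this.2

/-- Induction for bounded formulas. -/
theorem induction {p : M.Num → Prop} [hp : Def (fun z : M.Num × M.Num => p z.2)] (h0 : p 0)
    (hs : ∀ x, p x → p (x + 1)) (y : M.Num) : p y := by
  -- The set of all x ≤ y up to which `p` holds throughout. It contains 0, and the length axioms
  -- make the predecessor of its length its largest element; if that were not y, its successor would
  -- be a larger element.
  obtain ⟨Y, hYl, hY⟩ := comprehension_le (fun x : M.Num => ∀ i, i ≤ x → p i) (y + 1)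
  have h00 : (0 : M.Num) ∈ Y := (hY 0 (le_iff_lt_succ.1 (zero_le' y))).2 fun i hi => by
    rwa [le_antisymm' hi (zero_le' i)]
  have hl : M.len Y ≠ 0 := fun h => by
    have := Str.lt_len h00
    rw [h] at this
    exact this.2 rfl
  obtain ⟨x, hx⟩ := exists_pred hl
  have hxY := Str.mem_of_succ_eq_len hx
  have hxy : x < y + 1 := by
    rw [← hx] at hYl
    rcases le_succ_iff.1 hYl with h | h
    · exact le_iff_lt_succ.1 (le_of_succ_le h)
    · rw [add_one_inj h]; exact le_iff_lt_succ.1 (le_refl' _)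
  have hp := (hY x hxy).1 hxY
  by_cases he : x = y
  · exact hp y (he ▸ le_refl' _)
  · have hxy' : x + 1 ≤ y := succ_le_of_lt ⟨le_iff_lt_succ.2 hxy, he⟩
    have : x + 1 ∈ Y := (hY _ (le_iff_lt_succ.1 hxy')).2 fun i hi => by
      rcases le_succ_iff.1 hi with h | rfl
      · exact hp i h
      · exact hs x (hp x (le_refl' x))
    exact absurd hx (Str.lt_len this).2

theorem add_assoc' (a b c : M.Num) : a + b + c = a + (b + c) := by
  refine induction (p := fun c => a + b + c = a + (b + c)) ?_ (fun c h => ?_) c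
  · simp only [add_zero']
  · simp only [add_succ, h]

theorem zero_add' (a : M.Num) : 0 + a = a := by
  refine induction (p := fun a : M.Num => 0 + a = a) (add_zero' 0) (fun c h => ?_) a
  simp only [add_succ, h]

theorem succ_add (a b : M.Num) : a + 1 + b = a + b + 1 := by
  refine induction (p := fun b => a + 1 + b = a + b + 1) ?_ (fun c h => ?_) b
  · simp only [add_zero']
  · simp only [add_succ, h]

theorem add_comm' (a b : M.Num) : a + b = b + a := by
  refine induction (p := fun b => a + b = b + a) ?_ (fun c h => ?_) b
  · simp only [add_zero', zero_add']
  · simp only [add_succ, succ_add, h]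

theorem zero_mul' (a : M.Num) : 0 * a = 0 := by
  refine induction (p := fun a : M.Num => 0 * a = 0) (mul_zero' 0) (fun c h => ?_) a
  simp only [mul_succ, h, add_zero']

theorem succ_mul (a b : M.Num) : (a + 1) * b = a * b + b := by
  refine induction (p := fun b => (a + 1) * b = a * b + b) ?_ (fun c h => ?_) b
  · simp only [mul_zero', add_zero']
  · rw [mul_succ, h, mul_succ, add_assoc' _ c, add_assoc' _ a, add_succ c, add_succ a, add_comm' c]

theorem mul_comm' (a b : M.Num) : a * b = b * a := by
  refine induction (p := fun b => a * b = b * a) ?_ (fun c h => ?_) b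
  · simp only [mul_zero', zero_mul']
  · simp only [mul_succ, succ_mul, h]

theorem mul_add' (a b c : M.Num) : a * (b + c) = a * b + a * c := by
  refine induction (p := fun c => a * (b + c) = a * b + a * c) ?_ (fun c h => ?_) c
  · simp only [mul_zero', add_zero']
  · rw [add_succ, mul_succ, h, mul_succ, add_assoc']

theorem mul_assoc' (a b c : M.Num) : a * b * c = a * (b * c) := by
  refine induction (p := fun c => a * b * c = a * (b * c)) ?_ (fun c h => ?_) c
  · simp only [mul_zero']
  · rw [mul_succ, h, mul_succ, mul_add']

theorem one_mul' (a : M.Num) : 1 * a = a := by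
  rw [← zero_add' (1 : M.Num), succ_mul, zero_mul', zero_add']

instance : CommSemiring M.Num where
  add_assoc := add_assoc'
  zero_add := zero_add'
  add_zero := add_zero'
  add_comm := add_comm'
  left_distrib := mul_add'
  right_distrib a b c := by rw [mul_comm', mul_add', mul_comm' c a, mul_comm' c b]
  zero_mul := zero_mul'
  mul_zero := mul_zero'
  mul_assoc := mul_assoc'
  one_mul := one_mul'
  mul_one a := by rw [mul_comm', one_mul']
  mul_comm := mul_comm'
  nsmul := nsmulRec

theorem add_left_cancel' {a b c : M.Num} (h : a + b = a + c) : b = c := by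
  revert h
  refine induction (p := fun a => a + b = a + c → b = c) ?_ (fun a ih h => ?_) a
  · simp only [zero_add, imp_self]
  · rw [succ_add, succ_add] at h; exact ih (add_one_inj h)

theorem exists_add_of_le' {a b : M.Num} (h : a ≤ b) : ∃ c, b = a + c := by
  -- The witness is bounded by `b` to keep the induction formula bounded. Redundant bounds occur for
  -- the same reason in later inductions.
  have : ∃ c, c ≤ b ∧ b = a + c := by
    revert h
    refine induction (p := fun b => a ≤ b → ∃ c, c ≤ b ∧ b = a + c) (fun h => ?_)
      (fun b ih h => ?_) b
    · exact ⟨0, le_refl' _, by rw [add_zero]; exact le_antisymm' (zero_le' _) h⟩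
    · rcases le_succ_iff.1 h with h | rfl
      · obtain ⟨c, -, rfl⟩ := ih h
        refine ⟨c + 1, ?_, add_assoc _ _ _⟩
        rw [add_assoc, add_comm a]; exact le_add _ _
      · exact ⟨0, zero_le' _, (add_zero (b + 1)).symm⟩
  obtain ⟨c, -, h⟩ := this
  exact ⟨c, h⟩

theorem le_trans' {a b c : M.Num} (h : a ≤ b) (h' : b ≤ c) : a ≤ c := by
  obtain ⟨x, rfl⟩ := exists_add_of_le' h
  obtain ⟨y, rfl⟩ := exists_add_of_le' h'
  rw [add_assoc]; exact le_add _ _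

noncomputable instance : LinearOrder M.Num where
  le_refl := le_refl'
  le_trans _ _ _ := le_trans'
  le_antisymm _ _ := le_antisymm'
  le_total := le_total'
  lt_iff_le_not_ge a b := ⟨fun h => ⟨h.1, fun h' => h.2 (le_antisymm' h.1 h')⟩,
    fun h => ⟨h.1, fun h' => h.2 (h' ▸ le_refl' _)⟩⟩
  toDecidableLE := Classical.decRel _

instance : IsOrderedCancelAddMonoid M.Num where
  add_le_add_left a b h c := by
    obtain ⟨x, rfl⟩ := exists_add_of_le' h
    rw [add_right_comm]; exact le_add _ _
  le_of_add_le_add_left a b c h := by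
    obtain ⟨x, hx⟩ := exists_add_of_le' h
    rw [add_assoc] at hx
    rw [add_left_cancel' hx]; exact le_add _ _

instance : Nontrivial M.Num := ⟨0, 1, fun h => by
  have := add_one_ne_zero' (0 : M.Num)
  rw [zero_add] at this
  exact this h.symm⟩

theorem add_one_le_iff {a b : M.Num} : a + 1 ≤ b ↔ a < b :=
  ⟨fun h => lt_of_le_of_ne (le_of_succ_le h) fun h' => by
    subst h'; exact (le_iff_lt_succ.1 (le_refl' a)).not_ge h, succ_le_of_lt⟩

theorem lt_add_one_iff' {a b : M.Num} : a < b + 1 ↔ a ≤ b := le_iff_lt_succ.symm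

instance : CanonicallyOrderedAdd M.Num where
  exists_add_of_le := exists_add_of_le'
  le_add_self a b := by rw [add_comm]; exact le_add _ _
  le_self_add := le_add

theorem mul_lt_mul_left_aux {a b c : M.Num} (hc : 0 < c) (hab : a < b) : c * a < c * b := by
  obtain ⟨d, rfl⟩ := exists_add_of_le' (succ_le_of_lt hab)
  rw [add_assoc, mul_add]
  refine lt_add_of_pos_right _ (lt_of_lt_of_le hc ?_)
  rw [mul_add, mul_one]
  exact le_add _ _

instance : IsStrictOrderedRing M.Num where
  mul_lt_mul_of_pos_left _ hc _ _ hab := mul_lt_mul_left_aux hc hab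
  mul_lt_mul_of_pos_right c hc a b hab := by
    rw [mul_comm a, mul_comm b]; exact mul_lt_mul_left_aux hc hab

end Num
end Arithmetic

/-! ### The ordered ring of differences of an ordered semiring -/

section Differences
variable (N : Type u) [CommSemiring N] [LinearOrder N] [IsStrictOrderedRing N]
  [CanonicallyOrderedAdd N]

/-- The ring of differences. -/
def Diff : Type u := Algebra.GrothendieckAddGroup N

namespace Diff
variable {N}

instance : AddCommGroup (Diff N) := inferInstanceAs (AddCommGroup (Algebra.GrothendieckAddGroup N))
noncomputable instance : LinearOrder (Diff N) :=
  inferInstanceAs (LinearOrder (AddLocalization (⊤ : AddSubmonoid N)))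
instance : IsOrderedCancelAddMonoid (Diff N) :=
  inferInstanceAs (IsOrderedCancelAddMonoid (AddLocalization (⊤ : AddSubmonoid N)))

/-- The embedding. -/
def of : N →+ Diff N := Algebra.GrothendieckAddGroup.of

theorem of_eq (a : N) : of a = AddLocalization.mk a (0 : (⊤ : AddSubmonoid N)) :=
  (AddLocalization.mk_zero_eq_addMonoidOf_mk a).symm

theorem of_le {a b : N} : of a ≤ of b ↔ a ≤ b := by
  rw [of_eq, of_eq]
  exact (AddLocalization.mk_le_mk).trans (by simp)

theorem of_lt {a b : N} : of a < of b ↔ a < b := by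
  rw [← not_le, of_le, not_le]

theorem of_inj {a b : N} : of a = of b ↔ a = b := by
  simp only [le_antisymm_iff, of_le]

theorem exists_sub (x : Diff N) : ∃ a b : N, x = of a - of b := by
  induction x using AddLocalization.ind with
  | _ y =>
    refine ⟨y.1, y.2, ?_⟩
    refine eq_sub_iff_add_eq.2 ?_
    rw [of_eq, of_eq]
    refine (AddLocalization.mk_add _ _ _ _).trans (AddLocalization.mk_eq_mk_iff'.2 ?_)
    simp [add_comm]

/-- Extension of additive maps. -/
noncomputable def lift {G : Type u} [AddCommGroup G] : (N →+ G) ≃ (Diff N →+ G) :=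
  Algebra.GrothendieckAddGroup.lift

@[simp] theorem lift_of {G : Type u} [AddCommGroup G] (f : N →+ G) (a : N) :
    lift f (of a) = f a :=
  DFunLike.congr_fun (lift.symm_apply_apply f) a

theorem hom_ext {G : Type u} [AddCommGroup G] {f g : Diff N →+ G} (h : ∀ a, f (of a) = g (of a)) :
    f = g :=
  lift.symm.injective (AddMonoidHom.ext h)

/-- The multiplication. -/
noncomputable def mulHom : Diff N →+ Diff N →+ Diff N :=
  lift
    { toFun := fun a => lift (of.comp (AddMonoidHom.mulLeft a))
      map_zero' := hom_ext fun b => by simp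
      map_add' := fun a b => hom_ext fun c => by simp [add_mul] }

noncomputable instance : Mul (Diff N) := ⟨fun x y => mulHom x y⟩

theorem mul_def (x y : Diff N) : x * y = mulHom x y := rfl

instance : One (Diff N) := ⟨of 1⟩

theorem of_one : of (1 : N) = 1 := rfl

theorem of_mul (a b : N) : of (a * b) = of a * of b := by
  simp [mul_def, mulHom]

theorem sub_mul_sub (a b c d : N) :
    (of a - of b) * (of c - of d) = of (a * c + b * d) - of (a * d + b * c) := by
  simp only [mul_def, map_sub, AddMonoidHom.sub_apply, map_add, of_mul]
  abel

noncomputable instance : CommRing (Diff N) where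
  __ := (inferInstance : AddCommGroup (Diff N))
  left_distrib x y z := by simp only [mul_def, map_add]
  right_distrib x y z := by simp only [mul_def, map_add, AddMonoidHom.add_apply]
  zero_mul x := by simp [mul_def]
  mul_zero x := by simp [mul_def]
  mul_assoc x y z := by
    obtain ⟨a, b, rfl⟩ := exists_sub x
    obtain ⟨c, d, rfl⟩ := exists_sub y
    obtain ⟨e, f, rfl⟩ := exists_sub z
    simp only [sub_mul_sub]
    congr 2 <;> ring
  one_mul x := by
    obtain ⟨a, b, rfl⟩ := exists_sub x
    simp only [mul_def, map_sub]
    simp only [← mul_def, ← of_one, ← of_mul, one_mul]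
  mul_one x := by
    obtain ⟨a, b, rfl⟩ := exists_sub x
    simp only [mul_def, map_sub, AddMonoidHom.sub_apply]
    simp only [← mul_def, ← of_one, ← of_mul, mul_one]
  mul_comm x y := by
    obtain ⟨a, b, rfl⟩ := exists_sub x
    obtain ⟨c, d, rfl⟩ := exists_sub y
    simp only [sub_mul_sub]
    congr 2 <;> ring

instance : Nontrivial (Diff N) := ⟨of 0, of 1, fun h => zero_ne_one (of_inj.1 h)⟩

theorem exists_of_pos {x : Diff N} (h : 0 < x) : ∃ a : N, 0 < a ∧ x = of a := by
  obtain ⟨a, b, rfl⟩ := exists_sub x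
  obtain ⟨c, rfl⟩ := exists_add_of_le (of_lt.1 (sub_pos.1 h)).le
  rw [map_add, add_sub_cancel_left] at h ⊢
  exact ⟨c, of_lt.1 (by rwa [map_zero]), rfl⟩

instance : ZeroLEOneClass (Diff N) :=
  ⟨by rw [← of_one, ← map_zero of, of_le]; exact zero_le_one⟩

instance : IsStrictOrderedRing (Diff N) := by
  refine IsStrictOrderedRing.of_mul_pos fun x y hx hy => ?_
  obtain ⟨a, ha, rfl⟩ := exists_of_pos hx
  obtain ⟨b, hb, rfl⟩ := exists_of_pos hy
  rw [← of_mul, ← map_zero of, of_lt]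
  positivity

theorem of_nonneg (a : N) : 0 ≤ of a := by
  rw [← map_zero of, of_le]; exact zero_le

end Diff
end Differences

section
variable {M : TwoSorted.{u}} [VModel M]

/-- The embedding of the numbers of a model into an ordered ring. -/
def toDiff (a : M.Num) : Diff M.Num := Diff.of a

theorem toDiff_nonneg (a : M.Num) : 0 ≤ toDiff a := Diff.of_nonneg a

/-- The ring of differences inherits discreteness: a positive element is the image of a nonzero
number, and such a number is at least 1. -/
theorem diff_lt_iff {x y : Diff M.Num} : x < y ↔ x + 1 ≤ y := by
  refine ⟨fun h => ?_, fun h => lt_of_lt_of_le (lt_add_one x) h⟩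
  obtain ⟨a, ha, h⟩ := Diff.exists_of_pos (sub_pos.2 h)
  have : (1 : Diff M.Num) ≤ y - x := by
    rw [h, ← Diff.of_one, Diff.of_le, ← zero_add (1 : M.Num)]
    exact Num.succ_le_of_lt ha
  linarith

theorem diff_le_or (x y : Diff M.Num) : x ≤ y ∨ y + 1 ≤ x := by
  rw [← diff_lt_iff]; exact le_or_gt x y

/-- Translation of arithmetical statements into the ordered ring of differences. -/
theorem toDiff_simps :
    (∀ a b : M.Num, a ≤ b ↔ toDiff a ≤ toDiff b) ∧
    (∀ a b : M.Num, a < b ↔ toDiff a < toDiff b) ∧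
    (∀ a b : M.Num, a = b ↔ toDiff a = toDiff b) ∧
    (∀ a b : M.Num, toDiff (a + b) = toDiff a + toDiff b) ∧
    (∀ a b : M.Num, toDiff (a * b) = toDiff a * toDiff b) ∧
    toDiff (0 : M.Num) = 0 ∧ toDiff (1 : M.Num) = 1 ∧
    (∀ x y : Diff M.Num, x < y ↔ x + 1 ≤ y) ∧
    (∀ x y : Diff M.Num, ¬ x ≤ y ↔ y + 1 ≤ x) ∧
    (∀ x y : Diff M.Num, ¬ x = y ↔ x + 1 ≤ y ∨ y + 1 ≤ x) := by
  refine ⟨fun _ _ => Diff.of_le.symm, fun _ _ => Diff.of_lt.symm, fun _ _ => Diff.of_inj.symm,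
    map_add Diff.of, Diff.of_mul, map_zero Diff.of, rfl, fun _ _ => diff_lt_iff, fun x y => ?_,
    fun x y => ?_⟩
  · rw [not_le, diff_lt_iff]
  · rw [← diff_lt_iff, ← diff_lt_iff]; exact ne_iff_lt_or_gt
end

/-! ### The pairing function and comprehension for coded rows and matrices. -/

section Coding
variable {M : TwoSorted.{u}} [VModel M]

theorem two_mul_cancel {a b : M.Num} (h : (1 + 1) * a = (1 + 1) * b) : a = b := by
  -- The pattern for elementary arithmetic: everything is moved to the ordered ring of differences,
  -- strict and negated statements become `≤` with an added 1, and `grind` closes the goal with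
  -- nonnegativity and discreteness as extra facts.
  by_contra; simp only [toDiff_simps] at *; grind [toDiff_nonneg, diff_le_or]

/-- With σ = s + t the code lies between σ(σ+1) and σ(σ+1) + 2σ, which is below (σ+1)(σ+2). The
intervals for different σ are disjoint and increasing. -/
theorem add_le_of_npair_le {s t s' t' : M.Num} (h : npair s t ≤ npair s' t') :
    s + t ≤ s' + t' := by
  by_contra hc
  obtain ⟨c, hc⟩ := exists_add_of_le (Num.succ_le_of_lt (not_le.1 hc))
  unfold npair at h
  rw [hc] at h
  have h1 : 0 ≤ (s' + t') * c := zero_le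
  have h2 : 0 ≤ c * c := zero_le
  simp only [toDiff_simps] at *; grind [toDiff_nonneg, diff_le_or]

theorem npair_inj {s t s' t' : M.Num} : npair s t = npair s' t' ↔ s = s' ∧ t = t' := by
  refine ⟨fun h => ?_, fun h => by rw [h.1, h.2]⟩
  have h1 := le_antisymm (add_le_of_npair_le h.le) (add_le_of_npair_le h.ge)
  unfold npair at h
  rw [h1] at h
  have ht : t = t' := two_mul_cancel (add_left_cancel h)
  subst ht
  exact ⟨add_right_cancel h1, rfl⟩

theorem npair_mono {s t s' t' : M.Num} (h : s ≤ s') (h' : t ≤ t') :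
    npair s t ≤ npair s' t' := by
  unfold npair; gcongr

theorem add_le_npair (s t : M.Num) : s + t ≤ npair s t := by
  unfold npair
  have h1 : 0 ≤ (s + t) * (s + t) := zero_le
  by_contra; simp only [toDiff_simps] at *; grind [toDiff_nonneg, diff_le_or]

theorem left_le_npair (s t : M.Num) : s ≤ npair s t := le_self_add.trans (add_le_npair s t)
theorem right_le_npair (s t : M.Num) : t ≤ npair s t := le_add_self.trans (add_le_npair s t)

theorem Str.le_len {X : M.Str} {y : M.Num} (h : y ∈ X) : y ≤ M.len X := (Str.lt_len h).le

theorem exists_str {p : M.Num → Prop} [Def p] (L : M.Num) (hL : ∀ b, p b → b ≤ L) :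
    ∃ Y : M.Str, dStr Y = p := by
  obtain ⟨Y, hY, h⟩ := comprehension_le p (L + 1)
  refine ⟨Y, funext fun b => propext ?_⟩
  by_cases hb : b < L + 1
  · exact h b hb
  · exact iff_of_false (fun h' => hb ((Str.lt_len h').trans_le hY))
      fun h' => hb (Num.lt_add_one_iff'.2 (hL b h'))

/-- The code of a pair dominates both components, so the quantifiers that decode it are bounded by
the code itself and comprehension applies. -/
theorem exists_rows {p : M.Num → M.Num → Prop}
    [Def (fun z : (M.Num × M.Num) × M.Num => p z.1.2 z.2)] (I L : M.Num)
    (hL : ∀ i b, i ≤ I → p i b → b ≤ L) :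
    ∃ Y : M.Str, ∀ i, i ≤ I → dRow Y i = p i := by
  obtain ⟨Y, hY⟩ := exists_str
    (p := fun x : M.Num =>
      ∃ i, i ≤ x ∧ ∃ b, b ≤ x ∧ x = npair i b ∧ i ≤ I ∧ b ≤ L ∧ p i b) (npair I L) (by
      rintro _ ⟨i, -, b, -, rfl, hi, hb, -⟩
      exact npair_mono hi hb)
  refine ⟨Y, fun i hi => funext fun b => propext ((iff_of_eq (congrFun hY _)).trans ⟨?_, ?_⟩)⟩
  · rintro ⟨i', -, b', -, h, -, -, hp⟩
    obtain ⟨rfl, rfl⟩ := npair_inj.1 h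
    exact hp
  · exact fun hp => ⟨i, left_le_npair _ _, b, right_le_npair _ _, rfl, hi, hL i b hi hp, hp⟩

theorem exists_mat {p : M.Num → M.Num → M.Num → Prop}
    [Def (fun z : ((M.Num × M.Num) × M.Num) × M.Num => p z.1.1.2 z.1.2 z.2)] (I J L : M.Num)
    (hL : ∀ i j b, i ≤ I → j ≤ J → p i j b → b ≤ L) :
    ∃ Y : M.Str, ∀ i j, i ≤ I → j ≤ J → dMat Y i j = p i j := by
  obtain ⟨Y, hY⟩ := exists_str
    (p := fun x : M.Num => ∃ i, i ≤ x ∧ ∃ j, j ≤ x ∧ ∃ b, b ≤ x ∧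
      x = npair (npair i j) b ∧ i ≤ I ∧ j ≤ J ∧ b ≤ L ∧ p i j b) (npair (npair I J) L) (by
      rintro _ ⟨i, -, j, -, b, -, rfl, hi, hj, hb, -⟩
      exact npair_mono (npair_mono hi hj) hb)
  refine ⟨Y, fun i j hi hj => funext fun b => propext ((iff_of_eq (congrFun hY _)).trans ⟨?_, ?_⟩)⟩
  · rintro ⟨i', -, j', -, b', -, h, -, -, -, hp⟩
    obtain ⟨h', rfl⟩ := npair_inj.1 h
    obtain ⟨rfl, rfl⟩ := npair_inj.1 h'
    exact hp
  · exact fun hp => ⟨i, (left_le_npair _ _).trans (left_le_npair _ _), j,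
      (right_le_npair _ _).trans (left_le_npair _ _), b, right_le_npair _ _, rfl, hi, hj,
      hL i j b hi hj hp, hp⟩

/-! ### Digit sequences -/

/-- The digit sequence is coded by a string. -/
def IsStr (P : Digits M) : Prop := ∃ X : M.Str, dStr X = P

theorem isStr_dStr (X : M.Str) : IsStr (dStr X) := ⟨X, rfl⟩

theorem IsStr.of_def {p : Digits M} [Def p] (L : M.Num) (hL : ∀ b, p b → b ≤ L) : IsStr p :=
  exists_str L hL

theorem isStr_dRow (X : M.Str) (i : M.Num) : IsStr (dRow X i) :=
  IsStr.of_def (p := fun b => npair i b ∈ X) (M.len X) fun _ h =>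
    (right_le_npair _ _).trans (Str.le_len h)

theorem isStr_dMat (X : M.Str) (i j : M.Num) : IsStr (dMat X i j) :=
  IsStr.of_def (p := fun b => npair (npair i j) b ∈ X) (M.len X) fun _ h =>
    (right_le_npair _ _).trans (Str.le_len h)

theorem isStr_dMatSeq (X : M.Str) (s i j : M.Num) : IsStr (dMatSeq X s i j) :=
  IsStr.of_def (p := fun b => npair (npair (npair s i) j) b ∈ X) (M.len X) fun _ h =>
    (right_le_npair _ _).trans (Str.le_len h)

theorem same_iff {P Q : Digits M} : Same P Q ↔ P = Q := by
  simp only [Same, riff_iff, funext_iff, eq_iff_iff]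

/-- The digit sequence of the number `0`. -/
def zeroD : Digits M := fun _ => False

theorem dZero_eq : (dZero : Digits M) = zeroD := by
  funext b; simp [dZero, zeroD]

theorem isStr_zeroD : IsStr (zeroD : Digits M) :=
  IsStr.of_def (p := fun _ => False) 0 fun _ h => h.elim

theorem IsStr.dMag {P : Digits M} (hP : IsStr P) : IsStr (dMag P) := by
  obtain ⟨X, rfl⟩ := hP
  exact IsStr.of_def (p := fun b => b + 1 ∈ X) (M.len X) fun _ h =>
    le_self_add.trans (Str.le_len h)

theorem digits_ext {P Q : Digits M} (h0 : P 0 ↔ Q 0) (h : dMag P = dMag Q) : P = Q := by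
  funext b
  by_cases hb : b = 0
  · subst hb; exact propext h0
  · obtain ⟨c, rfl⟩ := Num.exists_pred hb
    exact congrFun h c

theorem nonzero_iff {P : Digits M} : Nonzero P ↔ P ≠ zeroD := by
  constructor
  · rintro ⟨b, hb⟩ rfl; exact hb
  · intro h
    by_contra hc
    exact h (funext fun b => propext ⟨fun hb => hc ⟨b, hb⟩, False.elim⟩)

theorem isInt_iff {P : Digits M} : IsInt P ↔ (P 0 → dMag P ≠ zeroD) := by
  rw [IsInt, rimp_iff, nonzero_iff]

theorem rxor_iff {p q : Prop} : rxor p q ↔ ¬ (p ↔ q) := by unfold rxor; tauto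

theorem natAdd_comm {P Q R : Digits M} : NatAdd P Q R ↔ NatAdd Q P R := by
  have : ∀ i, Carry P Q i ↔ Carry Q P i := fun i => by
    simp only [Carry, or_comm, and_left_comm]
  simp only [NatAdd, riff_iff, rxor_iff, this]
  refine forall_congr' fun i => ?_
  tauto

/-- Without a common digit no carry is generated. Every addition of naturals evaluated explicitly
below is of this kind. -/
theorem natAdd_of_disjoint {P Q R : Digits M} (h : ∀ k, ¬ (P k ∧ Q k)) :
    NatAdd P Q R ↔ R = fun b => P b ∨ Q b := by
  have hc : ∀ i, ¬ Carry P Q i := by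
    rintro i ⟨k, -, h1, h2, -⟩; exact h k ⟨h1, h2⟩
  simp only [NatAdd, riff_iff, rxor_iff, hc, funext_iff, eq_iff_iff, iff_false, not_not]
  refine forall_congr' fun i => ?_
  have := h i
  tauto

theorem natAdd_zeroD {P R : Digits M} : NatAdd P zeroD R ↔ R = P := by
  rw [natAdd_of_disjoint (Q := zeroD) (fun k h => h.2)]
  simp only [zeroD, or_false]

/-- A nonempty digit sequence has a leading digit. -/
theorem IsStr.exists_max {P : Digits M} (hP : IsStr P) (h : Nonzero P) :
    ∃ b, P b ∧ ∀ c, b < c → ¬ P c := by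
  obtain ⟨b, hb⟩ := h
  obtain ⟨X, rfl⟩ := hP
  have hl : M.len X ≠ 0 := fun h => by
    have := Str.lt_len hb
    rw [h] at this
    exact not_lt_zero this
  obtain ⟨x, hx⟩ := Num.exists_pred hl
  refine ⟨x, Str.mem_of_succ_eq_len hx, fun c hc h => ?_⟩
  exact (Str.lt_len h).not_ge (hx ▸ Num.succ_le_of_lt hc)

/-- Let b be the highest digit occurring in either summand. Since digit b + 1 of the sum is 0, no
carry enters b + 1. But a carry into b would be passed on by the digit present there, and without
one both summands must have digit b, which generates a carry. -/
theorem eq_zeroD_of_natAdd {P Q : Digits M} (hP : IsStr P) (hQ : IsStr Q)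
    (h : NatAdd P Q zeroD) : Q = zeroD := by
  by_contra hne
  obtain ⟨X, rfl⟩ := hP
  obtain ⟨Y, rfl⟩ := hQ
  have hS : IsStr (fun b : M.Num => b ∈ X ∨ b ∈ Y) :=
    IsStr.of_def (M.len X + M.len Y) (by
      rintro b (h | h)
      · exact (Str.le_len h).trans le_self_add
      · exact (Str.le_len h).trans le_add_self)
  obtain ⟨y, hy⟩ := nonzero_iff.2 hne
  obtain ⟨b, hb, hmax⟩ := hS.exists_max ⟨y, Or.inr hy⟩
  have key : ∀ i, ((i ∈ X ↔ i ∈ Y) ↔ ¬ Carry (dStr X) (dStr Y) i) := fun i => by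
    have := h i
    rw [riff_iff, rxor_iff, rxor_iff] at this
    simp only [zeroD, dStr, false_iff, not_not] at this ⊢
    tauto
  have h1 := hmax (b + 1) (Num.lt_add_one_iff'.2 le_rfl)
  have h2 : ¬ Carry (dStr X) (dStr Y) (b + 1) := (key (b + 1)).1 (by tauto)
  by_cases hc : Carry (dStr X) (dStr Y) b
  · obtain ⟨k, hk, hk1, hk2, hk3⟩ := hc
    refine h2 ⟨k, hk.trans (Num.lt_add_one_iff'.2 le_rfl), hk1, hk2, fun j => ?_⟩
    rw [rimp_iff]
    rintro ⟨hj, hj'⟩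
    rcases (Num.lt_add_one_iff'.1 hj').lt_or_eq with hj' | rfl
    · exact (rimp_iff _ _).1 (hk3 j) ⟨hj, hj'⟩
    · exact hb
  · have := (key b).2 hc
    refine h2 ⟨b, Num.lt_add_one_iff'.2 le_rfl, ?_, ?_, fun j => ?_⟩
    · change b ∈ X; tauto
    · change b ∈ Y; tauto
    · rw [rimp_iff]
      rintro ⟨hj, hj'⟩
      exact absurd (Num.lt_add_one_iff'.1 hj') hj.not_ge

theorem intAdd_comm {P Q R : Digits M} : IntAdd P Q R ↔ IntAdd Q P R := by
  simp only [IntAdd, riff_iff, natAdd_comm (P := dMag P) (Q := dMag Q)]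
  refine and_congr_right fun _ => ?_
  by_cases h : P 0 <;> by_cases h' : Q 0 <;> by_cases h'' : R 0 <;> simp [h, h', h'']

theorem isInt_zeroD : IsInt (zeroD : Digits M) := isInt_iff.2 fun h => h.elim

theorem dMag_zeroD : dMag (zeroD : Digits M) = zeroD := rfl

theorem intAdd_zeroD {P R : Digits M} (hP : IsStr P) (hPi : IsInt P) (hR : IsStr R) :
    IntAdd P zeroD R ↔ R = P := by
  have h0 : (zeroD : Digits M) 0 ↔ False := Iff.rfl
  simp only [IntAdd, riff_iff, dMag_zeroD, natAdd_zeroD, h0]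
  constructor
  · rintro ⟨hi, ⟨-, h1, h2⟩ | ⟨h1, ⟨h2, h3⟩ | ⟨-, h3⟩⟩⟩
    · exact digits_ext h1 h2
    · exact digits_ext h2 h3.symm
    -- Here `P` is negative and |R| + |P| = 0, so `P` would be a negative zero, which `IsInt`
    -- excludes.
    · exact absurd (eq_zeroD_of_natAdd hR.dMag hP.dMag h3) (isInt_iff.1 hPi (by tauto))
  · rintro rfl
    refine ⟨hPi, ?_⟩
    by_cases h : R 0 <;> simp [h]

theorem zeroD_intAdd {P R : Digits M} (hP : IsStr P) (hPi : IsInt P) (hR : IsStr R) :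
    IntAdd zeroD P R ↔ R = P := by
  rw [intAdd_comm, intAdd_zeroD hP hPi hR]

/-! ### Multiplication by `0`, `1` and `-1` -/

/-- The integers `0`, `1` and `-1`. -/
def val (c : SignType) : Digits M := fun b => (b = 1 ∧ c ≠ 0) ∨ (b = 0 ∧ c = -1)

/-- Multiplication by `0`, `1` or `-1`. -/
def smulD (c : SignType) (P : Digits M) : Digits M :=
  match c with
  | 0 => zeroD
  | 1 => P
  | -1 => dNeg P

theorem isStr_val (c : SignType) : IsStr (val c : Digits M) :=
  IsStr.of_def (p := fun b => (b = 1 ∧ c ≠ 0) ∨ (b = 0 ∧ c = -1)) 1 (by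
    rintro b (⟨rfl, -⟩ | ⟨rfl, -⟩)
    · exact le_rfl
    · exact zero_le_one)

theorem val_zero_iff (c : SignType) : (val c : Digits M) 0 ↔ c = -1 := by
  simp [val]

theorem dMag_val (c : SignType) : dMag (val c : Digits M) = fun b => b = 0 ∧ c ≠ 0 := by
  funext b; simp [val, dMag]

theorem isInt_val (c : SignType) : IsInt (val c : Digits M) := by
  rw [isInt_iff, val_zero_iff, dMag_val]
  rintro rfl h
  have := congrFun h 0
  simp [zeroD] at this

theorem val_zero : (val 0 : Digits M) = zeroD := by
  funext b; simp [val, zeroD]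

theorem val_one : (val 1 : Digits M) = dOne := by
  funext b; simp [val, dOne]

theorem val_inj {c c' : SignType} : (val c : Digits M) = val c' ↔ c = c' := by
  refine ⟨fun h => ?_, fun h => h ▸ rfl⟩
  have h0 := congrFun h 0
  have h1 := congrFun h 1
  simp only [val] at h0 h1
  revert h0 h1
  cases c <;> cases c' <;> simp

theorem dMag_dNeg (P : Digits M) : dMag (dNeg P) = dMag P := by
  funext b; simp [dMag, dNeg]

theorem dNeg_zero_iff (P : Digits M) : dNeg P 0 ↔ ¬ P 0 ∧ Nonzero (dMag P) := by
  simp [dNeg]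

theorem isInt_smulD {c : SignType} {P : Digits M} (hP : IsInt P) : IsInt (smulD c P) := by
  cases c
  · exact isInt_zeroD
  · change IsInt (dNeg P)
    rw [isInt_iff, dNeg_zero_iff, dMag_dNeg, nonzero_iff]
    exact fun h => h.2
  · exact hP

theorem isStr_smulD {c : SignType} {P : Digits M} (hP : IsStr P) : IsStr (smulD c P) := by
  cases c
  · exact isStr_zeroD
  · obtain ⟨X, rfl⟩ := hP
    refine IsStr.of_def (p := fun b : M.Num =>
      (b = 0 ∧ ¬ (0 ∈ X) ∧ Nonzero (dMag (dStr X))) ∨ (¬ b = 0 ∧ b ∈ X)) (M.len X) ?_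
    rintro b (⟨rfl, -⟩ | ⟨-, h⟩)
    · exact zero_le
    · exact Str.le_len h
  · exact hP

theorem smulD_val (c c' : SignType) : (smulD c (val c') : Digits M) = val (c * c') := by
  cases c
  · exact val_zero.symm
  · change dNeg (val c') = _
    refine digits_ext ?_ ?_
    · rw [dNeg_zero_iff, val_zero_iff, val_zero_iff, nonzero_iff, dMag_val]
      cases c'
      · refine iff_of_false (fun h => h.2 ?_) (by decide)
        simp; rfl
      · refine iff_of_false (fun h => h.1 rfl) (by decide)
      · refine iff_of_true ⟨by decide, fun h => ?_⟩ rfl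
        have := congrFun h 0
        simp [zeroD] at this
    · rw [dMag_dNeg, dMag_val, dMag_val]
      cases c' <;> simp
  · exact congrArg val (one_mul c').symm

theorem zero_smulD (P : Digits M) : smulD 0 P = zeroD := rfl

/-- Induction along the rows. Equality of a row with `f i` becomes a bounded formula because neither
side has digits beyond `M.len W + L`. -/
theorem forall_rows_eq {W : M.Str} {l : M.Num} {f : M.Num → Digits M}
    [Def (fun z : (M.Num × M.Num) × M.Num => f z.1.2 z.2)] (a : M.Num) (L : M.Num)
    (hL : ∀ i b, f i b → b ≤ L) (h0 : dRow W a = f a)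
    (hs : ∀ i, a ≤ i → i < l → dRow W i = f i → dRow W (i + 1) = f (i + 1)) :
    ∀ i, a ≤ i → i ≤ l → dRow W i = f i := by
  intro i
  have hw : ∀ i b, ¬ b ≤ M.len W + L → (npair i b ∈ W ↔ f i b) := fun i b hb =>
    iff_of_false (fun h => hb (((right_le_npair _ _).trans (Str.le_len h)).trans le_self_add))
      fun h => hb ((hL i b h).trans le_add_self)
  have key : ∀ i, (∀ b, b ≤ M.len W + L → (npair i b ∈ W ↔ f i b)) ↔ dRow W i = f i := by
    intro i
    refine ⟨fun h => funext fun b => propext ?_, fun h b _ => iff_of_eq (congrFun h b)⟩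
    by_cases hb : b ≤ M.len W + L
    · exact h b hb
    · exact hw i b hb
  rw [← key]
  refine Num.induction (p := fun i => a ≤ i → i ≤ l →
    ∀ b, b ≤ M.len W + L → (npair i b ∈ W ↔ f i b)) ?_ (fun i ih ha hi => ?_) i
  · intro ha _
    rw [key, ← le_antisymm ha zero_le]
    exact h0
  · rcases ha.lt_or_eq with ha | rfl
    · have ha := Num.lt_add_one_iff'.1 ha
      have hi := Num.add_one_le_iff.1 hi
      rw [key]
      exact hs i ha hi ((key i).1 (ih ha hi.le))
    · rw [key]; exact h0

end Coding

/-! ### Products with a factor 0, 1 or -1 by the school method. -/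

section Products
variable {M : TwoSorted.{u}} [VModel M]

/-- `C` is the product of the integers `P` and `Q`. -/
def HasProd (P Q C : Digits M) : Prop := ∀ R, IntMul P Q R ↔ R = C

/-- For the multiplicand 1 the i-th partial sum is the part of `Q` below position i: each step adds
at most the digit i, which is disjoint from what is there. For 0 all partial sums vanish. -/
theorem natMul_zero_one {Q R : Digits M} (hQ : IsStr Q) (q : Prop) :
    NatMul (fun b => b = 0 ∧ q) Q R ↔ R = fun b => Q b ∧ q := by
  obtain ⟨X, rfl⟩ := hQ
  have hshift : ∀ i : M.Num, (fun b => dStr X i ∧ dShift (fun b => b = 0 ∧ q) i b) =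
      fun b => b = i ∧ b ∈ X ∧ q := by
    intro i; funext b
    simp only [dShift, dStr, eq_iff_iff]
    constructor
    · rintro ⟨h, _, rfl, rfl, hq⟩; rw [add_zero]; exact ⟨rfl, h, hq⟩
    · rintro ⟨rfl, h, hq⟩; exact ⟨h, 0, (add_zero b).symm, rfl, hq⟩
  have hadd : ∀ (i : M.Num) (R : Digits M),
      NatAdd (fun b => b < i ∧ b ∈ X ∧ q) (fun b => b = i ∧ b ∈ X ∧ q) R ↔
        R = fun b => b < i + 1 ∧ b ∈ X ∧ q := by
    intro i R
    rw [natAdd_of_disjoint (fun k h => h.1.1.ne h.2.1)]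
    simp only [Num.lt_add_one_iff', le_iff_lt_or_eq, or_and_right]
  simp only [NatMul, rimp_iff, same_iff, hshift, dZero_eq]
  constructor
  · rintro ⟨W, l, hl, h0, hs, rfl⟩
    have := forall_rows_eq (W := W) (l := l) (f := fun i b => b < i ∧ b ∈ X ∧ q) 0 (M.len X)
      (fun _ _ h => Str.le_len h.2.1) (by rw [h0]; funext b; simp [zeroD]) (fun i _ hi ih => by
        have := hs i hi
        rwa [ih, hadd] at this) l zero_le le_rfl
    rw [this]
    funext b
    refine propext ⟨fun h => h.2, fun h => ⟨lt_of_not_ge fun hb => hl b hb h.1, h⟩⟩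
  · rintro rfl
    obtain ⟨W, hW⟩ := exists_rows (p := fun i b : M.Num => b < i ∧ b ∈ X ∧ q) (M.len X) (M.len X)
      (fun _ _ _ h => Str.le_len h.2.1)
    refine ⟨W, M.len X, fun i hi h => (Str.lt_len h).not_ge hi, ?_, fun i hi => ?_, ?_⟩
    · rw [hW 0 zero_le]; funext b; simp [zeroD]
    · rw [hW _ hi.le, hW _ (Num.add_one_le_iff.2 hi), hadd]
    · rw [hW _ le_rfl]; funext b
      exact propext ⟨fun h => ⟨Str.lt_len h.1, h⟩, fun h => h.2⟩

/-- Only the first step can contribute, so the partial sums are constant from row 1 on, and a string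
with `l = 1` witnesses the product. -/
theorem natMul_by_zero_one {Q R : Digits M} (hQ : IsStr Q) (q : Prop) :
    NatMul Q (fun b => b = 0 ∧ q) R ↔ R = fun b => Q b ∧ q := by
  obtain ⟨X, rfl⟩ := hQ
  have hshift : ∀ i : M.Num, (fun b => (i = 0 ∧ q) ∧ dShift (dStr X) i b) =
      fun b => i = 0 ∧ b ∈ X ∧ q := by
    intro i; funext b
    simp only [dShift, dStr, eq_iff_iff]
    constructor
    · rintro ⟨⟨rfl, hq⟩, c, rfl, h⟩; rw [zero_add]; exact ⟨rfl, h, hq⟩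
    · rintro ⟨rfl, h, hq⟩; exact ⟨⟨rfl, hq⟩, b, (zero_add b).symm, h⟩
  have hadd : ∀ (i : M.Num) (R : Digits M),
      NatAdd (fun b => 0 < i ∧ b ∈ X ∧ q) (fun b => i = 0 ∧ b ∈ X ∧ q) R ↔
        R = fun b => 0 < i + 1 ∧ b ∈ X ∧ q := by
    intro i R
    rw [natAdd_of_disjoint (fun k h => h.1.1.ne' h.2.1)]
    have : ∀ b, (0 < i ∧ b ∈ X ∧ q ∨ i = 0 ∧ b ∈ X ∧ q) ↔ (0 < i + 1 ∧ b ∈ X ∧ q) := fun b => by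
      rw [← or_and_right, Num.lt_add_one_iff', le_iff_lt_or_eq, eq_comm (a := (0 : M.Num))]
    simp only [this]
  simp only [NatMul, rimp_iff, same_iff, hshift, dZero_eq]
  constructor
  · rintro ⟨W, l, hl, h0, hs, rfl⟩
    have := forall_rows_eq (W := W) (l := l) (f := fun i b => 0 < i ∧ b ∈ X ∧ q) 0 (M.len X)
      (fun _ _ h => Str.le_len h.2.1) (by rw [h0]; funext b; simp [zeroD]) (fun i _ hi ih => by
        have := hs i hi
        rwa [ih, hadd] at this) l zero_le le_rfl
    rw [this]
    funext b
    refine propext ⟨fun h => h.2, fun h => ⟨?_, h⟩⟩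
    exact lt_of_not_ge fun hb => hl 0 hb ⟨rfl, h.2⟩
  · rintro rfl
    obtain ⟨W, hW⟩ := exists_rows (p := fun i b : M.Num => 0 < i ∧ b ∈ X ∧ q) 1 (M.len X)
      (fun _ _ _ h => Str.le_len h.2.1)
    refine ⟨W, 1, fun i hi h => ?_, ?_, fun i hi => ?_, ?_⟩
    · rw [h.1] at hi; exact zero_lt_one.not_ge hi
    · rw [hW 0 zero_le]; funext b; simp [zeroD]
    · rw [hW _ hi.le, hW _ (Num.add_one_le_iff.2 hi), hadd]
    · rw [hW _ le_rfl]; funext b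
      exact propext ⟨fun h => ⟨zero_lt_one, h⟩, fun h => h.2⟩

theorem mag_and_iff {P : Digits M} {c : SignType} :
    (fun b => dMag P b ∧ c ≠ 0) = dMag (smulD c P) := by
  cases c
  · funext b; simp [smulD, zeroD, dMag]
  · change _ = dMag (dNeg P)
    rw [dMag_dNeg]; funext b; simp
  · change _ = dMag P
    funext b; simp

theorem smulD_zero_iff {P : Digits M} (hP : IsInt P) {c : SignType} :
    smulD c P 0 ↔ Nonzero (dMag (smulD c P)) ∧ ¬ (c = -1 ↔ P 0) := by
  rw [isInt_iff] at hP
  cases c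
  · simp [smulD, zeroD, Nonzero, dMag]
  · change dNeg P 0 ↔ Nonzero (dMag (dNeg P)) ∧ _
    rw [dMag_dNeg, dNeg_zero_iff]
    simp; tauto
  · change P 0 ↔ Nonzero (dMag P) ∧ _
    rw [nonzero_iff]
    simp; tauto

theorem hasProd_val_left {P : Digits M} (hP : IsStr P) (hi : IsInt P) (c : SignType) :
    HasProd (val c) P (smulD c P) := by
  intro R
  rw [IntMul, dMag_val, natMul_zero_one hP.dMag, mag_and_iff, rimp_iff, riff_iff, rxor_iff,
    val_zero_iff]
  constructor
  · rintro ⟨h1, h2, h3⟩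
    refine digits_ext ?_ h2
    rw [smulD_zero_iff hi, ← h2]
    rw [isInt_iff, ← nonzero_iff] at h1
    tauto
  · rintro rfl
    have := isInt_smulD (c := c) hi
    refine ⟨this, rfl, ?_⟩
    rw [smulD_zero_iff hi]
    tauto

theorem hasProd_val_right {P : Digits M} (hP : IsStr P) (hi : IsInt P) (c : SignType) :
    HasProd P (val c) (smulD c P) := by
  intro R
  rw [IntMul, dMag_val, natMul_by_zero_one hP.dMag, mag_and_iff, rimp_iff, riff_iff, rxor_iff,
    val_zero_iff]
  constructor
  · rintro ⟨h1, h2, h3⟩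
    refine digits_ext ?_ h2
    rw [smulD_zero_iff hi, ← h2]
    rw [isInt_iff, ← nonzero_iff] at h1
    tauto
  · rintro rfl
    have := isInt_smulD (c := c) hi
    refine ⟨this, rfl, ?_⟩
    rw [smulD_zero_iff hi]
    tauto

/-- With the factor 0 the other factor need not be a valid integer. This allows entries about which
nothing is known to be ignored in scalar products. -/
theorem hasProd_zero_left {P : Digits M} (hP : IsStr P) : HasProd (val 0) P zeroD := by
  intro R
  rw [IntMul, dMag_val, natMul_zero_one hP.dMag, mag_and_iff]
  constructor
  · rintro ⟨h1, h2, -⟩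
    refine digits_ext (iff_of_false (fun h => ?_) id) h2
    exact isInt_iff.1 h1 h h2
  · rintro rfl
    refine ⟨isInt_zeroD, rfl, (rimp_iff _ _).2 fun h => ?_⟩
    exact absurd rfl (nonzero_iff.1 h)

theorem hasProd_zero_right {P : Digits M} (hP : IsStr P) : HasProd P (val 0) zeroD := by
  intro R
  rw [IntMul, dMag_val, natMul_by_zero_one hP.dMag, mag_and_iff]
  constructor
  · rintro ⟨h1, h2, -⟩
    refine digits_ext (iff_of_false (fun h => ?_) id) h2
    exact isInt_iff.1 h1 h h2
  · rintro rfl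
    refine ⟨isInt_zeroD, rfl, (rimp_iff _ _).2 fun h => ?_⟩
    exact absurd rfl (nonzero_iff.1 h)

/-! ### Scalar products with few nonzero terms -/

theorem dot_step {P Q C T T' : Digits M} (h : HasProd P Q C) (hC : IsStr C) :
    (∃ U : M.Str, IntMul P Q (dStr U) ∧ IntAdd T (dStr U) T') ↔ IntAdd T C T' := by
  constructor
  · rintro ⟨U, h1, h2⟩
    rwa [(h _).1 h1] at h2
  · obtain ⟨U, rfl⟩ := hC
    exact fun h' => ⟨U, (h _).2 rfl, h'⟩

/-- Partial sums stand still while the products vanish. The row at the start must be a valid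
integer, because adding 0 would not reproduce a negative zero. -/
theorem dot_rows_eq {T : M.Str} {l a c : M.Num} {x y : M.Num → Digits M}
    (hs : ∀ r, r < l → ∃ U : M.Str, IntMul (x (r + 1)) (y (r + 1)) (dStr U) ∧
      IntAdd (dRow T r) (dStr U) (dRow T (r + 1)))
    (hc : c ≤ l) (ha : a ≤ c) (hi : IsInt (dRow T a))
    (h0 : ∀ r, a ≤ r → r < c → HasProd (x (r + 1)) (y (r + 1)) zeroD) :
    dRow T c = dRow T a := by
  obtain ⟨X, hX⟩ := isStr_dRow T a
  rw [← hX]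
  refine forall_rows_eq (W := T) (l := c) (f := fun _ b => b ∈ X) a (M.len X) (fun _ _ h => Str.le_len h) hX.symm (fun i hai hic ih => ?_) c ha le_rfl
  have := hs i (hic.trans_le hc)
  replace ih : dRow T i = dStr X := ih
  rw [dot_step (h0 i hai hic) isStr_zeroD, ih,
    intAdd_zeroD (isStr_dStr X) (hX ▸ hi) (isStr_dRow _ _)] at this
  exact this

/-- A scalar product in which at most the terms with the numbers `r₁ < r₂` are nonzero. For
`r₁ = 0` only the term with the number `r₂` is. -/
theorem dot_iff_intAdd {l r₁ r₂ : M.Num} {x y : M.Num → Digits M} {C₁ C₂ R : Digits M}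
    (h12 : r₁ < r₂) (h2 : r₂ ≤ l) (hC₁ : IsStr C₁) (hC₂ : IsStr C₂) (hi₁ : IsInt C₁)
    (hp₁ : 1 ≤ r₁ → HasProd (x r₁) (y r₁) C₁) (hz : r₁ = 0 → C₁ = zeroD)
    (hp₂ : HasProd (x r₂) (y r₂) C₂)
    (h0 : ∀ r, 1 ≤ r → r ≤ l → r ≠ r₁ → r ≠ r₂ → HasProd (x r) (y r) zeroD) (hR : IsStr R) :
    Dot l x y R ↔ IntAdd C₁ C₂ R := by
  simp only [Dot, same_iff, rimp_iff, dZero_eq]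
  constructor
  · rintro ⟨T, hT, hs, rfl⟩
    have hz₁ : dRow T r₁ = C₁ := by
      by_cases h1 : r₁ = 0
      · rw [hz h1, h1, hT]
      · obtain ⟨r, rfl⟩ := Num.exists_pred h1
        have hrl : r < l := Num.add_one_le_iff.1 (h12.le.trans h2)
        have hc := dot_rows_eq hs hrl.le zero_le (hT ▸ isInt_zeroD) fun i _ hi =>
          h0 (i + 1) le_add_self (Num.add_one_le_iff.2 (hi.trans hrl))
            (fun h => hi.ne (Num.add_one_inj h))
            ((Num.add_one_le_iff.2 hi).trans_lt ((Num.lt_add_one_iff'.2 le_rfl).trans h12)).ne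
        have := (dot_step (hp₁ le_add_self) hC₁).1 (hs r hrl)
        rw [hc, hT] at this
        exact (zeroD_intAdd hC₁ hi₁ (isStr_dRow _ _)).1 this
    obtain ⟨r, rfl⟩ := Num.exists_pred (zero_le.trans_lt h12).ne'
    have hrl := Num.add_one_le_iff.1 h2
    have h12' := Num.lt_add_one_iff'.1 h12
    have hc := dot_rows_eq hs hrl.le h12' (hz₁ ▸ hi₁) fun i hi hi' =>
      h0 (i + 1) le_add_self (Num.add_one_le_iff.2 (hi'.trans hrl))
        (fun h => (Num.add_one_le_iff.1 (h.le.trans hi)).false)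
        (fun h => hi'.ne (Num.add_one_inj h))
    have hstep := (dot_step hp₂ hC₂).1 (hs r hrl)
    rw [hc, hz₁] at hstep
    rwa [dot_rows_eq hs le_rfl h2 hstep.1 fun i hi hi' =>
      h0 (i + 1) le_add_self (Num.add_one_le_iff.2 hi')
        (fun h => (h12.trans (Num.lt_add_one_iff'.2 hi)).ne' h)
        (fun h => (Num.lt_add_one_iff'.2 hi).ne' h)]
  · intro hadd
    obtain ⟨X, rfl⟩ := hC₁
    obtain ⟨Z, rfl⟩ := hR
    -- The partial sums are 0 before `r₁`, `C₁` from there to `r₂`, and `R` from `r₂` on. If `r₁ =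
    -- 0`, the row 0 is `C₁`, which is zero in that case.
    obtain ⟨T, hT⟩ := exists_rows
      (p := fun r b : M.Num => (r₁ ≤ r ∧ r < r₂ ∧ b ∈ X) ∨ (r₂ ≤ r ∧ b ∈ Z)) l (M.len X + M.len Z) (by
        rintro i b - (h | h)
        · exact (Str.le_len h.2.2).trans le_self_add
        · exact (Str.le_len h.2).trans le_add_self)
    have hlt : ∀ r, r < r₁ → r ≤ l → dRow T r = zeroD := fun r hr hrl => by
      rw [hT r hrl]; funext b
      simp [zeroD, hr.not_ge, (hr.trans h12).not_ge]
    have hmid : ∀ r, r₁ ≤ r → r < r₂ → r ≤ l → dRow T r = dStr X := fun r hr hr' hrl => by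
      rw [hT r hrl]; funext b
      simp [dStr, hr, hr', hr'.not_ge]
    have hgt : ∀ r, r₂ ≤ r → r ≤ l → dRow T r = dStr Z := fun r hr hrl => by
      rw [hT r hrl]; funext b
      simp [dStr, hr, hr.not_gt]
    refine ⟨T, ?_, fun r hr => ?_, (hgt l h2 le_rfl).symm⟩
    · rcases (zero_le (a := r₁)).lt_or_eq with h | h
      · exact hlt 0 h zero_le
      · rw [hmid 0 h.ge (h ▸ h12) zero_le, hz h.symm]
    · have hr' := Num.add_one_le_iff.2 hr
      by_cases ha : r + 1 = r₁
      · subst ha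
        rw [dot_step (hp₁ le_add_self) (isStr_dStr X), hlt r (Num.lt_add_one_iff'.2 le_rfl) hr.le,
          hmid _ le_rfl h12 hr', zeroD_intAdd (isStr_dStr X) hi₁ (isStr_dStr X)]
      by_cases hb : r + 1 = r₂
      · subst hb
        rw [dot_step hp₂ hC₂, hmid r (Num.lt_add_one_iff'.1 h12) (Num.lt_add_one_iff'.2 le_rfl) hr.le,
          hgt _ le_rfl hr']
        exact hadd
      · rw [dot_step (h0 _ le_add_self hr' ha hb) isStr_zeroD]
        rcases lt_or_ge r r₁ with h | h
        · rw [hlt r h hr.le, hlt (r + 1) (lt_of_le_of_ne (Num.add_one_le_iff.2 h) ha) hr',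
            intAdd_zeroD isStr_zeroD isInt_zeroD isStr_zeroD]
        rcases lt_or_ge r r₂ with h' | h'
        · rw [hmid r h h' hr.le, hmid (r + 1) (h.trans le_self_add)
            (lt_of_le_of_ne (Num.add_one_le_iff.2 h') hb) hr',
            intAdd_zeroD (isStr_dStr X) hi₁ (isStr_dStr X)]
        · rw [hgt r h' hr.le, hgt (r + 1) (h'.trans le_self_add) hr',
            intAdd_zeroD (isStr_dStr Z) hadd.1 (isStr_dStr Z)]

theorem dot_iff_eq {l r₀ : M.Num} {x y : M.Num → Digits M} {C R : Digits M}
    (h1 : 1 ≤ r₀) (h2 : r₀ ≤ l) (hC : IsStr C) (hi : IsInt C)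
    (hp : HasProd (x r₀) (y r₀) C)
    (h0 : ∀ r, 1 ≤ r → r ≤ l → r ≠ r₀ → HasProd (x r) (y r) zeroD) (hR : IsStr R) :
    Dot l x y R ↔ R = C := by
  rw [dot_iff_intAdd (r₁ := 0) (zero_lt_one.trans_le h1) h2 isStr_zeroD hC isInt_zeroD
    (fun h => absurd h zero_lt_one.not_ge) (fun _ => rfl) hp (fun r hr hr' _ h => h0 r hr hr' h) hR,
    zeroD_intAdd hC hi hR]

theorem dot_unit_left {l c : M.Num} {x y : M.Num → Digits M} {a : SignType} {R : Digits M}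
    (h1 : 1 ≤ c) (h2 : c ≤ l) (hx : ∀ r, 1 ≤ r → r ≤ l → x r = val (if r = c then a else 0))
    (hy : ∀ r, 1 ≤ r → r ≤ l → IsStr (y r)) (hyi : IsInt (y c)) (hR : IsStr R) :
    Dot l x y R ↔ R = smulD a (y c) := by
  refine dot_iff_eq h1 h2 (isStr_smulD (hy c h1 h2)) (isInt_smulD hyi) ?_ (fun r hr hr' h => ?_) hR
  · rw [hx c h1 h2, if_pos rfl]; exact hasProd_val_left (hy c h1 h2) hyi a
  · rw [hx r hr hr', if_neg h]; exact hasProd_zero_left (hy r hr hr')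

theorem dot_unit_right {l c : M.Num} {x y : M.Num → Digits M} {a : SignType} {R : Digits M}
    (h1 : 1 ≤ c) (h2 : c ≤ l) (hy : ∀ r, 1 ≤ r → r ≤ l → y r = val (if r = c then a else 0))
    (hx : ∀ r, 1 ≤ r → r ≤ l → IsStr (x r)) (hxi : IsInt (x c)) (hR : IsStr R) :
    Dot l x y R ↔ R = smulD a (x c) := by
  refine dot_iff_eq h1 h2 (isStr_smulD (hx c h1 h2)) (isInt_smulD hxi) ?_ (fun r hr hr' h => ?_) hR
  · rw [hy c h1 h2, if_pos rfl]; exact hasProd_val_right (hx c h1 h2) hxi a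
  · rw [hy r hr hr', if_neg h]; exact hasProd_zero_right (hx r hr hr')

end Products

/-! ### The entries of the matrix (0 I[k]; -I[k] 0). -/

section Swap
variable {M : TwoSorted.{u}} [VModel M]

/-- The transposition of `k` and `k + 1` maps `i` to `h`. -/
def Swaps (k i h : M.Num) : Prop :=
  (i = k ∧ h = k + 1) ∨ (i = k + 1 ∧ h = k) ∨ (¬ i = k ∧ ¬ i = k + 1 ∧ h = i)

theorem Swaps.symm {k i h : M.Num} (H : Swaps k i h) : Swaps k h i := by
  unfold Swaps at *
  rcases H with ⟨rfl, rfl⟩ | ⟨rfl, rfl⟩ | ⟨h1, h2, rfl⟩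
  · exact Or.inr (Or.inl ⟨rfl, rfl⟩)
  · exact Or.inl ⟨rfl, rfl⟩
  · exact Or.inr (Or.inr ⟨h1, h2, rfl⟩)

theorem Swaps.unique {k i h h' : M.Num} (H : Swaps k i h) (H' : Swaps k i h') : h = h' := by
  have hk : ¬ k = k + 1 := fun h => (Num.lt_add_one_iff'.2 le_rfl).ne h
  unfold Swaps at *
  rcases H with ⟨rfl, rfl⟩ | ⟨rfl, rfl⟩ | ⟨h1, h2, rfl⟩ <;>
    rcases H' with ⟨h3, rfl⟩ | ⟨h3, rfl⟩ | ⟨h3, h4, rfl⟩ <;> first | rfl | tauto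

theorem Swaps.one_le {k i h : M.Num} (H : Swaps k i h) (hk : 1 ≤ k) (hi : 1 ≤ i) : 1 ≤ h := by
  rcases H with ⟨rfl, rfl⟩ | ⟨rfl, rfl⟩ | ⟨-, -, rfl⟩
  · exact le_add_self
  · exact hk
  · exact hi

theorem Swaps.le {k i h N : M.Num} (H : Swaps k i h) (hk : k < N) (hi : i ≤ N) : h ≤ N := by
  rcases H with ⟨rfl, rfl⟩ | ⟨rfl, rfl⟩ | ⟨-, -, rfl⟩
  · exact Num.add_one_le_iff.2 hk
  · exact hk.le
  · exact hi

/-- The positions of the entries `1` of the matrix `(0 I[k]; -I[k] 0)`. -/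
def PosEntry (N k i j : M.Num) : Prop := i ≤ N ∧ ∃ h, 1 ≤ h ∧ j = N + h ∧ Swaps k i h

open Classical in
/-- The entries of the matrix `(0 I[k]; -I[k] 0)`. -/
noncomputable def swapEntry (N k i j : M.Num) : SignType :=
  if PosEntry N k i j then 1 else if PosEntry N k j i then -1 else 0

theorem PosEntry.lt {N k i j : M.Num} (H : PosEntry N k i j) : N < j := by
  obtain ⟨-, h, h1, rfl, -⟩ := H
  exact lt_add_of_pos_right _ (zero_lt_one.trans_le h1)

theorem dSwapMat_eq (k i h : M.Num) : dSwapMat k i h = fun b => Swaps k i h ∧ b = 1 := by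
  funext b
  simp only [dSwapMat, dIdMat, dOne, Swaps, eq_iff_iff, eq_comm (b := h)]
  tauto

theorem dNeg_and_one (q : Prop) [Decidable q] :
    (dNeg (fun b => q ∧ b = 1) : Digits M) = val (if q then -1 else 0) := by
  by_cases hq : q
  · have : (fun b : M.Num => q ∧ b = 1) = val 1 := by funext b; simp [hq, val]
    rw [this, if_pos hq]
    exact smulD_val (M := M) (-1) 1
  · have : (fun b : M.Num => q ∧ b = 1) = val 0 := by funext b; simp [hq, val]
    rw [this, if_neg hq]
    exact smulD_val (M := M) (-1) 0

/-- A positive entry forces its column beyond `N`, so the two alternatives of the block matrix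
exclude each other. The transposition is its own inverse, which makes the lower block the negative
transpose of the upper one. -/
theorem dBlockSwap_eq (n k i j : M.Num) :
    dBlockSwap n k i j = val (swapEntry ((1 + 1) * n) k i j) := by
  classical
  set N := (1 + 1) * n with hN
  funext b
  have e1 : dBlockSwap n k i j b ↔ (PosEntry N k i j ∧ b = 1) ∨
      (j ≤ N ∧ ∃ h, 1 ≤ h ∧ i = N + h ∧ val (if Swaps k h j then -1 else 0) b) := by
    simp only [dBlockSwap, dAntidiag, dSwapMat_eq, dNeg_and_one, PosEntry]
    constructor
    · rintro (⟨h, h1, h2, h3, h4, h5⟩ | ⟨h, h1, h2, h3, h4⟩)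
      · exact Or.inl ⟨⟨h1, h, h2, h3, h4⟩, h5⟩
      · exact Or.inr ⟨h1, h, h2, h3, h4⟩
    · rintro (⟨⟨h1, h, h2, h3, h4⟩, h5⟩ | ⟨h1, h, h2, h3, h4⟩)
      · exact Or.inl ⟨h, h1, h2, h3, h4, h5⟩
      · exact Or.inr ⟨h, h1, h2, h3, h4⟩
  rw [eq_iff_iff, e1, swapEntry]
  by_cases hp : PosEntry N k i j
  · have : ¬ j ≤ N := hp.lt.not_ge
    simp [hp, this, val]
  · rw [if_neg hp]
    by_cases hq : PosEntry N k j i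
    · rw [if_pos hq]
      obtain ⟨hj, h, h1, rfl, hs⟩ := hq
      constructor
      · rintro (h' | ⟨-, h', -, h'', h3⟩)
        · exact absurd h'.1 hp
        · obtain rfl := add_left_cancel h''
          rwa [if_pos hs.symm] at h3
      · intro hv
        exact Or.inr ⟨hj, h, h1, rfl, by rwa [if_pos hs.symm]⟩
    · rw [if_neg hq, val_zero]
      refine iff_of_false ?_ id
      rintro (h' | ⟨h1, h, h2, h3, h4⟩)
      · exact hp h'.1
      · by_cases hs : Swaps k h j
        · exact hq ⟨h1, h, h2, h3, hs.symm⟩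
        · rw [if_neg hs, val_zero] at h4; exact h4

theorem swapEntry_upper {N k i c : M.Num} (hi : i ≤ N) (hc : 1 ≤ c) (h : Swaps k i c) (j : M.Num)
    [Decidable (j = N + c)] : swapEntry N k i j = if j = N + c then 1 else 0 := by
  have h2 : ¬ PosEntry N k j i := fun h => h.lt.not_ge hi
  rw [swapEntry, if_neg h2]
  have : PosEntry N k i j ↔ j = N + c := by
    constructor
    · rintro ⟨-, h', h1, rfl, hs⟩; rw [h.unique hs]
    · exact fun hj => ⟨hi, c, hc, hj, h⟩
  simp only [this]

theorem swapEntry_swap {N k i j : M.Num} : swapEntry N k j i = - swapEntry N k i j := by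
  unfold swapEntry
  by_cases h1 : PosEntry N k i j
  · have : ¬ PosEntry N k j i := fun h => (h1.lt.not_ge h.1)
    simp [h1, this]
  · by_cases h2 : PosEntry N k j i <;> simp [h1, h2]

theorem swapEntry_left {N k q c : M.Num} (hi : q ≤ N) (hc : 1 ≤ c) (h : Swaps k q c) (i : M.Num)
    [Decidable (i = N + c)] : swapEntry N k i q = if i = N + c then -1 else 0 := by
  rw [swapEntry_swap, swapEntry_upper hi hc h]
  split_ifs <;> rfl

theorem swapEntry_lower {N k h c : M.Num} (hh : 1 ≤ h) (hc : c ≤ N) (hs : Swaps k h c) (j : M.Num)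
    [Decidable (j = c)] : swapEntry N k (N + h) j = if j = c then -1 else 0 := by
  have h1 : ¬ PosEntry N k (N + h) j := fun h' =>
    (lt_add_of_pos_right N (zero_lt_one.trans_le hh)).not_ge h'.1
  rw [swapEntry, if_neg h1]
  have : PosEntry N k j (N + h) ↔ j = c := by
    constructor
    · rintro ⟨-, h', h1, h2, h3⟩
      obtain rfl := add_left_cancel h2
      exact h3.symm.unique hs
    · rintro rfl; exact ⟨hc, h, hh, rfl, hs.symm⟩
  simp only [this]

theorem swapEntry_eq_zero_of_le {N k i j : M.Num} (hi : i ≤ N) (hj : j ≤ N) :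
    swapEntry N k i j = 0 := by
  rw [swapEntry, if_neg fun h => h.lt.not_ge hj, if_neg fun h => h.lt.not_ge hi]

theorem swapEntry_eq_zero_of_lt {N k i j : M.Num} (hi : N < i) (hj : N < j) :
    swapEntry N k i j = 0 := by
  rw [swapEntry, if_neg fun h => hi.not_ge h.1, if_neg fun h => hj.not_ge h.1]

/-! ### Multiplication by the matrix `J` -/

theorem even_ne_odd (a b : M.Num) : ¬ (1 + 1) * a = (1 + 1) * b + 1 := by
  intro h
  have := lt_trichotomy a b
  simp only [toDiff_simps] at *; grind [toDiff_nonneg, diff_le_or]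

theorem exists_half (j : M.Num) : ∃ h, j = (1 + 1) * h ∨ j = (1 + 1) * h + 1 := by
  have : ∃ h, h ≤ j ∧ (j = (1 + 1) * h ∨ j = (1 + 1) * h + 1) := by
    refine Num.induction (p := fun j : M.Num =>
      ∃ h, h ≤ j ∧ (j = (1 + 1) * h ∨ j = (1 + 1) * h + 1)) ?_ (fun j ih => ?_) j
    · exact ⟨0, le_rfl, Or.inl (by simp)⟩
    · obtain ⟨h, hj, rfl | rfl⟩ := ih
      · exact ⟨h, hj.trans le_self_add, Or.inr rfl⟩
      · refine ⟨h + 1, ?_, Or.inl (by ring)⟩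
        clear hj
        by_contra; simp only [toDiff_simps] at *; grind [toDiff_nonneg, diff_le_or]
  obtain ⟨h, -, hh⟩ := this
  exact ⟨h, hh⟩

theorem exists_half_of_one_le {j : M.Num} (hj : 1 ≤ j) :
    ∃ h, j = (1 + 1) * h + 1 ∨ j = (1 + 1) * h + (1 + 1) := by
  obtain ⟨i, rfl⟩ := Num.exists_pred (zero_lt_one.trans_le hj).ne'
  obtain ⟨h, rfl | rfl⟩ := exists_half i
  · exact ⟨h, Or.inl rfl⟩
  · exact ⟨h, Or.inr (by ring)⟩

theorem dNeg_dOne : (dNeg dOne : Digits M) = val (-1) := by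
  rw [← val_one]; exact smulD_val (M := M) (-1) 1

theorem dMatJ_odd (r h : M.Num) [Decidable (r = (1 + 1) * h + (1 + 1))] :
    dMatJ r ((1 + 1) * h + 1) = val (if r = (1 + 1) * h + (1 + 1) then -1 else 0) := by
  funext b
  rw [eq_iff_iff, dMatJ]
  constructor
  · rintro (⟨g, -, h2, -⟩ | ⟨g, h1, h2, h3⟩)
    · exact absurd (by rw [h2]; ring) (even_ne_odd (g + 1) h)
    · obtain rfl := two_mul_cancel (add_right_cancel h2)
      rwa [if_pos h1, ← dNeg_dOne]
  · split_ifs with hr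
    · exact fun hb => Or.inr ⟨h, hr, rfl, by rwa [dNeg_dOne]⟩
    · rw [val_zero]; exact False.elim

theorem dMatJ_even (r h : M.Num) [Decidable (r = (1 + 1) * h + 1)] :
    dMatJ r ((1 + 1) * h + (1 + 1)) = val (if r = (1 + 1) * h + 1 then 1 else 0) := by
  funext b
  rw [eq_iff_iff, dMatJ]
  constructor
  · rintro (⟨g, h1, h2, h3⟩ | ⟨g, -, h2, -⟩)
    · obtain rfl := two_mul_cancel (add_right_cancel h2)
      rwa [if_pos h1, val_one]
    · exact absurd (by rw [← h2]; ring) (even_ne_odd (h + 1) g)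
  · split_ifs with hr
    · exact fun hb => Or.inl ⟨h, hr, rfl, by rwa [← val_one]⟩
    · rw [val_zero]; exact False.elim

theorem dot_matJ_odd {l h : M.Num} {x : M.Num → Digits M} {R : Digits M}
    (hl : (1 + 1) * h + (1 + 1) ≤ l) (hx : ∀ r, 1 ≤ r → r ≤ l → IsStr (x r) ∧ IsInt (x r))
    (hR : IsStr R) : Dot l x (fun r => dMatJ r ((1 + 1) * h + 1)) R ↔
      R = smulD (-1) (x ((1 + 1) * h + (1 + 1))) := by
  classical
  have h1 : 1 ≤ (1 + 1) * h + (1 + 1) := by by_contra; simp only [toDiff_simps] at *; grind [toDiff_nonneg, diff_le_or]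
  exact dot_unit_right h1 hl (fun r _ _ => dMatJ_odd r h) (fun r h1 h2 => (hx r h1 h2).1)
    (hx _ h1 hl).2 hR

theorem dot_matJ_even {l h : M.Num} {x : M.Num → Digits M} {R : Digits M}
    (hl : (1 + 1) * h + 1 ≤ l) (hx : ∀ r, 1 ≤ r → r ≤ l → IsStr (x r) ∧ IsInt (x r))
    (hR : IsStr R) : Dot l x (fun r => dMatJ r ((1 + 1) * h + (1 + 1))) R ↔
      R = x ((1 + 1) * h + 1) := by
  classical
  have h1 : 1 ≤ (1 + 1) * h + 1 := le_add_self
  rw [dot_unit_right (c := (1 + 1) * h + 1) (a := 1) h1 hl (fun r _ _ => dMatJ_even r h)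
    (fun r h1 h2 => (hx r h1 h2).1) (hx _ h1 hl).2 hR]
  rfl

end Swap

/-! ### Rows of the powers of M J, and the entries R J (M J)^t S. -/

section Berkowitz
variable {M : TwoSorted.{u}} [VModel M]

/-- The result is 0 or comes out of `IntAdd`, which includes validity. So entries of matrix powers
are integers even where their values are not known. -/
theorem Dot.isInt {l : M.Num} {x y : M.Num → Digits M} {R : Digits M} (h : Dot l x y R) :
    IsInt R := by
  simp only [Dot, same_iff, rimp_iff, dZero_eq] at h
  obtain ⟨T, h0, hs, rfl⟩ := h
  by_cases hl : l = 0
  · rw [hl, h0]; exact isInt_zeroD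
  · obtain ⟨r, rfl⟩ := Num.exists_pred hl
    obtain ⟨U, -, h⟩ := hs r (Num.lt_add_one_iff'.2 le_rfl)
    exact h.1

theorem matMul_iff {a b c : M.Num} {X Y Z : DMat M} : MatMul a b c X Y Z ↔
    ∀ i j, 1 ≤ i → i ≤ a → 1 ≤ j → j ≤ c → Dot b (X i) (fun r => Y r j) (Z i j) := by
  simp only [MatMul, rimp_iff, InRange, and_imp]

theorem sameMat_iff {a b : M.Num} {X Y : DMat M} : SameMat a b X Y ↔
    ∀ i j, 1 ≤ i → i ≤ a → 1 ≤ j → j ≤ b → X i j = Y i j := by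
  simp only [SameMat, rimp_iff, InRange, and_imp, same_iff]

theorem dIdMat_eq (i j : M.Num) [Decidable (i = j)] :
    dIdMat i j = val (if i = j then 1 else 0) := by
  funext b
  by_cases h : i = j <;> simp [h, dIdMat, val, dOne]

/-- The string `W` codes the powers of `X` up to the exponent `t`. -/
def IsPowers (m : M.Num) (X : DMat M) (t : M.Num) (W : M.Str) : Prop :=
  (∀ i j, 1 ≤ i → i ≤ m → 1 ≤ j → j ≤ m → dMatSeq W 0 i j = dIdMat i j) ∧
  ∀ s, s < t → ∀ i j, 1 ≤ i → i ≤ m → 1 ≤ j → j ≤ m →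
    Dot m (dMatSeq W s i) (fun r => X r j) (dMatSeq W (s + 1) i j)

theorem matPow_iff {m t : M.Num} {X Y : DMat M} : MatPow m X t Y ↔
    ∃ W, IsPowers m X t W ∧
      ∀ i j, 1 ≤ i → i ≤ m → 1 ≤ j → j ≤ m → Y i j = dMatSeq W t i j := by
  simp only [MatPow, sameMat_iff, rimp_iff, matMul_iff, IsPowers, and_assoc]

theorem exists_matPow {m t : M.Num} {X : M.Str}
    (hX : ∀ i j, 1 ≤ i → i ≤ m → 1 ≤ j → j ≤ m → IsInt (dMat X i j)) :
    ∃ Y : M.Str, MatPow m (dMat X) t (dMat Y) := by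
  have := (sat_matrixPowering (M := M) Num.nil Num.nilS).1
    (VModel.valid _ (Or.inr (by simp)) Num.nil Num.nilS) m t X
  refine (rimp_iff _ _).1 this fun i j => ?_
  rw [rimp_iff]
  exact fun h => hX i j h.1.1 h.1.2 h.2.1 h.2.2

namespace IsPowers
variable {m t : M.Num} {X : DMat M} {W : M.Str} (H : IsPowers m X t W)
include H

theorem isInt {s i j : M.Num} (hs : s ≤ t) (hi : 1 ≤ i) (hi' : i ≤ m) (hj : 1 ≤ j) (hj' : j ≤ m) :
    IsInt (dMatSeq W s i j) := by
  classical
  by_cases h : s = 0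
  · rw [h, H.1 i j hi hi' hj hj', dIdMat_eq]; exact isInt_val _
  · obtain ⟨r, rfl⟩ := Num.exists_pred h
    exact (H.2 r (Num.add_one_le_iff.1 hs) i j hi hi' hj hj').isInt

/-- Row `c` of the next power depends on row `c` of the current one only; while that is a multiple
of a unit row, multiplication by `X` just selects a row of `X`. -/
theorem row_succ {s c p : M.Num} {a : SignType} {ξ : M.Num → SignType} (hs : s < t)
    (hc : 1 ≤ c) (hc' : c ≤ m) (hp : 1 ≤ p) (hp' : p ≤ m) [∀ r, Decidable (r = p)]
    (hrow : ∀ r, 1 ≤ r → r ≤ m → dMatSeq W s c r = val (if r = p then a else 0))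
    (hX : ∀ r j, 1 ≤ r → r ≤ m → 1 ≤ j → j ≤ m → IsStr (X r j))
    (hξ : ∀ j, 1 ≤ j → j ≤ m → X p j = val (ξ j)) (j : M.Num) (hj : 1 ≤ j) (hj' : j ≤ m) :
    dMatSeq W (s + 1) c j = val (a * ξ j) := by
  have := H.2 s hs c j hc hc' hj hj'
  rw [dot_unit_left hp hp' (a := a) (fun r h h' => by rw [hrow r h h']; congr)
    (fun r h h' => hX r j h h' hj hj')
    (by rw [hξ j hj hj']; exact isInt_val _) (isStr_dMatSeq _ _ _ _)] at this
  rw [this, hξ j hj hj', smulD_val]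

theorem row_eq_zero {s₀ c : M.Num} (hm : 1 ≤ m) (hc : 1 ≤ c) (hc' : c ≤ m)
    (h0 : ∀ j, 1 ≤ j → j ≤ m → dMatSeq W s₀ c j = zeroD)
    (hX : ∀ r j, 1 ≤ r → r ≤ m → 1 ≤ j → j ≤ m → IsStr (X r j) ∧ IsInt (X r j)) (s : M.Num)
    (hs : s₀ ≤ s) (hst : s ≤ t) (j : M.Num) (hj : 1 ≤ j) (hj' : j ≤ m) :
    dMatSeq W s c j = zeroD := by
  classical
  have key : ∀ s, (∀ j, j ≤ m → 1 ≤ j → ∀ b, b ≤ M.len W →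
      ¬ npair (npair (npair s c) j) b ∈ W) ↔
      ∀ j, 1 ≤ j → j ≤ m → dMatSeq W s c j = zeroD := by
    intro s
    refine ⟨fun h j hj hj' => funext fun b => propext (iff_of_false (fun hb => ?_) id),
      fun h j hj' hj b _ hb => (iff_of_eq (congrFun (h j hj hj') b)).1 hb⟩
    exact h j hj' hj b ((right_le_npair _ _).trans (Str.le_len hb)) hb
  refine (key s).1 (Num.induction (p := fun s => s₀ ≤ s → s ≤ t → ∀ j, j ≤ m → 1 ≤ j →
    ∀ b, b ≤ M.len W → ¬ npair (npair (npair s c) j) b ∈ W) (fun h _ => ?_)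
    (fun s ih h hst => ?_) s hs hst) j hj hj'
  · rw [key, ← le_antisymm h zero_le]; exact h0
  · rw [key]
    rcases h.lt_or_eq with h | rfl
    · have ih := (key s).1 (ih (Num.lt_add_one_iff'.1 h) ((Num.lt_add_one_iff'.2 le_rfl).le.trans hst))
      intro j hj hj'
      have := H.2 s (Num.add_one_le_iff.1 hst) c j hc hc' hj hj'
      -- A zero row is 0 times a unit row at any position; position 1 is taken.
      rwa [dot_unit_left (c := 1) (a := 0) le_rfl hm
        (fun r h h' => by rw [ih r h h', ite_self, val_zero])
        (fun r h h' => (hX r j h h' hj hj').1) (hX 1 j le_rfl hm hj hj').2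
        (isStr_dMatSeq _ _ _ _), zero_smulD] at this
    · exact h0

end IsPowers

open Classical in
/-- The row `ξ J`. -/
noncomputable def jmul (ξ : M.Num → SignType) (j : M.Num) : SignType :=
  if h : ∃ h, j = (1 + 1) * h + 1 then - ξ ((1 + 1) * h.choose + (1 + 1))
  else if h : ∃ h, j = (1 + 1) * h + (1 + 1) then ξ ((1 + 1) * h.choose + 1) else 0

theorem jmul_odd (ξ : M.Num → SignType) (h : M.Num) :
    jmul ξ ((1 + 1) * h + 1) = - ξ ((1 + 1) * h + (1 + 1)) := by
  have hex : ∃ g, (1 + 1) * h + 1 = (1 + 1) * g + 1 := ⟨h, rfl⟩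
  rw [jmul, dif_pos hex, ← two_mul_cancel (add_right_cancel hex.choose_spec)]

theorem jmul_even (ξ : M.Num → SignType) (h : M.Num) :
    jmul ξ ((1 + 1) * h + (1 + 1)) = ξ ((1 + 1) * h + 1) := by
  have hex : ∃ g, (1 + 1) * h + (1 + 1) = (1 + 1) * g + (1 + 1) := ⟨h, rfl⟩
  have hno : ¬ ∃ g, (1 + 1) * h + (1 + 1) = (1 + 1) * g + 1 := by
    rintro ⟨g, hg⟩
    exact even_ne_odd (h + 1) g (by rw [← hg]; ring)
  rw [jmul, dif_neg hno, dif_pos hex, ← two_mul_cancel (add_right_cancel hex.choose_spec)]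

theorem jmul_unit_odd (a : SignType) (h : M.Num) {j : M.Num} (hj : 1 ≤ j)
    [∀ r : M.Num, Decidable (r = (1 + 1) * h + 1)] [Decidable (j = (1 + 1) * h + (1 + 1))] :
    jmul (fun r => if r = (1 + 1) * h + 1 then a else 0) j =
      if j = (1 + 1) * h + (1 + 1) then a else 0 := by
  obtain ⟨g, rfl | rfl⟩ := exists_half_of_one_le hj
  · rw [jmul_odd, if_neg, if_neg, neg_zero]
    · exact fun h' => even_ne_odd (h + 1) g (by rw [h']; ring)
    · exact fun h' => even_ne_odd (g + 1) h (by rw [← h']; ring)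
  · rw [jmul_even]
    simp only [add_left_inj]

theorem jmul_unit_even (a : SignType) (h : M.Num) {j : M.Num} (hj : 1 ≤ j)
    [∀ r : M.Num, Decidable (r = (1 + 1) * h + (1 + 1))] [Decidable (j = (1 + 1) * h + 1)] :
    jmul (fun r => if r = (1 + 1) * h + (1 + 1) then a else 0) j =
      if j = (1 + 1) * h + 1 then -a else 0 := by
  obtain ⟨g, rfl | rfl⟩ := exists_half_of_one_le hj
  · rw [jmul_odd]
    simp only [add_left_inj]
    split_ifs <;> simp
  · rw [jmul_even, if_neg, if_neg]
    · exact fun h' => even_ne_odd (g + 1) h (by rw [← h']; ring)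
    · exact fun h' => even_ne_odd (h + 1) g (by rw [h']; ring)

theorem two_mul_add_two_le {h f : M.Num} (H : (1 + 1) * h + 1 ≤ (1 + 1) * f) :
    (1 + 1) * h + (1 + 1) ≤ (1 + 1) * f := by
  have : h < f := by by_contra; simp only [toDiff_simps] at *; grind [toDiff_nonneg, diff_le_or]
  rw [← Num.add_one_le_iff] at this
  by_contra; simp only [toDiff_simps] at *; grind [toDiff_nonneg, diff_le_or]

theorem jmul_zero {ξ : M.Num → SignType} (hξ : ∀ r, 1 ≤ r → ξ r = 0) {j : M.Num}
    (hj : 1 ≤ j) : jmul ξ j = 0 := by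
  obtain ⟨h, rfl | rfl⟩ := exists_half_of_one_le hj
  · rw [jmul_odd, hξ _ (by by_contra; simp only [toDiff_simps] at *; grind [toDiff_nonneg, diff_le_or]), neg_zero]
  · rw [jmul_even, hξ _ le_add_self]

theorem dot_matJ {f j : M.Num} {x : M.Num → Digits M} {ξ : M.Num → SignType} {R : Digits M}
    (hx : ∀ r, 1 ≤ r → r ≤ (1 + 1) * f → x r = val (ξ r)) (hj : 1 ≤ j) (hjf : j ≤ (1 + 1) * f)
    (hR : IsStr R) : Dot ((1 + 1) * f) x (fun r => dMatJ r j) R ↔ R = val (jmul ξ j) := by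
  have hx' : ∀ r, 1 ≤ r → r ≤ (1 + 1) * f → IsStr (x r) ∧ IsInt (x r) := fun r h h' => by
    rw [hx r h h']; exact ⟨isStr_val _, isInt_val _⟩
  obtain ⟨h, rfl | rfl⟩ := exists_half_of_one_le hj
  · have hl := two_mul_add_two_le hjf
    rw [dot_matJ_odd hl hx' hR, hx _ (by by_contra; simp only [toDiff_simps] at *; grind [toDiff_nonneg, diff_le_or]) hl, smulD_val, jmul_odd, neg_one_mul]
  · have hl : (1 + 1) * h + 1 ≤ (1 + 1) * f := le_trans (by by_contra; simp only [toDiff_simps] at *; grind [toDiff_nonneg, diff_le_or]) hjf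
    rw [dot_matJ_even hl hx' hR, hx _ le_add_self hl, jmul_even]

/-- Multiplication by J only exchanges paired columns, one of them with a change of sign, so no sums
are needed. Negation asks whether the absolute value is nonzero; for entries 0, 1, -1 this is just
digit 1, which keeps the formula bounded. -/
theorem exists_mul_matJ {A : M.Str} {f g : M.Num} {μ : M.Num → M.Num → SignType}
    (hμ : ∀ i j, 1 ≤ i → i ≤ (1 + 1) * f → 1 ≤ j → j ≤ (1 + 1) * f →
      dMat A (g + i) (g + j) = val (μ i j)) :
    ∃ MJ : M.Str, ∀ i j, 1 ≤ i → i ≤ (1 + 1) * f → 1 ≤ j → j ≤ (1 + 1) * f →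
      dMat MJ i j = val (jmul (μ i) j) := by
  obtain ⟨Y, hY⟩ := exists_mat (p := fun i j b : M.Num => ∃ h, h ≤ j ∧
      ((j = (1 + 1) * h + 1 ∧
        ((b = 0 ∧ ¬ npair (npair (g + i) (g + ((1 + 1) * h + (1 + 1)))) 0 ∈ A ∧
            npair (npair (g + i) (g + ((1 + 1) * h + (1 + 1)))) 1 ∈ A) ∨
          ¬ b = 0 ∧ npair (npair (g + i) (g + ((1 + 1) * h + (1 + 1)))) b ∈ A)) ∨
       (j = (1 + 1) * h + (1 + 1) ∧ npair (npair (g + i) (g + ((1 + 1) * h + 1))) b ∈ A)))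
      ((1 + 1) * f) ((1 + 1) * f) (M.len A) (by
        rintro i j b - - ⟨h, -, ⟨-, ⟨rfl, -⟩ | ⟨-, hb⟩⟩ | ⟨-, hb⟩⟩
        · exact zero_le
        · exact (right_le_npair _ _).trans (Str.le_len hb)
        · exact (right_le_npair _ _).trans (Str.le_len hb))
  refine ⟨Y, fun i j hi hi' hj hj' => ?_⟩
  rw [hY i j hi' hj']
  obtain ⟨h, rfl | rfl⟩ := exists_half_of_one_le hj
  · have hm := hμ i ((1 + 1) * h + (1 + 1)) hi hi' (by by_contra; simp only [toDiff_simps] at *; grind [toDiff_nonneg, diff_le_or]) (two_mul_add_two_le hj')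
    rw [jmul_odd, ← neg_one_mul, ← smulD_val, ← hm]
    funext b
    have hnz : Nonzero (dMag (dMat A (g + i) (g + ((1 + 1) * h + (1 + 1))))) ↔
        npair (npair (g + i) (g + ((1 + 1) * h + (1 + 1)))) 1 ∈ A := by
      change _ ↔ dMat A (g + i) (g + ((1 + 1) * h + (1 + 1))) 1
      rw [hm, dMag_val]
      simp [Nonzero, val]
    refine propext (Iff.trans ⟨?_, fun H => ⟨h, ?_, Or.inl ⟨rfl, H⟩⟩⟩
      (or_congr (and_congr_right fun _ => and_congr_right fun _ => hnz.symm) Iff.rfl))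
    · rintro ⟨h', -, ⟨h1, h2⟩ | ⟨h1, -⟩⟩
      · obtain rfl := two_mul_cancel (add_right_cancel h1)
        exact h2
      · exact absurd (by rw [h1]; ring) (even_ne_odd (h' + 1) h)
    · clear hY hμ hm hnz H
      by_contra; simp only [toDiff_simps] at *; grind [toDiff_nonneg, diff_le_or]
  · have hm := hμ i ((1 + 1) * h + 1) hi hi' le_add_self (le_trans (by by_contra; simp only [toDiff_simps] at *; grind [toDiff_nonneg, diff_le_or]) hj')
    rw [jmul_even, ← hm]
    funext b
    refine propext ⟨?_, fun H => ⟨h, ?_, Or.inr ⟨rfl, H⟩⟩⟩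
    · rintro ⟨h', -, ⟨h1, -⟩ | ⟨h1, h2⟩⟩
      · exact absurd (by rw [← h1]; ring) (even_ne_odd (h + 1) h')
      · obtain rfl := two_mul_cancel (add_right_cancel h1)
        exact h2
    · clear hY hμ hm H
      by_contra; simp only [toDiff_simps] at *; grind [toDiff_nonneg, diff_le_or]

theorem exists_unit_row (c J : M.Num) (a : SignType) [∀ j, Decidable (j = c)] :
    ∃ Y : M.Str, ∀ j, j ≤ J → dMat Y 1 j = val (if j = c then a else 0) := by
  obtain ⟨Y, hY⟩ := exists_mat
    (p := fun _ j b : M.Num => j = c ∧ ((b = 1 ∧ a ≠ 0) ∨ (b = 0 ∧ a = -1))) 1 J 1 (by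
      rintro i j b - - ⟨-, ⟨rfl, -⟩ | ⟨rfl, -⟩⟩
      · exact le_rfl
      · exact zero_le_one)
  refine ⟨Y, fun j hj => ?_⟩
  rw [hY 1 j le_rfl hj]
  funext b
  by_cases h : j = c <;> simp [h, val]

theorem exists_smul_row (G : M.Str) (c J : M.Num) (a : SignType) :
    ∃ Y : M.Str, ∀ j, j ≤ J → dMat Y 1 j = smulD a (dMat G c j) := by
  cases a
  · obtain ⟨Y, hY⟩ := exists_mat (p := fun _ _ _ : M.Num => False) 1 J 0 (by tauto)
    exact ⟨Y, fun j hj => hY 1 j le_rfl hj⟩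
  · have : ∃ Y : M.Str, ∀ i j, i ≤ 1 → j ≤ J → dMat Y i j = fun b =>
        (b = 0 ∧ ¬ npair (npair c j) 0 ∈ G ∧ ∃ d, d ≤ M.len G ∧ npair (npair c j) (d + 1) ∈ G) ∨
        (¬ b = 0 ∧ npair (npair c j) b ∈ G) := exists_mat (p := fun _ j b : M.Num =>
        (b = 0 ∧ ¬ npair (npair c j) 0 ∈ G ∧ ∃ d, d ≤ M.len G ∧ npair (npair c j) (d + 1) ∈ G) ∨
        (¬ b = 0 ∧ npair (npair c j) b ∈ G)) 1 J (M.len G) (by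
          rintro i j b - - (⟨rfl, -⟩ | ⟨-, hb⟩)
          · exact zero_le
          · exact (right_le_npair _ _).trans (Str.le_len hb))
    obtain ⟨Y, hY⟩ := this
    refine ⟨Y, fun j hj => (hY 1 j le_rfl hj).trans (funext fun b => propext ?_)⟩
    refine or_congr (and_congr_right fun _ => and_congr_right fun _ => ?_) Iff.rfl
    refine exists_congr fun d => ⟨fun h => h.2, fun h => ⟨?_, h⟩⟩
    exact (le_self_add.trans (right_le_npair _ _)).trans (Str.le_len h)
  · obtain ⟨Y, hY⟩ := exists_mat (p := fun _ j b : M.Num => npair (npair c j) b ∈ G) 1 J (M.len G) (by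
      intro i j b _ _ hb
      exact (right_le_npair _ _).trans (Str.le_len hb))
    exact ⟨Y, fun j hj => hY 1 j le_rfl hj⟩

/-- R J is supported at `c` and S at `c'`, so of the power of M J only the entry in row `c` and
column `c'` affects the value; `hpow` supplies it. The rest of the power stays unknown: its
existence is the matrix powering axiom, and of row `c` only validity is used otherwise. -/
theorem berkowitzEntry_iff {A : M.Str} {f g t c c' : M.Num} {C : DMat M}
    {μ : M.Num → M.Num → SignType} {ξ : M.Num → SignType} {a a' v : SignType}
    [∀ i j : M.Num, Decidable (i = j)]
    (hCM : ∀ i j, C ((1 + 1) + i) ((1 + 1) + j) = dMat A (g + i) (g + j))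
    (hμ : ∀ i j, 1 ≤ i → i ≤ (1 + 1) * f → 1 ≤ j → j ≤ (1 + 1) * f →
      dMat A (g + i) (g + j) = val (μ i j))
    (hξ : ∀ j, 1 ≤ j → j ≤ (1 + 1) * f → C 1 ((1 + 1) + j) = val (ξ j))
    (hc : 1 ≤ c) (hcf : c ≤ (1 + 1) * f) (hc' : 1 ≤ c') (hcf' : c' ≤ (1 + 1) * f)
    (hRJ : ∀ j, 1 ≤ j → j ≤ (1 + 1) * f → jmul ξ j = if j = c then a else 0)
    (hS : ∀ i, 1 ≤ i → i ≤ (1 + 1) * f → C ((1 + 1) + i) (1 + 1) = val (if i = c' then a' else 0))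
    (hpow : ∀ X W, (∀ i j, 1 ≤ i → i ≤ (1 + 1) * f → 1 ≤ j → j ≤ (1 + 1) * f →
        X i j = val (jmul (μ i) j)) → IsPowers ((1 + 1) * f) X t W →
      smulD a (dMatSeq W t c c') = val v) {Z : Digits M} (hZ : IsStr Z) :
    BerkowitzEntry ((1 + 1) * f) C t Z ↔ Z = val (a' * v) := by
  have hMJ : ∀ MJ : M.Str, MatMul ((1 + 1) * f) ((1 + 1) * f) ((1 + 1) * f) (dMinor (1 + 1) C) dMatJ
      (dMat MJ) ↔ ∀ i j, 1 ≤ i → i ≤ (1 + 1) * f → 1 ≤ j → j ≤ (1 + 1) * f →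
        dMat MJ i j = val (jmul (μ i) j) := by
    intro MJ
    rw [matMul_iff]
    refine forall_congr' fun i => forall_congr' fun j => forall_congr' fun hi =>
      forall_congr' fun hi' => forall_congr' fun hj => forall_congr' fun hj' => ?_
    exact dot_matJ (fun r hr hr' => (hCM i r).trans (hμ i r hi hi' hr hr')) hj hj'
      (isStr_dMat _ _ _)
  have hone : ∀ i : M.Num, 1 ≤ i → i ≤ 1 → i = 1 := fun i h h' => le_antisymm h' h
  have hRJ' : ∀ RJ : M.Str, MatMul 1 ((1 + 1) * f) ((1 + 1) * f) (fun _ j => C 1 ((1 + 1) + j)) dMatJ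
      (dMat RJ) ↔ ∀ j, 1 ≤ j → j ≤ (1 + 1) * f → dMat RJ 1 j = val (if j = c then a else 0) := by
    intro RJ
    rw [matMul_iff]
    have : ∀ j, 1 ≤ j → j ≤ (1 + 1) * f → ((Dot ((1 + 1) * f) (fun r => C 1 ((1 + 1) + r))
        (fun r => dMatJ r j) (dMat RJ 1 j)) ↔ dMat RJ 1 j = val (if j = c then a else 0)) :=
      fun j hj hj' => by rw [dot_matJ hξ hj hj' (isStr_dMat _ _ _), hRJ j hj hj']
    constructor
    · exact fun h j hj hj' => (this j hj hj').1 (h 1 j le_rfl le_rfl hj hj')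
    · intro h i j hi hi' hj hj'
      rw [hone i hi hi']
      exact (this j hj hj').2 (h j hj hj')
  have hV : ∀ RJ G V : M.Str, (∀ j, 1 ≤ j → j ≤ (1 + 1) * f →
        dMat RJ 1 j = val (if j = c then a else 0)) →
      (∀ j, 1 ≤ j → j ≤ (1 + 1) * f → IsInt (dMat G c j)) →
      (MatMul 1 ((1 + 1) * f) ((1 + 1) * f) (dMat RJ) (dMat G) (dMat V) ↔
        ∀ j, 1 ≤ j → j ≤ (1 + 1) * f → dMat V 1 j = smulD a (dMat G c j)) := by
    intro RJ G V hRJ hG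
    rw [matMul_iff]
    have : ∀ j, 1 ≤ j → j ≤ (1 + 1) * f → ((Dot ((1 + 1) * f) (dMat RJ 1)
        (fun r => dMat G r j) (dMat V 1 j)) ↔ dMat V 1 j = smulD a (dMat G c j)) :=
      fun j hj hj' => dot_unit_left (y := fun r => dMat G r j) hc hcf
        (fun r hr hr' => (hRJ r hr hr').trans (by congr))
        (fun _ _ _ => isStr_dMat _ _ _) (hG j hj hj') (isStr_dMat _ _ _)
    constructor
    · exact fun h j hj hj' => (this j hj hj').1 (h 1 j le_rfl le_rfl hj hj')
    · intro h i j hi hi' hj hj'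
      rw [hone i hi hi']
      exact (this j hj hj').2 (h j hj hj')
  have hfin : ∀ V : M.Str, dMat V 1 c' = val v →
      (MatMul 1 ((1 + 1) * f) 1 (dMat V) (fun i _ => C ((1 + 1) + i) (1 + 1)) (fun _ _ => Z) ↔
        Z = val (a' * v)) := by
    intro V hv
    have := dot_unit_right (x := dMat V 1) hc' hcf' (a := a')
      (fun r h h' => (hS r h h').trans (by congr)) (fun _ _ _ => isStr_dMat _ _ _)
      (by rw [hv]; exact isInt_val _) hZ
    rw [hv, smulD_val] at this
    rw [matMul_iff, ← this]
    constructor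
    · exact fun h => h 1 1 le_rfl le_rfl le_rfl le_rfl
    · intro h i j hi hi' _ _
      rw [hone i hi hi']; exact h
  constructor
  · rintro ⟨MJ, G, RJ, V, h1, h2, h3, h4, h5⟩
    rw [hMJ] at h1
    rw [hRJ'] at h3
    obtain ⟨W, hW, hG⟩ := matPow_iff.1 h2
    rw [hV RJ G V h3 fun j hj hj' => by
      rw [hG c j hc hcf hj hj']; exact hW.isInt le_rfl hc hcf hj hj'] at h4
    refine (hfin V ?_).1 h5
    rw [h4 c' hc' hcf', hG c c' hc hcf hc' hcf']
    exact hpow _ W h1 hW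
  · intro hz
    obtain ⟨MJ, h1⟩ := exists_mul_matJ hμ
    obtain ⟨G, h2⟩ := exists_matPow (t := t) (X := MJ) fun i j hi hi' hj hj' => by
      rw [h1 i j hi hi' hj hj']; exact isInt_val _
    obtain ⟨W, hW, hG⟩ := matPow_iff.1 h2
    obtain ⟨RJ, h3⟩ := exists_unit_row c ((1 + 1) * f) a
    obtain ⟨V, h4⟩ := exists_smul_row G c ((1 + 1) * f) a
    refine ⟨MJ, G, RJ, V, (hMJ MJ).2 h1, h2, (hRJ' RJ).2 fun j _ hj' => h3 j hj',
      (hV RJ G V (fun j _ hj' => h3 j hj') fun j hj hj' => ?_).2 fun j _ hj' => h4 j hj',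
      (hfin V ?_).2 hz⟩
    · rw [hG c j hc hcf hj hj']; exact hW.isInt le_rfl hc hcf hj hj'
    · rw [h4 c' hcf', hG c c' hc hcf hc' hcf']
      exact hpow _ W h1 hW

end Berkowitz

/-! ### The Toeplitz matrices of the algorithm -/

section Stage
variable {M : TwoSorted.{u}} [VModel M]

/-- Once the followed row is supported at the index of a zero row of `X`, the next multiplication
kills it for good. -/
theorem IsPowers.row_of_zero {m t : M.Num} {X : DMat M} {W : M.Str} (H : IsPowers m X t W)
    {c : M.Num} (hc : 1 ≤ c) (hc' : c ≤ m)
    (hX : ∀ r j, 1 ≤ r → r ≤ m → 1 ≤ j → j ≤ m → IsStr (X r j) ∧ IsInt (X r j))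
    {s₀ p : M.Num} {a : SignType} (hs : s₀ ≤ t) (hp : 1 ≤ p) (hp' : p ≤ m)
    (hrow : ∀ j, 1 ≤ j → j ≤ m → dMatSeq W s₀ c j = val (if j = p then a else 0))
    (h0 : ∀ j, 1 ≤ j → j ≤ m → X p j = val 0) (j : M.Num) (hj : 1 ≤ j) (hj' : j ≤ m) :
    dMatSeq W t c j = val (if t = s₀ ∧ j = p then a else 0) := by
  rcases hs.eq_or_lt with rfl | hs
  · simp only [hrow j hj hj', true_and]
  · rw [if_neg fun h => hs.ne' h.1, val_zero]
    refine H.row_eq_zero (s₀ := s₀ + 1) (hc.trans hc') hc hc' (fun j hj hj' => ?_) hX t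
      (Num.add_one_le_iff.2 hs) le_rfl j hj hj'
    rw [H.row_succ hs hc hc' hp hp' hrow (fun r j h1 h2 h3 h4 => (hX r j h1 h2 h3 h4).1) h0 j hj hj',
      mul_zero, val_zero]

theorem one_le_two_mul_add_two (s : M.Num) : 1 ≤ (1 + 1) * s + (1 + 1) := by by_contra; simp only [toDiff_simps] at *; grind [toDiff_nonneg, diff_le_or]

theorem isInt_isStr_val (c : SignType) : IsStr (val c : Digits M) ∧ IsInt (val c : Digits M) :=
  ⟨isStr_val _, isInt_val _⟩

theorem berkowitzEntry_minor_iff {A : M.Str} {N k s f t c c' : M.Num} {ξ : M.Num → SignType}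
    {a a' v : SignType}
    (hA : ∀ i j, 1 ≤ i → i ≤ N + N → 1 ≤ j → j ≤ N + N → dMat A i j = val (swapEntry N k i j))
    (hf : s + 1 + f = N)
    (hξ : ∀ j, 1 ≤ j → swapEntry N k ((1 + 1) * s + 1) ((1 + 1) * s + (1 + 1) + j) = ξ j)
    (hc : 1 ≤ c) (hcf : c ≤ (1 + 1) * f) (hc' : 1 ≤ c') (hcf' : c' ≤ (1 + 1) * f)
    (hRJ : ∀ j, 1 ≤ j → jmul ξ j = if j = c then a else 0)
    (hS : ∀ i, 1 ≤ i → swapEntry N k ((1 + 1) * s + (1 + 1) + i) ((1 + 1) * s + (1 + 1)) =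
      if i = c' then a' else 0)
    (hpow : ∀ X W, (∀ i j, 1 ≤ i → i ≤ (1 + 1) * f → 1 ≤ j → j ≤ (1 + 1) * f → X i j =
        val (jmul (fun r => swapEntry N k ((1 + 1) * s + (1 + 1) + i)
          ((1 + 1) * s + (1 + 1) + r)) j)) →
      IsPowers ((1 + 1) * f) X t W → smulD a (dMatSeq W t c c') = val v)
    {Z : Digits M} (hZ : IsStr Z) :
    BerkowitzEntry ((1 + 1) * f) (dMinor ((1 + 1) * s) (dMat A)) t Z ↔ Z = val (a' * v) := by
  refine berkowitzEntry_iff (A := A) (g := (1 + 1) * s + (1 + 1)) (fun i j => ?_)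
    (fun i j hi hi' hj hj' => hA _ _ ?_ ?_ ?_ ?_) (fun j hj hj' => ?_) hc hcf hc' hcf'
    (fun j hj _ => hRJ j hj) (fun i hi hi' => ?_) hpow hZ
  · simp only [dMinor, ← add_assoc]
  · exact hi.trans le_add_self
  · clear hpow hRJ hS hξ hA; by_contra; simp only [toDiff_simps] at *; grind [toDiff_nonneg, diff_le_or]
  · exact hj.trans le_add_self
  · clear hpow hRJ hS hξ hA; by_contra; simp only [toDiff_simps] at *; grind [toDiff_nonneg, diff_le_or]
  · rw [dMinor, ← add_assoc, hA, hξ j hj]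
    · exact le_add_self
    · clear hpow hRJ hS hξ hA; by_contra; simp only [toDiff_simps] at *; grind [toDiff_nonneg, diff_le_or]
    · exact hj.trans le_add_self
    · clear hpow hRJ hS hξ hA; by_contra; simp only [toDiff_simps] at *; grind [toDiff_nonneg, diff_le_or]
  · rw [dMinor, ← add_assoc, hA, hS i hi]
    · exact hi.trans le_add_self
    · clear hpow hRJ hS hξ hA; by_contra; simp only [toDiff_simps] at *; grind [toDiff_nonneg, diff_le_or]
    · clear hpow hRJ hS hξ hA; by_contra; simp only [toDiff_simps] at *; grind [toDiff_nonneg, diff_le_or]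
    · clear hpow hRJ hS hξ hA; by_contra; simp only [toDiff_simps] at *; grind [toDiff_nonneg, diff_le_or]

/-- The entry `R J (M J) ^ t S` of stage `s` for the matrix `(0 I[k]; -I[k] 0)`. -/
noncomputable def stageEntry (n k s t : M.Num) : SignType :=
  if n ≤ s then 0
  else if k = (1 + 1) * s + 1 then if t = 0 then 1 else 0
  else if k = (1 + 1) * s then 0
  else if k = (1 + 1) * s + (1 + 1) then if t = 1 + 1 then -1 else 0
  else if t = 0 then -1 else 0

section Entry
variable {A : M.Str} {n N k s f t : M.Num} {Z : Digits M}
    (hA : ∀ i j, 1 ≤ i → i ≤ N + N → 1 ≤ j → j ≤ N + N → dMat A i j = val (swapEntry N k i j))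
    (hN : N = (1 + 1) * n) (hk : 1 ≤ k) (hkN : k < N) (hf : s + 1 + f = N) (hf1 : 1 ≤ f)
    (hZ : IsStr Z)
include hA hN hk hkN hf hf1 hZ

/-- Only rows and columns beyond `N` are left, where the matrix vanishes. The positions passed for R
J and S are arbitrary, since their coefficients are 0. -/
theorem entry_iff_of_le (hs : n ≤ s) :
    BerkowitzEntry ((1 + 1) * f) (dMinor ((1 + 1) * s) (dMat A)) t Z ↔ Z = val 0 := by
  have h1 : N < (1 + 1) * s + 1 := by clear hA; by_contra; simp only [toDiff_simps] at *; grind [toDiff_nonneg, diff_le_or]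
  have h2 : N < (1 + 1) * s + (1 + 1) := by clear hA; by_contra; simp only [toDiff_simps] at *; grind [toDiff_nonneg, diff_le_or]
  have h3 : 1 ≤ (1 + 1) * f := by clear hA; by_contra; simp only [toDiff_simps] at *; grind [toDiff_nonneg, diff_le_or]
  have h4 : ∀ r, N < (1 + 1) * s + (1 + 1) + r := fun r => h2.trans_le le_self_add
  rw [berkowitzEntry_minor_iff (ξ := fun _ => 0) (a := 0) (a' := 0) (v := 0) (c := 1) (c' := 1)
    hA hf (fun j _ => swapEntry_eq_zero_of_lt h1 (h4 j)) le_rfl h3 le_rfl h3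
    (fun j hj => (jmul_zero (fun _ _ => rfl) hj).trans (ite_self _).symm)
    (fun i _ => (swapEntry_eq_zero_of_lt (h4 i) h2).trans (ite_self _).symm)
    (fun X W _ _ => by rw [zero_smulD, val_zero]) hZ, mul_zero]

/-- In the numbering of the whole matrix, R has its 1 in column N + p and S its -1 in row N + p'.
The numbers `c₀` and `c'` are these positions counted after the first 2s + 2, and `c` is the
position of R J counted in the same way. -/
theorem entry_iff_of_lt (hs : s < n) {p p' c₀ c c' : M.Num} {a v : SignType}
    (hp : Swaps k ((1 + 1) * s + 1) p) (hp' : Swaps k ((1 + 1) * s + (1 + 1)) p')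
    (hc₀ : (1 + 1) * s + (1 + 1) + c₀ = N + p) (hcp : (1 + 1) * s + (1 + 1) + c' = N + p')
    (hc : 1 ≤ c) (hcf : c ≤ (1 + 1) * f)
    (hRJ : ∀ j, 1 ≤ j → jmul (fun r => if r = c₀ then 1 else 0) j = if j = c then a else 0)
    (hpow : ∀ X W, (∀ i j, 1 ≤ i → i ≤ (1 + 1) * f → 1 ≤ j → j ≤ (1 + 1) * f → X i j =
        val (jmul (fun r => swapEntry N k ((1 + 1) * s + (1 + 1) + i)
          ((1 + 1) * s + (1 + 1) + r)) j)) →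
      IsPowers ((1 + 1) * f) X t W → smulD a (dMatSeq W t c c') = val v) :
    BerkowitzEntry ((1 + 1) * f) (dMinor ((1 + 1) * s) (dMat A)) t Z ↔ Z = val (-v) := by
  have hs2 : (1 + 1) * s + (1 + 1) ≤ N := by
    rw [← Num.add_one_le_iff] at hs; clear hA hpow hRJ; by_contra; simp only [toDiff_simps] at *; grind [toDiff_nonneg, diff_le_or]
  have hs1 : (1 + 1) * s + 1 ≤ N := by clear hA hpow hRJ; by_contra; simp only [toDiff_simps] at *; grind [toDiff_nonneg, diff_le_or]
  have hp1 := hp.one_le hk le_add_self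
  have hp2 := hp'.one_le hk (one_le_two_mul_add_two s)
  have hp3 := hp'.le hkN hs2
  have hc'1 : 1 ≤ c' := by clear hA hpow hRJ; by_contra; simp only [toDiff_simps] at *; grind [toDiff_nonneg, diff_le_or]
  have hc'2 : c' ≤ (1 + 1) * f := by clear hA hpow hRJ; by_contra; simp only [toDiff_simps] at *; grind [toDiff_nonneg, diff_le_or]
  rw [berkowitzEntry_minor_iff (ξ := fun r => if r = c₀ then 1 else 0) (a := a) (a' := -1) (v := v)
    (c := c) (c' := c') hA hf (fun j _ => ?_) hc hcf hc'1 hc'2 hRJ (fun i _ => ?_) hpow hZ,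
    neg_one_mul]
  · rw [swapEntry_upper hs1 hp1 hp, ← hc₀]; simp only [add_right_inj]
  · rw [swapEntry_left hs2 hp2 hp', ← hcp]; simp only [add_right_inj]

/-- The case that the vector `R J` is annihilated by `M J`. -/
theorem entry_iff_of_row (hs : s < n) {p p' q q' c₀ c c' : M.Num} {a : SignType}
    (hp : Swaps k ((1 + 1) * s + 1) p) (hp' : Swaps k ((1 + 1) * s + (1 + 1)) p')
    (hc₀ : (1 + 1) * s + (1 + 1) + c₀ = N + p) (hcp : (1 + 1) * s + (1 + 1) + c' = N + p')
    (hcq : (1 + 1) * s + (1 + 1) + c = N + q) (hq : Swaps k q q') (hqs : q' ≤ (1 + 1) * s + (1 + 1))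
    (hq1 : 1 ≤ q) (hc : 1 ≤ c) (hcf : c ≤ (1 + 1) * f)
    (hRJ : ∀ j, 1 ≤ j → jmul (fun r => if r = c₀ then 1 else 0) j = if j = c then a else 0) :
    BerkowitzEntry ((1 + 1) * f) (dMinor ((1 + 1) * s) (dMat A)) t Z ↔
      Z = val (-(if t = 0 ∧ p' = q then a else 0)) := by
  have hs2 : (1 + 1) * s + (1 + 1) ≤ N := by
    rw [← Num.add_one_le_iff] at hs; clear hA hRJ; by_contra; simp only [toDiff_simps] at *; grind [toDiff_nonneg, diff_le_or]
  have hc'1 : 1 ≤ c' := by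
    have := hp'.one_le hk (one_le_two_mul_add_two s); clear hA hRJ; by_contra; simp only [toDiff_simps] at *; grind [toDiff_nonneg, diff_le_or]
  have hc'2 : c' ≤ (1 + 1) * f := by
    have := hp'.le hkN hs2; clear hA hRJ; by_contra; simp only [toDiff_simps] at *; grind [toDiff_nonneg, diff_le_or]
  refine entry_iff_of_lt hA hN hk hkN hf hf1 hZ hs hp hp' hc₀ hcp hc hcf hRJ fun X W hX hW => ?_
  rw [hW.row_of_zero hc hcf (fun r j h1 h2 h3 h4 => by rw [hX r j h1 h2 h3 h4]; exact isInt_isStr_val _)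
    (s₀ := 0) (p := c) (a := 1) zero_le hc hcf (fun j hj hj' => ?_) (fun j hj hj' => ?_) c' hc'1 hc'2,
    smulD_val]
  · have : c' = c ↔ p' = q := by
      rw [← add_right_inj ((1 + 1) * s + (1 + 1)), hcp, hcq, add_right_inj]
    simp only [this]
    split_ifs <;> simp
  · rw [hW.1 c j hc hcf hj hj', dIdMat_eq]
    simp only [eq_comm]
  -- Row N + q has its only entry in column `q'`, which is among the first 2s + 2, so nothing of it
  -- is left in M.
  · rw [hX c j hc hcf hj hj', jmul_zero (fun r hr => ?_) hj]
    rw [hcq, swapEntry_lower hq1 (hqs.trans hs2) hq, if_neg]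
    exact (hqs.trans_lt (lt_add_of_pos_right _ (zero_lt_one.trans_le hr))).ne'

theorem entry_iff_of_odd (hs : s < n) (hks : k = (1 + 1) * s + 1) :
    BerkowitzEntry ((1 + 1) * f) (dMinor ((1 + 1) * s) (dMat A)) t Z ↔
      Z = val (if t = 0 then 1 else 0) := by
  obtain ⟨u, hu⟩ := exists_add_of_le (Num.add_one_le_iff.2 hs)
  have h2 : (1 + 1) * s + (1 + 1) = k + 1 := by rw [hks]; ring
  -- R has its 1 in column N + 2s + 2, and J moves it to N + 2s + 1 with sign -1, exactly where S
  -- has its -1. The local positions come from n = s + 1 + u.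
  rw [entry_iff_of_row hA hN hk hkN hf hf1 hZ hs (p := (1 + 1) * s + (1 + 1))
    (p' := (1 + 1) * s + 1) (q := (1 + 1) * s + 1) (q' := (1 + 1) * s + (1 + 1))
    (c₀ := (1 + 1) * (u + s) + (1 + 1)) (c := (1 + 1) * (u + s) + 1)
    (c' := (1 + 1) * (u + s) + 1)
    (Or.inl ⟨hks.symm, h2⟩) (Or.inr (Or.inl ⟨h2, hks.symm⟩)) ?_ ?_ ?_ (Or.inl ⟨hks.symm, h2⟩)
    le_rfl le_add_self le_add_self ?_ (fun j hj => jmul_unit_even 1 _ hj)]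
  · simp only [and_true]; split_ifs <;> simp
  · rw [hN, hu]; ring
  · rw [hN, hu]; ring
  · rw [hN, hu]; ring
  · clear hA; by_contra; simp only [toDiff_simps] at *; grind [toDiff_nonneg, diff_le_or]

theorem entry_iff_of_even (hs : s < n) (hks : k = (1 + 1) * s) :
    BerkowitzEntry ((1 + 1) * f) (dMinor ((1 + 1) * s) (dMat A)) t Z ↔ Z = val 0 := by
  obtain ⟨u, hu⟩ := exists_add_of_le (Num.add_one_le_iff.2 hs)
  obtain ⟨r, rfl⟩ := Num.exists_pred (x := s) (by
    rintro rfl; rw [mul_zero] at hks; exact (zero_lt_one.trans_le hk).ne' hks)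
  have h1 : k ≠ (1 + 1) * r + 1 := by clear hA; intro h; simp only [toDiff_simps] at *; grind [toDiff_nonneg, diff_le_or]
  have h2 : k + 1 ≠ (1 + 1) * r + 1 := by clear hA; intro h; simp only [toDiff_simps] at *; grind [toDiff_nonneg, diff_le_or]
  have h3 : (1 + 1) * (r + 1) + (1 + 1) ≠ k := by clear hA; intro h; simp only [toDiff_simps] at *; grind [toDiff_nonneg, diff_le_or]
  have h4 : (1 + 1) * (r + 1) + (1 + 1) ≠ k + 1 := by clear hA; intro h; simp only [toDiff_simps] at *; grind [toDiff_nonneg, diff_le_or]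
  have h5 : (1 + 1) * (r + 1) + (1 + 1) ≠ (1 + 1) * r + 1 := by clear hA; intro h; simp only [toDiff_simps] at *; grind [toDiff_nonneg, diff_le_or]
  -- With s = r + 1, R has its 1 in column N + 2s, and J moves it to N + 2s - 1. The entry of that
  -- row of the matrix is in the removed column 2s - 1, while S is supported at N + 2s + 2, so they
  -- never meet.
  rw [entry_iff_of_row hA hN hk hkN hf hf1 hZ hs (p := (1 + 1) * (r + 1))
    (p' := (1 + 1) * (r + 1) + (1 + 1)) (q := (1 + 1) * r + 1) (q' := (1 + 1) * r + 1)
    (c₀ := (1 + 1) * (u + r) + (1 + 1)) (c := (1 + 1) * (u + r) + 1)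
    (c' := (1 + 1) * (u + r) + (1 + 1) + (1 + 1))
    (Or.inr (Or.inl ⟨by rw [hks], hks.symm⟩)) (Or.inr (Or.inr ⟨h3, h4, rfl⟩)) ?_ ?_ ?_
    (Or.inr (Or.inr ⟨h1.symm, h2.symm, rfl⟩)) ?_ le_add_self le_add_self ?_
    (fun j hj => jmul_unit_even 1 _ hj)]
  · rw [if_neg fun h => h5 h.2, neg_zero]
  · rw [hN, hu]; ring
  · rw [hN, hu]; ring
  · rw [hN, hu]; ring
  · clear hA; by_contra; simp only [toDiff_simps] at *; grind [toDiff_nonneg, diff_le_or]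
  · clear hA; by_contra; simp only [toDiff_simps] at *; grind [toDiff_nonneg, diff_le_or]

theorem entry_iff_of_ne (hs : s < n) (h0 : k ≠ (1 + 1) * s) (h1 : k ≠ (1 + 1) * s + 1)
    (h2 : k ≠ (1 + 1) * s + (1 + 1)) :
    BerkowitzEntry ((1 + 1) * f) (dMinor ((1 + 1) * s) (dMat A)) t Z ↔
      Z = val (if t = 0 then -1 else 0) := by
  obtain ⟨u, hu⟩ := exists_add_of_le (Num.add_one_le_iff.2 hs)
  have h3 : (1 + 1) * s + 1 ≠ k + 1 := by rwa [Ne, add_left_inj, eq_comm]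
  have h4 : (1 + 1) * s + (1 + 1) ≠ k + 1 := by
    rwa [Ne, ← add_assoc, add_left_inj, eq_comm]
  have hsw : Swaps k ((1 + 1) * s + (1 + 1)) ((1 + 1) * s + (1 + 1)) :=
    Or.inr (Or.inr ⟨h2.symm, h4, rfl⟩)
  -- Neither of the two rows is moved: J takes N + 2s + 1 to N + 2s + 2 with sign 1, which is the
  -- position of S.
  rw [entry_iff_of_row hA hN hk hkN hf hf1 hZ hs (p := (1 + 1) * s + 1)
    (p' := (1 + 1) * s + (1 + 1)) (q := (1 + 1) * s + (1 + 1)) (q' := (1 + 1) * s + (1 + 1))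
    (c₀ := (1 + 1) * (u + s) + 1) (c := (1 + 1) * (u + s) + (1 + 1))
    (c' := (1 + 1) * (u + s) + (1 + 1))
    (Or.inr (Or.inr ⟨h1.symm, h3, rfl⟩)) hsw ?_ ?_ ?_ hsw
    le_rfl (one_le_two_mul_add_two s) (one_le_two_mul_add_two _) ?_
    (fun j hj => jmul_unit_odd 1 _ hj)]
  · simp only [and_true]; split_ifs <;> simp
  · rw [hN, hu]; ring
  · rw [hN, hu]; ring
  · rw [hN, hu]; ring
  · clear hA; by_contra; simp only [toDiff_simps] at *; grind [toDiff_nonneg, diff_le_or]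

/-- R J is the unit row at N + 2s + 2. Row N + 2s + 2 of the matrix has -1 in column 2s + 3, which J
moves to 2s + 4; row 2s + 4 has 1 in column N + 2s + 4, which J moves to N + 2s + 3 with sign -1. So
R J (M J)² is the unit row at N + 2s + 3, where S has its -1. The entry of row N + 2s + 3 lies in
the removed column 2s + 2, so all higher powers give 0. -/
theorem entry_iff_of_next (hs : s < n) (hks : k = (1 + 1) * s + (1 + 1)) :
    BerkowitzEntry ((1 + 1) * f) (dMinor ((1 + 1) * s) (dMat A)) t Z ↔
      Z = val (if t = 1 + 1 then -1 else 0) := by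
  obtain ⟨u, hu⟩ := exists_add_of_le (Num.add_one_le_iff.2 hs)
  have h3 : (1 + 1) * s + 1 ≠ k := by clear hA; intro h; simp only [toDiff_simps] at *; grind [toDiff_nonneg, diff_le_or]
  have h4 : (1 + 1) * s + 1 ≠ k + 1 := by clear hA; intro h; simp only [toDiff_simps] at *; grind [toDiff_nonneg, diff_le_or]
  have h5 : (1 + 1) * s + (1 + 1) + (1 + 1) ≠ k := by clear hA; intro h; simp only [toDiff_simps] at *; grind [toDiff_nonneg, diff_le_or]
  have h6 : (1 + 1) * s + (1 + 1) + (1 + 1) ≠ k + 1 := by clear hA; intro h; simp only [toDiff_simps] at *; grind [toDiff_nonneg, diff_le_or]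
  have h7 : (1 + 1) * s + (1 + 1) + (1 + 1) ≤ N := by
    have := two_mul_add_two_le (h := s + 1) (f := n) (by
      rw [hks, hN] at hkN
      rw [mul_add, mul_one]
      exact Num.add_one_le_iff.2 hkN)
    clear hA; by_contra; simp only [toDiff_simps] at *; grind [toDiff_nonneg, diff_le_or]
  have hsw : Swaps k ((1 + 1) * s + (1 + 1)) (k + 1) := Or.inl ⟨hks.symm, rfl⟩
  have hsw' : Swaps k ((1 + 1) * s + (1 + 1) + (1 + 1)) ((1 + 1) * s + (1 + 1) + (1 + 1)) :=
    Or.inr (Or.inr ⟨h5, h6, rfl⟩)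
  have hc : 1 ≤ (1 + 1) * (u + s) + (1 + 1) := one_le_two_mul_add_two _
  have hcf : (1 + 1) * (u + s) + (1 + 1) ≤ (1 + 1) * f := by clear hA; by_contra; simp only [toDiff_simps] at *; grind [toDiff_nonneg, diff_le_or]
  have hc'f : (1 + 1) * (u + s + 1) + 1 ≤ (1 + 1) * f := by clear hA; by_contra; simp only [toDiff_simps] at *; grind [toDiff_nonneg, diff_le_or]
  have hf2 : (1 + 1 : M.Num) ≤ (1 + 1) * f := by clear hA; by_contra; simp only [toDiff_simps] at *; grind [toDiff_nonneg, diff_le_or]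
  have h12 : (1 : M.Num) ≤ 1 + 1 := le_add_self
  rw [entry_iff_of_lt hA hN hk hkN hf hf1 hZ hs (p := (1 + 1) * s + 1)
    (p' := k + 1) (c₀ := (1 + 1) * (u + s) + 1) (c := (1 + 1) * (u + s) + (1 + 1))
    (c' := (1 + 1) * (u + s + 1) + 1) (a := 1) (v := if t = 1 + 1 then 1 else 0)
    (Or.inr (Or.inr ⟨h3, h4, rfl⟩)) hsw ?_ ?_ hc hcf
    (fun j hj => jmul_unit_odd 1 _ hj) fun X W hX hW => ?_]
  · split_ifs <;> simp
  · rw [hN, hu]; ring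
  · rw [hN, hu, hks]; ring
  have hXv : ∀ r j, 1 ≤ r → r ≤ (1 + 1) * f → 1 ≤ j → j ≤ (1 + 1) * f →
      IsStr (X r j) ∧ IsInt (X r j) := fun r j h1 h2 h3 h4 => by
    rw [hX r j h1 h2 h3 h4]; exact isInt_isStr_val _
  have hXs := fun r j h1 h2 h3 h4 => (hXv r j h1 h2 h3 h4).1
  have hrow1 : ∀ j, 1 ≤ j → j ≤ (1 + 1) * f → X ((1 + 1) * (u + s) + (1 + 1)) j =
      val (if j = 1 + 1 then -1 else 0) := by
    intro j hj hj'
    rw [hX _ j hc hcf hj hj']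
    have e : (fun r => swapEntry N k ((1 + 1) * s + (1 + 1) + ((1 + 1) * (u + s) + (1 + 1)))
        ((1 + 1) * s + (1 + 1) + r)) = fun r => if r = (1 + 1) * 0 + 1 then -1 else 0 := by
      funext r
      have e1 : (1 + 1) * s + (1 + 1) + ((1 + 1) * (u + s) + (1 + 1)) =
        N + ((1 + 1) * s + (1 + 1)) := by rw [hN, hu]; ring
      rw [e1, swapEntry_lower (one_le_two_mul_add_two s) (Num.add_one_le_iff.2 hkN) hsw]
      simp only [hks, add_right_inj, mul_zero, zero_add]
    rw [e, jmul_unit_odd _ _ hj]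
    simp only [mul_zero, zero_add]
  have hrow2 : ∀ j, 1 ≤ j → j ≤ (1 + 1) * f → X (1 + 1) j =
      val (if j = (1 + 1) * (u + s + 1) + 1 then -1 else 0) := by
    intro j hj hj'
    rw [hX _ j h12 hf2 hj hj']
    have e : (fun r => swapEntry N k ((1 + 1) * s + (1 + 1) + (1 + 1))
        ((1 + 1) * s + (1 + 1) + r)) =
          fun r => if r = (1 + 1) * (u + s + 1) + (1 + 1) then 1 else 0 := by
      funext r
      have e1 : N + ((1 + 1) * s + (1 + 1) + (1 + 1)) =
        (1 + 1) * s + (1 + 1) + ((1 + 1) * (u + s + 1) + (1 + 1)) := by rw [hN, hu]; ring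
      rw [swapEntry_upper h7 ((one_le_two_mul_add_two s).trans le_self_add) hsw', e1]
      simp only [add_right_inj]
    rw [e, jmul_unit_even _ _ hj]
  have hrow3 : ∀ j, 1 ≤ j → j ≤ (1 + 1) * f → X ((1 + 1) * (u + s + 1) + 1) j = val 0 := by
    intro j hj hj'
    rw [hX _ j le_add_self hc'f hj hj', jmul_zero (fun r hr => ?_) hj]
    have e1 : (1 + 1) * s + (1 + 1) + ((1 + 1) * (u + s + 1) + 1) = N + (k + 1) := by
      rw [hN, hu, hks]; ring
    rw [e1, swapEntry_lower le_add_self ((le_self_add).trans h7) hsw.symm, if_neg]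
    exact (lt_add_of_pos_right _ (zero_lt_one.trans_le hr)).ne'
  have hW0 : ∀ j, 1 ≤ j → j ≤ (1 + 1) * f → dMatSeq W 0 ((1 + 1) * (u + s) + (1 + 1)) j =
      val (if j = (1 + 1) * (u + s) + (1 + 1) then 1 else 0) := fun j hj hj' => by
    rw [hW.1 _ j hc hcf hj hj', dIdMat_eq]; simp only [eq_comm]
  have hW1 : 0 < t → ∀ j, 1 ≤ j → j ≤ (1 + 1) * f →
      dMatSeq W 1 ((1 + 1) * (u + s) + (1 + 1)) j = val (if j = 1 + 1 then -1 else 0) := by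
    intro ht j hj hj'
    have := hW.row_succ ht hc hcf hc hcf hW0 hXs hrow1 j hj hj'
    rwa [zero_add, one_mul] at this
  have hW2 : 1 < t → ∀ j, 1 ≤ j → j ≤ (1 + 1) * f →
      dMatSeq W (1 + 1) ((1 + 1) * (u + s) + (1 + 1)) j =
        val (if j = (1 + 1) * (u + s + 1) + 1 then 1 else 0) := by
    intro ht j hj hj'
    rw [hW.row_succ ht hc hcf h12 hf2 (hW1 (zero_lt_one.trans ht)) hXs hrow2 j hj hj']
    split_ifs <;> simp
  rcases eq_or_ne t 0 with rfl | ht0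
  · rw [hW0 _ le_add_self hc'f, if_neg, if_neg, smulD_val, mul_zero]
    · exact (zero_lt_one.trans_le h12).ne
    · exact fun h => even_ne_odd (u + s + 1) (u + s + 1) (by rw [h]; ring)
  rcases eq_or_ne t 1 with rfl | ht1
  · rw [hW1 zero_lt_one _ le_add_self hc'f, if_neg, if_neg, smulD_val, mul_zero]
    · exact (Num.lt_add_one_iff'.2 le_rfl).ne
    · exact fun h => even_ne_odd 1 (u + s + 1) (by rw [h, mul_one])
  have ht : 1 < t := lt_of_le_of_ne (Num.add_one_le_iff.2 (pos_iff_ne_zero.2 ht0) |>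
    (zero_add (1 : M.Num)).symm.le.trans) ht1.symm
  rw [hW.row_of_zero hc hcf hXv (Num.add_one_le_iff.2 ht) le_add_self hc'f (hW2 ht) hrow3 _
    le_add_self hc'f, smulD_val]
  simp

theorem berkowitzEntry_iff_stageEntry :
    BerkowitzEntry ((1 + 1) * f) (dMinor ((1 + 1) * s) (dMat A)) t Z ↔
      Z = val (stageEntry n k s t) := by
  unfold stageEntry
  split_ifs with h1 h2 h3 h4 h5 h6 h7
  · exact entry_iff_of_le hA hN hk hkN hf hf1 hZ h1
  all_goals rw [not_le] at h1
  · rw [entry_iff_of_odd hA hN hk hkN hf hf1 hZ h1 h2, if_pos h3]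
  · rw [entry_iff_of_odd hA hN hk hkN hf hf1 hZ h1 h2, if_neg h3]
  · exact entry_iff_of_even hA hN hk hkN hf hf1 hZ h1 h4
  · rw [entry_iff_of_next hA hN hk hkN hf hf1 hZ h1 h5, if_pos h6]
  · rw [entry_iff_of_next hA hN hk hkN hf hf1 hZ h1 h5, if_neg h6]
  · rw [entry_iff_of_ne hA hN hk hkN hf hf1 hZ h1 h4 h2 h5, if_pos h7]
  · rw [entry_iff_of_ne hA hN hk hkN hf hf1 hZ h1 h4 h2 h5, if_neg h7]

end Entry
end Stage

/-! ### The two-diagonal Toeplitz matrices and the recursion for the coefficient vectors. -/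

section Recursion
variable {M : TwoSorted.{u}} [VModel M]

/-- The position of the second nonzero diagonal of the Toeplitz matrix of stage `s`. -/
noncomputable def stageShift (k s : M.Num) : M.Num :=
  if k = (1 + 1) * s + (1 + 1) then 1 + 1 + (1 + 1) else 1 + 1

/-- The entries on the second nonzero diagonal of the Toeplitz matrix of stage `s`. -/
noncomputable def stageSign (n k s : M.Num) : SignType :=
  if n ≤ s then 0 else if k = (1 + 1) * s + 1 then 1 else if k = (1 + 1) * s then 0 else -1

/-- The entries of the Toeplitz matrix of stage `s`. -/
noncomputable def toeplitz (n k s i j : M.Num) : SignType :=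
  if i = j then 1 else if i = j + stageShift k s then stageSign n k s else 0

/-- The entry with exponent t stands 2 + t below the diagonal, so the exponents 0 and 2 become the
shifts 2 and 4. -/
theorem stageEntry_eq (n k s t : M.Num) :
    stageEntry n k s t = if 1 + 1 + t = stageShift k s then stageSign n k s else 0 := by
  have h1 : (1 + 1) * s + (1 + 1) ≠ (1 + 1) * s + 1 := by intro h; simp only [toDiff_simps] at *; grind [toDiff_nonneg, diff_le_or]
  have h2 : (1 + 1) * s + (1 + 1) ≠ (1 + 1) * s := by intro h; simp only [toDiff_simps] at *; grind [toDiff_nonneg, diff_le_or]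
  unfold stageEntry stageShift stageSign
  by_cases hn : n ≤ s
  · simp [hn]
  · by_cases h3 : k = (1 + 1) * s + (1 + 1)
    · subst h3; simp [hn, h1]
    · simp only [hn, h3, if_false, add_eq_left]
      split_ifs <;> rfl

theorem one_add_one_le_stageShift (k s : M.Num) : 1 + 1 ≤ stageShift k s := by
  unfold stageShift; split_ifs
  · exact le_self_add
  · exact le_rfl

theorem exists_toeplitz (n k s I J : M.Num) :
    ∃ P : M.Str, ∀ i j, i ≤ I → j ≤ J → dMat P i j = val (toeplitz n k s i j) := by
  obtain ⟨P, hP⟩ := exists_mat (p := fun i j b : M.Num =>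
    (b = 1 ∧ (i = j ∨ (i = j + stageShift k s ∧ stageSign n k s ≠ 0))) ∨
    (b = 0 ∧ ¬ i = j ∧ i = j + stageShift k s ∧ stageSign n k s = -1)) I J 1 (by
      rintro i j b - - (⟨rfl, -⟩ | ⟨rfl, -⟩)
      · exact le_rfl
      · exact zero_le_one)
  refine ⟨P, fun i j hi hj => (hP i j hi hj).trans ?_⟩
  funext b
  by_cases h : i = j
  · simp [toeplitz, h, val]
  · by_cases h' : i = j + stageShift k s
    · subst h'; simp only [toeplitz, if_neg h, val]; simp [h]
    · simp [toeplitz, h, h', val]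

theorem dot_congr {l : M.Num} {x y x' y' : M.Num → Digits M} {R : Digits M}
    (h : ∀ r, 1 ≤ r → r ≤ l → x r = x' r ∧ y r = y' r) : Dot l x y R ↔ Dot l x' y' R := by
  refine exists_congr fun T => and_congr_right fun _ => and_congr_left fun _ =>
    forall_congr' fun r => ?_
  simp only [rimp_iff]
  refine forall_congr' fun hr => ?_
  have := h (r + 1) le_add_self (Num.add_one_le_iff.2 hr)
  rw [this.1, this.2]

section Matrix
variable {A : M.Str} {n N k : M.Num}
    (hA : ∀ i j, 1 ≤ i → i ≤ N + N → 1 ≤ j → j ≤ N + N → dMat A i j = val (swapEntry N k i j))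
    (hN : N = (1 + 1) * n) (hk : 1 ≤ k) (hkN : k < N)
include hA hN

theorem minor_one_two {s : M.Num} (hs : s + 1 ≤ N) :
    dMinor ((1 + 1) * s) (dMat A) 1 (1 + 1) = val 0 := by
  rw [dMinor, hA]
  · congr 1
    rcases lt_or_ge s n with h | h
    · rw [← Num.add_one_le_iff] at h
      exact swapEntry_eq_zero_of_le (by clear hA; by_contra; simp only [toDiff_simps] at *; grind [toDiff_nonneg, diff_le_or]) (by clear hA; by_contra; simp only [toDiff_simps] at *; grind [toDiff_nonneg, diff_le_or])
    · exact swapEntry_eq_zero_of_lt (by clear hA; by_contra; simp only [toDiff_simps] at *; grind [toDiff_nonneg, diff_le_or]) (by clear hA; by_contra; simp only [toDiff_simps] at *; grind [toDiff_nonneg, diff_le_or])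
  · exact le_add_self
  · clear hA; by_contra; simp only [toDiff_simps] at *; grind [toDiff_nonneg, diff_le_or]
  · exact one_le_two_mul_add_two s
  · clear hA; by_contra; simp only [toDiff_simps] at *; grind [toDiff_nonneg, diff_le_or]

include hk hkN

/-- The first subdiagonal carries c₁₂ = 0, in accordance with a shift of at least 2; the diagonals
below it are settled by `berkowitzEntry_iff_stageEntry`, with d = f + 1 so that M has size 2f. -/
theorem berkowitzMat_iff {s d : M.Num} (hd : s + d = N) (hd2 : 1 + 1 ≤ d) {P : M.Str} :
    BerkowitzMat d (dMinor ((1 + 1) * s) (dMat A)) (dMat P) ↔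
      ∀ i j, 1 ≤ i → i ≤ d + 1 → 1 ≤ j → j ≤ d → dMat P i j = val (toeplitz n k s i j) := by
  obtain ⟨f, rfl⟩ := Num.exists_pred (x := d) (by rintro rfl; clear hA; simp only [toDiff_simps] at *; grind [toDiff_nonneg, diff_le_or])
  have hf : s + 1 + f = N := by rw [← hd]; ring
  have hf1 : 1 ≤ f := by clear hA; by_contra; simp only [toDiff_simps] at *; grind [toDiff_nonneg, diff_le_or]
  have h12 := minor_one_two hA hN (s := s) (by rw [← hf]; exact le_self_add)
  have hent : ∀ t i j, BerkowitzEntry ((1 + 1) * f) (dMinor ((1 + 1) * s) (dMat A)) t (dMat P i j) ↔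
      dMat P i j = val (stageEntry n k s t) := fun t i j =>
    berkowitzEntry_iff_stageEntry hA hN hk hkN hf hf1 (isStr_dMat _ _ _)
  have hsh := one_add_one_le_stageShift k s
  have he : ∀ e, e + (1 + 1) = (1 + 1) * (f + 1) ↔ e = (1 + 1) * f := fun e => by
    rw [mul_add, mul_one, add_left_inj]
  simp only [BerkowitzMat, InRange, rimp_iff, same_iff, dZero_eq, and_imp, h12, he]
  refine forall_congr' fun i => forall_congr' fun j => forall_congr' fun _ => forall_congr' fun _ =>
    forall_congr' fun _ => forall_congr' fun _ => ?_
  constructor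
  · rintro ⟨h1, h2, h3, h4⟩
    rcases lt_trichotomy i j with h | h | h
    · have h' : i ≠ j + stageShift k s := (h.trans_le le_self_add).ne
      rw [h1 h, toeplitz, if_neg h.ne, if_neg h', val_zero]
    · rw [h2 h, toeplitz, if_pos h, val_one]
    · rcases (Num.add_one_le_iff.2 h).eq_or_lt with h' | h'
      · rw [h3 h'.symm, toeplitz, if_neg h.ne', if_neg]
        rw [← h', add_right_inj]
        exact ((Num.lt_add_one_iff'.2 le_rfl).trans_le hsh).ne
      · obtain ⟨t, rfl⟩ := exists_add_of_le (Num.add_one_le_iff.2 h')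
        have := (hent t _ _).1 (h4 t _ (by ring) rfl)
        have e : j + 1 + 1 + t = j + (1 + 1 + t) := by ring
        rw [this, stageEntry_eq, toeplitz, if_neg h.ne', e]
        simp only [add_right_inj]
  · intro h
    rw [h]
    refine ⟨fun h' => ?_, fun h' => ?_, fun h' => ?_, ?_⟩
    · have h'' : i ≠ j + stageShift k s := (h'.trans_le le_self_add).ne
      rw [toeplitz, if_neg h'.ne, if_neg h'', val_zero]
    · rw [toeplitz, if_pos h', val_one]
    · subst h'
      rw [toeplitz, if_neg (Num.lt_add_one_iff'.2 le_rfl).ne', if_neg]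
      rw [add_right_inj]
      exact ((Num.lt_add_one_iff'.2 le_rfl).trans_le hsh).ne
    · rintro t _ h' rfl
      rw [← h, hent, h, stageEntry_eq, toeplitz, h', add_assoc, if_neg]
      · simp only [add_right_inj]
      · exact (lt_add_of_pos_right _ (zero_lt_one.trans_le (le_add_self.trans le_self_add))).ne'

/-- The recursion for the coefficient vectors. -/
def IsRecursion (n k N : M.Num) (Q : M.Str) : Prop :=
  (∀ s, s + 1 = N → dMat Q s 1 = val 1 ∧ dMat Q s (1 + 1) = val 0) ∧
  ∀ s d, s + d = N → 1 + 1 ≤ d → ∀ i, 1 ≤ i → i ≤ d + 1 →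
    Dot d (fun r => val (toeplitz n k s i r)) (fun r => dMat Q (s + 1) r) (dMat Q s i)

/-- The Toeplitz strings exist by comprehension and are determined on their range, so they can be
eliminated. Only the quantifier over the coefficient vectors remains. -/
theorem isPfaffian_iff {Z : Digits M} :
    IsPfaffian N (dMat A) Z ↔ ∃ Q, IsRecursion n k N Q ∧ Z = dMat Q 0 (N + 1) := by
  have hdot : ∀ (P Q : M.Str) (s d : M.Num),
      (∀ i j, 1 ≤ i → i ≤ d + 1 → 1 ≤ j → j ≤ d → dMat P i j = val (toeplitz n k s i j)) →
      (MatMul (d + 1) d 1 (dMat P) (fun i _ => dMat Q (s + 1) i) (fun i _ => dMat Q s i) ↔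
        ∀ i, 1 ≤ i → i ≤ d + 1 →
          Dot d (fun r => val (toeplitz n k s i r)) (fun r => dMat Q (s + 1) r) (dMat Q s i)) := by
    intro P Q s d hP
    have : ∀ i, 1 ≤ i → i ≤ d + 1 →
        (Dot d (fun r => dMat P i r) (fun r => dMat Q (s + 1) r) (dMat Q s i) ↔
        Dot d (fun r => val (toeplitz n k s i r)) (fun r => dMat Q (s + 1) r) (dMat Q s i)) := by
      intro i hi hi'
      refine dot_congr fun r hr hr' => ⟨hP i r hi hi' hr hr', rfl⟩
    rw [matMul_iff]
    exact ⟨fun h i hi hi' => (this i hi hi').1 (h i 1 hi hi' le_rfl le_rfl),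
      fun h i _ hi hi' _ _ => (this i hi hi').2 (h i hi hi')⟩
  simp only [IsPfaffian, IsRecursion, rimp_iff, same_iff, and_imp, and_assoc]
  refine exists_congr fun Q => and_congr ?_ (and_congr ?_ Iff.rfl)
  · refine forall_congr' fun s => forall_congr' fun hs => ?_
    rw [minor_one_two hA hN hs.le, ← val_one]
  · refine forall_congr' fun s => forall_congr' fun d => forall_congr' fun hs =>
      forall_congr' fun hd => ?_
    simp only [berkowitzMat_iff hA hN hk hkN hs hd]
    constructor
    · rintro ⟨P, hP, h⟩
      exact (hdot P Q s d hP).1 h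
    · intro h
      obtain ⟨P, hP⟩ := exists_toeplitz n k s (d + 1) d
      have hP' : ∀ i j, 1 ≤ i → i ≤ d + 1 → 1 ≤ j → j ≤ d →
        dMat P i j = val (toeplitz n k s i j) := fun i j _ hi _ hj => hP i j hi hj
      exact ⟨P, hP', (hdot P Q s d hP').2 h⟩

end Matrix
end Recursion

/-! ### The value of the Pfaffian -/

section Uniqueness
variable {M : TwoSorted.{u}} [VModel M]

open Classical in
/-- The sign `(-1) ^ e`. -/
noncomputable def altSign (e : M.Num) : SignType := if ∃ h, e = (1 + 1) * h + 1 then -1 else 1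

theorem altSign_zero : altSign (0 : M.Num) = 1 := by
  refine if_neg ?_
  rintro ⟨h, hh⟩
  exact even_ne_odd 0 h (by rw [mul_zero, hh])

theorem altSign_succ (e : M.Num) : altSign (e + 1) = - altSign e := by
  obtain ⟨h, rfl | rfl⟩ := exists_half e
  · rw [altSign, if_pos ⟨h, rfl⟩, altSign, if_neg]
    rintro ⟨g, hg⟩
    exact even_ne_odd _ _ hg
  · rw [altSign, if_neg, altSign, if_pos ⟨h, rfl⟩, neg_neg]
    rintro ⟨g, hg⟩
    exact even_ne_odd (h + 1) g (by rw [← hg]; ring)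

theorem altSign_add (a b : M.Num) : altSign (a + b) = altSign a * altSign b := by
  obtain ⟨h, rfl | rfl⟩ := exists_half b
  · have e : altSign ((1 + 1) * h) = 1 := if_neg (by rintro ⟨g, hg⟩; exact even_ne_odd _ _ hg)
    have : altSign (a + (1 + 1) * h) = altSign a := by
      unfold altSign
      congr 1
      rw [eq_iff_iff]
      constructor
      · rintro ⟨g, hg⟩
        obtain ⟨f, rfl | rfl⟩ := exists_half a
        · exact absurd (by rw [← hg]; ring) (even_ne_odd (f + h) g)
        · exact ⟨f, rfl⟩
      · rintro ⟨g, rfl⟩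
        exact ⟨g + h, by ring⟩
    rw [this, e, mul_one]
  · have e : altSign ((1 + 1) * h + 1) = -1 := if_pos ⟨h, rfl⟩
    rw [e, ← add_assoc, altSign_succ, mul_neg_one]
    congr 1
    unfold altSign
    congr 1
    rw [eq_iff_iff]
    constructor
    · rintro ⟨g, hg⟩
      obtain ⟨f, rfl | rfl⟩ := exists_half a
      · exact absurd (by rw [← hg]; ring) (even_ne_odd (f + h) g)
      · exact ⟨f, rfl⟩
    · rintro ⟨g, rfl⟩
      exact ⟨g + h, by ring⟩

theorem dNegOnePow_eq (e : M.Num) : dNegOnePow e = val (altSign e) := by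
  funext b
  unfold altSign
  split_ifs with h <;> simp [dNegOnePow, h, val]

section DefVal
variable {Γ : Type u} [Ctx M Γ]

/-- Neither side has digits beyond `M.len Q + 1`, the added 1 covering the digit of `val c`, so the
comparison of digits can be bounded. -/
instance Def.dMat_eq_val {f g : Γ → M.Num} [DTerm f] [DTerm g] (Q : M.Str) (c : SignType) :
    Def (fun z => dMat Q (f z) (g z) = val c) :=
  have := DTerm.fst (f := f) inferInstance
  have := DTerm.fst (f := g) inferInstance
  Def.congr (p := fun z => ∀ b, b ≤ M.len Q + 1 →
      (npair (npair (f z) (g z)) b ∈ Q ↔ (b = 1 ∧ c ≠ 0) ∨ (b = 0 ∧ c = -1))) inferInstance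
    fun z => by
      constructor
      · intro h
        funext b
        refine propext ?_
        by_cases hb : b ≤ M.len Q + 1
        · exact h b hb
        · refine iff_of_false (fun h' => hb ?_) (fun h' => hb ?_)
          · exact (right_le_npair _ _).trans ((Str.le_len h').trans le_self_add)
          · rcases h' with ⟨rfl, -⟩ | ⟨rfl, -⟩
            · exact le_add_self
            · exact zero_le
      · intro h b _
        exact iff_of_eq (congrFun h b)

end DefVal

/-- The coefficient vector of stage `s` ends, from the position `p` on, with `c, 0, …, 0`. -/
def EndsWith (N : M.Num) (Q : M.Str) (c : SignType) (s p : M.Num) : Prop :=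
  dMat Q s p = val c ∧ ∀ i, i ≤ N + 1 → p < i → s + i ≤ N + 1 → dMat Q s i = val 0

/-- The bound `i ≤ N + 1` in `EndsWith`, implied by `s + i ≤ N + 1`, is there to make the quantifier
syntactically bounded. -/
instance Def.endsWith {Γ : Type u} [Ctx M Γ] {f g : Γ → M.Num} [DTerm f] [DTerm g] (N : M.Num)
    (Q : M.Str) (c : SignType) : Def (fun z => EndsWith N Q c (f z) (g z)) := by
  have := DTerm.fst (f := f) inferInstance
  have := DTerm.fst (f := g) inferInstance
  unfold EndsWith; infer_instance

theorem stageShift_eq_and_stageSign_eq {n k s : M.Num} (hs : s < n) (h0 : k ≠ (1 + 1) * s) (h1 : k ≠ (1 + 1) * s + 1)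
    (h2 : k ≠ (1 + 1) * s + (1 + 1)) : stageShift k s = 1 + 1 ∧ stageSign n k s = -1 := by
  rw [stageShift, stageSign, if_neg h2, if_neg hs.not_ge, if_neg h1, if_neg h0]
  exact ⟨rfl, rfl⟩

section Steps
variable {n N k : M.Num} {Q : M.Str} (hQ : IsRecursion n k N Q)
include hQ

/-- Coefficients before `p` may be large and unknown, but row `i` does not see them; those after `p`
vanish. A single product is left, so no addition of integers has to be carried out. -/
theorem IsRecursion.entry_eq {s d p i : M.Num} {c : SignType}
    (hd : s + d = N) (hd2 : 1 + 1 ≤ d) (hp : 1 ≤ p) (hpd : p ≤ d)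
    (h : EndsWith N Q c (s + 1) p) (hi : 1 ≤ i) (hid : i ≤ d + 1)
    (hr : ∀ r, 1 ≤ r → r < p → toeplitz n k s i r = 0) :
    dMat Q s i = val (toeplitz n k s i p * c) := by
  have h0 : ∀ r, r ≤ d → p < r → dMat Q (s + 1) r = val 0 := fun r hr hpr =>
    h.2 r (hr.trans (by rw [← hd]; exact le_add_self.trans le_self_add)) hpr (by
      clear h; by_contra; simp only [toDiff_simps] at *; grind [toDiff_nonneg, diff_le_or])
  refine (dot_iff_eq hp hpd (C := val (toeplitz n k s i p * c)) (isStr_val _) (isInt_val _) ?_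
    (fun r hr1 hrd hne => ?_) (isStr_dMat _ _ _)).1 (hQ.2 s d hd hd2 i hi hid)
  · simp only [h.1]
    rw [← smulD_val]
    exact hasProd_val_left (isStr_val _) (isInt_val _) _
  · rcases hne.lt_or_gt with hlt | hlt
    · simp only [hr r hr1 hlt]
      exact hasProd_zero_left (isStr_dMat _ _ _)
    · simp only [h0 r hrd hlt]
      exact hasProd_zero_right (isStr_val _)

theorem IsRecursion.endsWith_of_sign_eq_zero {s p : M.Num} {c : SignType}
    (hs : s + (1 + 1) ≤ N) (hp : 1 ≤ p) (hpd : s + p ≤ N) (h0 : stageSign n k s = 0)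
    (h : EndsWith N Q c (s + 1) p) : EndsWith N Q c s p := by
  obtain ⟨d, rfl⟩ := exists_add_of_le (le_self_add.trans hs)
  have hd2 := le_of_add_le_add_left hs
  have hpd := le_of_add_le_add_left hpd
  have ht : ∀ i r, i ≠ r → toeplitz n k s i r = 0 := fun i r hir => by
    rw [toeplitz, if_neg hir, h0, ite_self]
  refine ⟨?_, fun i hi hpi hsi => ?_⟩
  · rw [hQ.entry_eq rfl hd2 hp hpd h hp (hpd.trans le_self_add) fun r _ hr => ht _ _ hr.ne',
      toeplitz, if_pos rfl, one_mul]
  · rw [add_assoc] at hsi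
    rw [hQ.entry_eq rfl hd2 hp hpd h (hp.trans hpi.le) (le_of_add_le_add_left hsi)
      fun r _ hr => ht _ _ (hr.trans hpi).ne', ht _ _ hpi.ne', zero_mul]

/-- In row p + δ the diagonal, if present, meets a zero beyond `p` and the lower diagonal meets `c`.
In later rows both meet zeros. This is the multiplication of leading coefficients. -/
theorem IsRecursion.endsWith_shift {s p δ : M.Num} {c ε : SignType}
    (hδ : 1 ≤ δ) (hp : 1 ≤ p) (hpd : s + (p + δ) ≤ N + 1) (hs : s + (1 + 1) ≤ N)
    (hshift : stageShift k s = δ) (hsign : stageSign n k s = ε)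
    (h : EndsWith N Q c (s + 1) p) : EndsWith N Q (ε * c) s (p + δ) := by
  obtain ⟨d, rfl⟩ := exists_add_of_le (le_self_add.trans hs)
  have hd2 := le_of_add_le_add_left hs
  rw [add_assoc] at hpd
  have hpd := le_of_add_le_add_left hpd
  have hpd' : p ≤ d := le_of_add_le_add_right ((add_le_add_right hδ p).trans hpd)
  have hpp : p < p + δ := lt_add_of_pos_right _ (zero_lt_one.trans_le hδ)
  have ht : ∀ i r, p + δ ≤ i → r < p → toeplitz n k s i r = 0 := fun i r hi hr => by
    rw [toeplitz, if_neg (hr.trans (hpp.trans_le hi)).ne', if_neg]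
    rw [hshift]
    exact ((add_lt_add_left hr δ).trans_le hi).ne'
  refine ⟨?_, fun i hi hpi hsi => ?_⟩
  · rw [hQ.entry_eq rfl hd2 hp hpd' h (hp.trans hpp.le) hpd fun r _ hr => ht _ _ le_rfl hr,
      toeplitz, if_neg hpp.ne', hshift, if_pos rfl, hsign]
  · rw [add_assoc] at hsi
    rw [hQ.entry_eq rfl hd2 hp hpd' h (hp.trans (hpp.trans hpi).le) (le_of_add_le_add_left hsi)
      fun r _ hr => ht _ _ hpi.le hr, toeplitz, if_neg (hpp.trans hpi).ne', hshift, if_neg hpi.ne',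
      zero_mul, val_zero]

/-- From stage N - 1, where the vector is (1, 0), down to stage n the sign is 0, so only zeros are
appended. The induction is on the distance u from stage N - 1. -/
theorem IsRecursion.endsWith_of_le (hN : N = (1 + 1) * n) (hn : 1 ≤ n) : EndsWith N Q 1 n 1 := by
  have key : ∀ u, ∀ s, s ≤ N → s + u + 1 = N → n ≤ s → EndsWith N Q 1 s 1 := by
    intro u
    refine Num.induction (p := fun u => ∀ s, s ≤ N → s + u + 1 = N → n ≤ s →
      EndsWith N Q 1 s 1) ?_ ?_ u
    · intro s _ hs _
      rw [add_zero] at hs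
      refine ⟨(hQ.1 s hs).1, fun i _ h1 h2 => ?_⟩
      obtain rfl : i = 1 + 1 := by
        refine le_antisymm ?_ (Num.add_one_le_iff.2 h1)
        rw [← hs, add_assoc] at h2
        exact le_of_add_le_add_left h2
      exact (hQ.1 s hs).2
    · intro u ih s _ hs hns
      refine hQ.endsWith_of_sign_eq_zero ?_ le_rfl ?_ ?_ (ih (s + 1) ?_ ?_ ?_)
      · clear ih; by_contra; simp only [toDiff_simps] at *; grind [toDiff_nonneg, diff_le_or]
      · clear ih; by_contra; simp only [toDiff_simps] at *; grind [toDiff_nonneg, diff_le_or]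
      · rw [stageSign, if_pos hns]
      · clear ih; by_contra; simp only [toDiff_simps] at *; grind [toDiff_nonneg, diff_le_or]
      · rw [← hs]; ring
      · exact hns.trans le_self_add
  obtain ⟨m, rfl⟩ := Num.exists_pred (zero_lt_one.trans_le hn).ne'
  exact key m (m + 1) (by clear key; by_contra; simp only [toDiff_simps] at *; grind [toDiff_nonneg, diff_le_or]) (by rw [hN]; ring) le_rfl

/-- A run of ordinary stages, each with shift 2 and sign -1. The hypothesis on `s₁ + s₁ + p` keeps
the moving position within the vector, whose length grows by only 1 per stage. -/
theorem IsRecursion.endsWith_run {s₀ s₁ p : M.Num} {c : SignType} (hp : 1 ≤ p)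
    (hs : s₁ + s₁ + p ≤ N + 1) (hs1 : s₁ + 1 ≤ N)
    (hstage : ∀ s, s₀ ≤ s → s < s₁ → stageShift k s = 1 + 1 ∧ stageSign n k s = -1)
    (h : EndsWith N Q c s₁ p) (u : M.Num) (hu : s₀ + u = s₁) :
    EndsWith N Q (altSign u * c) s₀ (p + (1 + 1) * u) := by
  -- The sign varies with the induction variable. Splitting by parity leaves the fixed signs `c` and
  -- `-c`, and the parity is expressed with a bounded witness, so the induction formula is bounded.
  have halt : ∀ s v q : M.Num, EndsWith N Q (altSign v * c) s q ↔
      ((∃ h, h ≤ v ∧ v = (1 + 1) * h + 1) ∧ EndsWith N Q (-c) s q) ∨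
      ((¬ ∃ h, h ≤ v ∧ v = (1 + 1) * h + 1) ∧ EndsWith N Q c s q) := by
    intro s v q
    have : (∃ h, h ≤ v ∧ v = (1 + 1) * h + 1) ↔ ∃ h : M.Num, v = (1 + 1) * h + 1 :=
      exists_congr fun _ => and_iff_right_of_imp fun h => by clear hstage; by_contra; simp only [toDiff_simps] at *; grind [toDiff_nonneg, diff_le_or]
    rw [this]
    by_cases hv : ∃ h, v = (1 + 1) * h + 1 <;> simp [altSign, hv]
  have key : ∀ s, s ≤ s₁ → s + u = s₁ → s₀ ≤ s →
      EndsWith N Q (altSign u * c) s (p + (1 + 1) * u) := by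
    simp only [halt]
    refine Num.induction (p := fun u => ∀ s, s ≤ s₁ → s + u = s₁ → s₀ ≤ s →
      ((∃ h, h ≤ u ∧ u = (1 + 1) * h + 1) ∧ EndsWith N Q (-c) s (p + (1 + 1) * u)) ∨
      ((¬ ∃ h, h ≤ u ∧ u = (1 + 1) * h + 1) ∧ EndsWith N Q c s (p + (1 + 1) * u))) ?_ ?_ u
    · intro s _ hs _
      rw [add_zero] at hs
      rw [← halt, altSign_zero, one_mul, mul_zero, add_zero, hs]
      exact h
    · intro u ih s _ hs hs0
      simp only [← halt] at ih ⊢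
      have hs' : s + 1 + u = s₁ := by rw [← hs]; ring
      have hlt : s < s₁ := by clear ih hstage; by_contra; simp only [toDiff_simps] at *; grind [toDiff_nonneg, diff_le_or]
      obtain ⟨h1, h2⟩ := hstage s hs0 hlt
      have := hQ.endsWith_shift (p := p + (1 + 1) * u) le_add_self (hp.trans le_self_add) ?_ ?_ h1 h2
        (ih (s + 1) (Num.add_one_le_iff.2 hlt) hs' (hs0.trans le_self_add))
      · rw [altSign_succ, neg_mul, ← neg_one_mul, mul_add, mul_one, ← add_assoc]
        exact this
      · clear ih hstage; by_contra; simp only [toDiff_simps] at *; grind [toDiff_nonneg, diff_le_or]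
      · clear ih hstage; by_contra; simp only [toDiff_simps] at *; grind [toDiff_nonneg, diff_le_or]
  exact key s₀ (by rw [← hu]; exact le_self_add) hu le_rfl

/-- Let h be the integer part of k/2. The stages above h, and those at the end of the descent, are
ordinary runs. For k = 2h stage h does nothing and stage h - 1 shifts by 4 with sign -1; for k = 2h
+ 1 stage h shifts by 2 with sign 1. Either way the position moves from 1 to 2n + 1 and collects n -
1 signs. -/
theorem IsRecursion.last_eq (hN : N = (1 + 1) * n) (hk : 1 ≤ k) (hkN : k < N) :
    dMat Q 0 (N + 1) = val (altSign (n + 1)) := by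
  obtain ⟨h, hkh⟩ := exists_half k
  have hhn : h < n := by
    rw [hN] at hkN
    rcases hkh with rfl | rfl
    · clear hQ; by_contra; simp only [toDiff_simps] at *; grind [toDiff_nonneg, diff_le_or]
    · clear hQ; by_contra; simp only [toDiff_simps] at *; grind [toDiff_nonneg, diff_le_or]
  have hn : 1 ≤ n := by clear hkh; by_contra; simp only [toDiff_simps] at *; grind [toDiff_nonneg, diff_le_or]
  obtain ⟨a, ha⟩ := exists_add_of_le (Num.add_one_le_iff.2 hhn)
  have hB := hQ.endsWith_run (s₀ := h + 1) (s₁ := n) le_rfl (by rw [hN]; exact (by ring : _ = _).le)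
    (by clear hkh; by_contra; simp only [toDiff_simps] at *; grind [toDiff_nonneg, diff_le_or]) (fun s hs hsn => by
      refine stageShift_eq_and_stageSign_eq hsn ?_ ?_ ?_
      all_goals
        intro hks
        rcases hkh with hk' | hk' <;> (simp only [toDiff_simps] at *; grind [toDiff_nonneg, diff_le_or])) (hQ.endsWith_of_le hN hn) a ha.symm
  rw [mul_one] at hB
  rcases hkh with hkh | hkh
  · obtain ⟨r, rfl⟩ := Num.exists_pred (x := h) (by
      rintro rfl; rw [mul_zero] at hkh; exact (zero_lt_one.trans_le hk).ne' hkh)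
    have h1 : k ≠ (1 + 1) * (r + 1) + 1 := by clear hB; intro h; simp only [toDiff_simps] at *; grind [toDiff_nonneg, diff_le_or]
    have hC := hQ.endsWith_of_sign_eq_zero (by clear hB; by_contra; simp only [toDiff_simps] at *; grind [toDiff_nonneg, diff_le_or]) le_self_add (by clear hB; by_contra; simp only [toDiff_simps] at *; grind [toDiff_nonneg, diff_le_or])
      (by rw [stageSign, if_neg hhn.not_ge, if_neg h1, if_pos hkh]) hB
    have h2 : k = (1 + 1) * r + (1 + 1) := by rw [hkh]; ring
    have h3 : k ≠ (1 + 1) * r + 1 := by clear hB hC; intro h; simp only [toDiff_simps] at *; grind [toDiff_nonneg, diff_le_or]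
    have h4 : k ≠ (1 + 1) * r := by clear hB hC; intro h; simp only [toDiff_simps] at *; grind [toDiff_nonneg, diff_le_or]
    have h5 : ¬ n ≤ r := by clear hB hC; intro h; simp only [toDiff_simps] at *; grind [toDiff_nonneg, diff_le_or]
    have hD := hQ.endsWith_shift (δ := 1 + 1 + (1 + 1)) (ε := -1) (by clear hB hC; by_contra; simp only [toDiff_simps] at *; grind [toDiff_nonneg, diff_le_or])
      le_self_add (by clear hB hC; by_contra; simp only [toDiff_simps] at *; grind [toDiff_nonneg, diff_le_or]) (by clear hB hC; by_contra; simp only [toDiff_simps] at *; grind [toDiff_nonneg, diff_le_or]) (if_pos h2)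
      (by rw [stageSign, if_neg h5, if_neg h3, if_neg h4]) hC
    have hE := hQ.endsWith_run (s₀ := 0) (s₁ := r) (by clear hB hC hD; by_contra; simp only [toDiff_simps] at *; grind [toDiff_nonneg, diff_le_or])
      (by clear hB hC hD; by_contra; simp only [toDiff_simps] at *; grind [toDiff_nonneg, diff_le_or]) (by clear hB hC hD; by_contra; simp only [toDiff_simps] at *; grind [toDiff_nonneg, diff_le_or]) (fun s hs hsn => by
        refine stageShift_eq_and_stageSign_eq (by clear hB hC hD; by_contra; simp only [toDiff_simps] at *; grind [toDiff_nonneg, diff_le_or]) ?_ ?_ ?_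
        all_goals
          clear hB hC hD
          intro hks
          simp only [toDiff_simps] at *; grind [toDiff_nonneg, diff_le_or]) hD r (zero_add _)
    have e1 : 1 + (1 + 1) * a + (1 + 1 + (1 + 1)) + (1 + 1) * r = N + 1 := by rw [hN, ha]; ring
    have e2 : altSign (n + 1) = altSign r * (-1 * altSign a) := by
      rw [ha, show r + 1 + 1 + a + 1 = r + a + 1 + 1 + 1 by ring, altSign_succ, altSign_succ,
        altSign_succ, altSign_add]
      simp
    rw [e1, ← e2] at hE
    exact hE.1
  · have h2 : k ≠ (1 + 1) * h + (1 + 1) := by clear hB; intro h; simp only [toDiff_simps] at *; grind [toDiff_nonneg, diff_le_or]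
    have hD := hQ.endsWith_shift (δ := 1 + 1) (ε := 1) le_self_add
      le_self_add (by clear hB; by_contra; simp only [toDiff_simps] at *; grind [toDiff_nonneg, diff_le_or]) (by clear hB; by_contra; simp only [toDiff_simps] at *; grind [toDiff_nonneg, diff_le_or]) (if_neg h2)
      (by rw [stageSign, if_neg hhn.not_ge, if_pos hkh]) hB
    have hE := hQ.endsWith_run (s₀ := 0) (s₁ := h) (by clear hB hD; by_contra; simp only [toDiff_simps] at *; grind [toDiff_nonneg, diff_le_or])
      (by clear hB hD; by_contra; simp only [toDiff_simps] at *; grind [toDiff_nonneg, diff_le_or]) (by clear hB hD; by_contra; simp only [toDiff_simps] at *; grind [toDiff_nonneg, diff_le_or]) (fun s hs hsn => by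
        refine stageShift_eq_and_stageSign_eq (by clear hB hD; by_contra; simp only [toDiff_simps] at *; grind [toDiff_nonneg, diff_le_or]) ?_ ?_ ?_
        all_goals
          clear hB hD
          intro hks
          simp only [toDiff_simps] at *; grind [toDiff_nonneg, diff_le_or]) hD h (zero_add _)
    have e1 : 1 + (1 + 1) * a + (1 + 1) + (1 + 1) * h = N + 1 := by rw [hN, ha]; ring
    have e2 : altSign (n + 1) = altSign h * (1 * altSign a) := by
      rw [ha, show h + 1 + a + 1 = h + a + 1 + 1 by ring, altSign_succ, altSign_succ, altSign_add]
      simp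
    rw [e1, ← e2] at hE
    exact hE.1

end Steps
end Uniqueness

/-! ### Existence of the coefficient vectors, by matrix powering -/

section Existence
variable {M : TwoSorted.{u}} [VModel M]

/-- Division with remainder, with remainders from 1 to D to match the numbering of matrix indices.
-/
theorem block_inj {D a r a' r' : M.Num} (hr : 1 ≤ r) (hrD : r ≤ D) (hr' : 1 ≤ r') (hrD' : r' ≤ D)
    (h : a * D + r = a' * D + r') : a = a' ∧ r = r' := by
  have aux : ∀ {a r a' r' : M.Num}, 1 ≤ r' → r ≤ D → a * D + r = a' * D + r' → ¬ a < a' := by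
    intro a r a' r' hr' hrD h hlt
    obtain ⟨c, rfl⟩ := exists_add_of_le (Num.add_one_le_iff.2 hlt)
    have hc : 0 ≤ c * D := zero_le
    rw [add_mul, add_mul, one_mul] at h
    by_contra; simp only [toDiff_simps] at *; grind [toDiff_nonneg, diff_le_or]
  obtain rfl : a = a' := by
    rcases lt_trichotomy a a' with hlt | heq | hlt
    · exact absurd hlt (aux hr' hrD h)
    · exact heq
    · exact absurd hlt (aux hr hrD' h.symm)
  exact ⟨rfl, add_left_cancel h⟩

/-- Dot products with at most two nonzero products, at corresponding positions. -/
theorem dot_shift_iff {l m o r₁ r₂ : M.Num} {c : M.Num → SignType} {y x' y' : M.Num → Digits M}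
    {R : Digits M} (h12 : r₁ < r₂) (h2 : r₂ ≤ l) (hlm : o + l ≤ m)
    (hy : ∀ r, IsStr (y r)) (hyi : ∀ r, 1 ≤ r → r ≤ l → IsInt (y r))
    (hc : ∀ r, 1 ≤ r → r ≤ l → r ≠ r₁ → r ≠ r₂ → c r = 0)
    (hx' : ∀ r, 1 ≤ r → r ≤ l → x' (o + r) = y r) (hxs : ∀ r, IsStr (x' r))
    (hy' : ∀ r, 1 ≤ r → r ≤ l → y' (o + r) = val (c r))
    (hy0 : ∀ q, 1 ≤ q → q ≤ m → (∀ r, 1 ≤ r → r ≤ l → q ≠ o + r) → y' q = val 0)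
    (hR : IsStr R) :
    Dot m x' y' R ↔ Dot l (fun r => val (c r)) y R := by
  have hr2 : 1 ≤ r₂ := by
    have := Num.add_one_le_iff.2 h12
    exact le_add_self.trans this
  obtain ⟨C₁, hC₁, hi₁, hp₁, hz₁⟩ : ∃ C₁ : Digits M, IsStr C₁ ∧ IsInt C₁ ∧
      (1 ≤ r₁ → C₁ = smulD (c r₁) (y r₁)) ∧ (r₁ = 0 → C₁ = zeroD) := by
    rcases eq_or_ne r₁ 0 with h | h
    · exact ⟨zeroD, isStr_zeroD, isInt_zeroD, fun h' => absurd h (zero_lt_one.trans_le h').ne',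
        fun _ => rfl⟩
    · have h1 : 1 ≤ r₁ := by
        have := Num.add_one_le_iff.2 (pos_iff_ne_zero.2 h)
        rwa [zero_add] at this
      exact ⟨_, isStr_smulD (hy r₁), isInt_smulD (hyi r₁ h1 (h12.le.trans h2)), fun _ => rfl,
        fun h' => absurd h' h⟩
  have hzero : ∀ q, 1 ≤ q → q ≤ m → (∀ r, 1 ≤ r → r = r₁ ∨ r = r₂ → q ≠ o + r) →
      HasProd (x' q) (y' q) zeroD := by
    intro q hq hqm hne
    by_cases hex : ∃ r, 1 ≤ r ∧ r ≤ l ∧ q = o + r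
    · obtain ⟨r, h1, h2, rfl⟩ := hex
      rw [hy' r h1 h2, hc r h1 h2]
      · exact hasProd_zero_right (hxs _)
      · exact fun h => hne r h1 (Or.inl h) rfl
      · exact fun h => hne r h1 (Or.inr h) rfl
    · rw [hy0 q hq hqm fun r h1 h2 h => hex ⟨r, h1, h2, h⟩]
      exact hasProd_zero_right (hxs _)
  have hpr : ∀ r, 1 ≤ r → r ≤ l → HasProd (x' (o + r)) (y' (o + r)) (smulD (c r) (y r)) := by
    intro r h1 h2
    rw [hx' r h1 h2, hy' r h1 h2]
    exact hasProd_val_right (hy r) (hyi r h1 h2) _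
  -- Both scalar products become the same statement that the sum of `C₁` and the `r₂` term is `R`.
  -- Thus neither commutativity of multiplication nor the existence of sums of arbitrary integers is
  -- required.
  rw [dot_iff_intAdd (C₁ := C₁) (C₂ := smulD (c r₂) (y r₂)) h12 h2 hC₁ (isStr_smulD (hy r₂)) hi₁
    (fun h => by rw [hp₁ h]; exact hasProd_val_left (hy r₁) (hyi r₁ h (h12.le.trans h2)) _) hz₁
    (hasProd_val_left (hy r₂) (hyi r₂ hr2 h2) _)
    (fun r h h' h1 h2 => by rw [hc r h h' h1 h2]; exact hasProd_zero_left (hy r)) hR]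
  rcases eq_or_ne r₁ 0 with h | h
  · refine dot_iff_intAdd (r₁ := 0) (r₂ := o + r₂) (C₁ := C₁) (C₂ := smulD (c r₂) (y r₂))
      (zero_lt_one.trans_le (hr2.trans le_add_self)) ((add_le_add_right h2 o).trans hlm) hC₁
      (isStr_smulD (hy r₂)) hi₁ (fun h => absurd h zero_lt_one.not_ge) (fun _ => hz₁ h)
      (hpr r₂ hr2 h2) (fun q hq hqm _ hq2 => hzero q hq hqm ?_) hR
    rintro r hr (rfl | rfl)
    · exact absurd h (zero_lt_one.trans_le hr).ne'
    · exact hq2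
  · have h1 : 1 ≤ r₁ := by
      have := Num.add_one_le_iff.2 (pos_iff_ne_zero.2 h)
      rwa [zero_add] at this
    refine dot_iff_intAdd (r₁ := o + r₁) (r₂ := o + r₂) (C₁ := C₁) (C₂ := smulD (c r₂) (y r₂))
      (add_lt_add_right h12 o) ((add_le_add_right h2 o).trans hlm) hC₁
      (isStr_smulD (hy r₂)) hi₁ (fun _ => ?_) (fun h' => ?_)
      (hpr r₂ hr2 h2) (fun q hq hqm hq1 hq2 => hzero q hq hqm ?_) hR
    · rw [hp₁ h1]; exact hpr r₁ h1 (h12.le.trans h2)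
    · exact absurd h' (zero_lt_one.trans_le (h1.trans le_add_self)).ne'
    · rintro r hr (rfl | rfl)
      · exact hq1
      · exact hq2

theorem val_eq_or (p q : Prop) [Decidable p] [Decidable q] :
    (val (if q then -1 else if p then 1 else 0) : Digits M) =
      fun b => (b = 1 ∧ (p ∨ q)) ∨ (b = 0 ∧ q) := by
  funext b
  by_cases hq : q <;> by_cases hp : p <;> simp [val, hp, hq]

/-- The positions of the entries `1` of the Toeplitz matrix of stage `s`. -/
def ToeplitzPos (n k s i j : M.Num) : Prop :=
  i = j ∨ (s < n ∧ k = (1 + 1) * s + 1 ∧ i = j + (1 + 1))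

/-- The positions of the entries `-1` of the Toeplitz matrix of stage `s`. -/
def ToeplitzNeg (n k s i j : M.Num) : Prop :=
  s < n ∧ ((k = (1 + 1) * s + (1 + 1) ∧ i = j + (1 + 1 + (1 + 1))) ∨
    (¬ k = (1 + 1) * s ∧ ¬ k = (1 + 1) * s + 1 ∧ ¬ k = (1 + 1) * s + (1 + 1) ∧
      i = j + (1 + 1)))

-- Inside the block matrix the stage s varies with the position. The sets of positions of 1 and -1
-- are therefore written as formulas in s, i and j, to which comprehension applies.
open Classical in
theorem toeplitz_eq (n k s i j : M.Num) : toeplitz n k s i j =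
    if ToeplitzNeg n k s i j then -1 else if ToeplitzPos n k s i j then 1 else 0 := by
  have h1 : (1 + 1) * s + (1 + 1) ≠ (1 + 1) * s + 1 := by intro h; simp only [toDiff_simps] at *; grind [toDiff_nonneg, diff_le_or]
  have h2 : (1 + 1) * s + (1 + 1) ≠ (1 + 1) * s := by intro h; simp only [toDiff_simps] at *; grind [toDiff_nonneg, diff_le_or]
  have h3 : j ≠ j + (1 + 1) := by intro h; simp only [toDiff_simps] at *; grind [toDiff_nonneg, diff_le_or]
  have h4 : j ≠ j + (1 + 1 + (1 + 1)) := by intro h; simp only [toDiff_simps] at *; grind [toDiff_nonneg, diff_le_or]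
  unfold toeplitz stageShift stageSign ToeplitzNeg ToeplitzPos
  by_cases hij : i = j
  · subst hij; simp [h3, h4]
  by_cases hn : n ≤ s
  · simp [hij, hn, hn.not_gt]
  have hn' : s < n := not_le.1 hn
  by_cases hk1 : k = (1 + 1) * s + (1 + 1)
  · subst hk1; simp [hij, hn, hn', h1, h2]
  by_cases hk2 : k = (1 + 1) * s + 1
  · subst hk2; simp [hij, hn, hn', hk1]
  by_cases hk3 : k = (1 + 1) * s
  · subst hk3; simp [hij, hn, hn', hk1, hk2]
  simp [hij, hn, hn', hk1, hk2, hk3]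

section
variable {Γ : Type u} [Ctx M Γ] {f g h : Γ → M.Num} [DTerm f] [DTerm g] [DTerm h] (n k : M.Num)

instance Def.toeplitzPos : Def (fun z => ToeplitzPos n k (f z) (g z) (h z)) := by
  unfold ToeplitzPos; infer_instance

instance Def.toeplitzNeg : Def (fun z => ToeplitzNeg n k (f z) (g z) (h z)) := by
  unfold ToeplitzNeg; infer_instance

end

/-- The entries of a block matrix, nonzero above the diagonal blocks only. -/
def BlockEntry (N : M.Num) (T : M.Num → M.Num → M.Num → Prop) (p q : M.Num) : Prop :=
  ∃ a, a ≤ N ∧ ∃ r, r ≤ N ∧ ∃ i, i ≤ N + 1 ∧ ∃ s, s ≤ N ∧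
    s + (a + (1 + 1)) = N ∧ 1 ≤ r ∧ r ≤ a + (1 + 1) ∧ 1 ≤ i ∧ i ≤ a + (1 + 1) + 1 ∧
    p = a * (N + 1) + r ∧ q = (a + 1) * (N + 1) + i ∧ T s i r

instance Def.blockEntry_pos (N n k : M.Num) :
    Def (fun z : ((M.Num × M.Num) × M.Num) × M.Num =>
      BlockEntry N (ToeplitzPos n k) z.1.1.2 z.1.2) := by
  unfold BlockEntry; infer_instance

instance Def.blockEntry_neg (N n k : M.Num) :
    Def (fun z : ((M.Num × M.Num) × M.Num) × M.Num =>
      BlockEntry N (ToeplitzNeg n k) z.1.1.2 z.1.2) := by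
  unfold BlockEntry; infer_instance

theorem blockEntry_iff {N s a r i : M.Num} {T : M.Num → M.Num → M.Num → Prop}
    (hs : s + (a + (1 + 1)) = N) (hr : 1 ≤ r) (hra : r ≤ a + (1 + 1)) (hi : 1 ≤ i)
    (hia : i ≤ a + (1 + 1) + 1) :
    BlockEntry N T (a * (N + 1) + r) ((a + 1) * (N + 1) + i) ↔ T s i r := by
  have haN : a + (1 + 1) ≤ N := by rw [← hs]; exact le_add_self
  constructor
  · rintro ⟨a', -, r', -, i', -, s', -, h1, h2, h3, h4, h5, h6, h7, h8⟩
    have haN' : a' + (1 + 1) ≤ N := by rw [← h1]; exact le_add_self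
    obtain ⟨rfl, rfl⟩ := block_inj hr ((hra.trans haN).trans le_self_add) h2
      ((h3.trans haN').trans le_self_add) h6
    obtain ⟨-, rfl⟩ := block_inj hi (hia.trans (add_le_add_left haN 1)) h4
      (h5.trans (add_le_add_left haN' 1)) h7
    obtain rfl := add_right_cancel (hs.trans h1.symm)
    exact h8
  · intro h
    exact ⟨a, le_self_add.trans haN, r, hra.trans haN, i, hia.trans (add_le_add_left haN 1), s,
      by rw [← hs]; exact le_self_add, hs, hr, hra, hi, hia, rfl, rfl, h⟩

theorem BlockEntry.exists_row {N a i p : M.Num} {T : M.Num → M.Num → M.Num → Prop} (hi : 1 ≤ i)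
    (hiN : i ≤ N + 1) (h : BlockEntry N T p ((a + 1) * (N + 1) + i)) :
    ∃ r, 1 ≤ r ∧ r ≤ a + (1 + 1) ∧ p = a * (N + 1) + r := by
  obtain ⟨a', -, r', -, i', -, s', -, h1, h2, h3, h4, h5, h6, h7, -⟩ := h
  have haN' : a' + (1 + 1) ≤ N := by rw [← h1]; exact le_add_self
  obtain ⟨h8, -⟩ := block_inj hi hiN h4 (h5.trans (add_le_add_left haN' 1)) h7
  obtain rfl := add_right_cancel h8
  exact ⟨r', h2, h3, h6⟩

/-- The block in block row a and block column a + 1 is the transposed Toeplitz matrix of stage N - 2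
- a, so multiplying a row vector by `X` performs one step of the recursion. Blocks of size N + 1
accommodate the coefficient vectors of all stages. -/
theorem exists_blockMat (N n k : M.Num) : ∃ X : M.Str,
    (∀ p q, p ≤ N * (N + 1) → q ≤ N * (N + 1) → IsInt (dMat X p q)) ∧
    ∀ s a i, s + (a + (1 + 1)) = N → 1 ≤ i → i ≤ a + (1 + 1) + 1 →
      (∀ r, 1 ≤ r → r ≤ a + (1 + 1) → dMat X (a * (N + 1) + r) ((a + 1) * (N + 1) + i) =
        val (toeplitz n k s i r)) ∧
      ∀ p, p ≤ N * (N + 1) → (∀ r, 1 ≤ r → r ≤ a + (1 + 1) → p ≠ a * (N + 1) + r) →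
        dMat X p ((a + 1) * (N + 1) + i) = val 0 := by
  classical
  obtain ⟨X, hX⟩ := exists_mat (p := fun p q b : M.Num =>
    (b = 1 ∧ (BlockEntry N (ToeplitzPos n k) p q ∨ BlockEntry N (ToeplitzNeg n k) p q)) ∨
    (b = 0 ∧ BlockEntry N (ToeplitzNeg n k) p q)) (N * (N + 1)) (N * (N + 1)) 1 (by
      rintro i j b - - (⟨rfl, -⟩ | ⟨rfl, -⟩)
      · exact le_rfl
      · exact zero_le_one)
  simp only [← val_eq_or] at hX
  refine ⟨X, fun p q hp hq => by rw [hX p q hp hq]; exact isInt_val _, fun s a i hs hi hia => ?_⟩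
  have haN : a + (1 + 1) ≤ N := by rw [← hs]; exact le_add_self
  have hiN : i ≤ N + 1 := hia.trans (add_le_add_left haN 1)
  have hq : (a + 1) * (N + 1) + i ≤ N * (N + 1) := by
    refine le_trans ?_ (mul_le_mul_left haN (N + 1))
    rw [← add_assoc, add_mul (a + 1), one_mul]
    exact add_le_add_right hiN _
  refine ⟨fun r hr hra => ?_, fun p hp hne => ?_⟩
  · have hp : a * (N + 1) + r ≤ N * (N + 1) := by
      refine le_trans ?_ hq
      rw [add_mul, one_mul]
      exact (add_le_add_right ((hra.trans haN).trans le_self_add) _).trans le_self_add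
    rw [hX _ _ hp hq, toeplitz_eq]
    simp only [blockEntry_iff hs hr hra hi hia]
  · rw [hX _ _ hp hq, if_neg, if_neg]
    all_goals
      intro h
      obtain ⟨r, hr, hra, h⟩ := h.exists_row hi hiN
      exact hne r hr hra h

theorem exists_support {n k s d i : M.Num} (hd : 1 + 1 ≤ d) (hi : 1 ≤ i) (hid : i ≤ d + 1) :
    ∃ r₁ r₂, r₁ < r₂ ∧ r₂ ≤ d ∧
      ∀ r, 1 ≤ r → r ≤ d → r ≠ r₁ → r ≠ r₂ → toeplitz n k s i r = 0 := by
  have hδ := one_add_one_le_stageShift k s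
  obtain ⟨r₁, h1, h2, h3⟩ : ∃ r₁, (∀ r, 1 ≤ r → i = r + stageShift k s → r = r₁) ∧ r₁ < i ∧
      r₁ < d := by
    rcases le_total (stageShift k s) i with h | h
    · obtain ⟨r, hr⟩ := exists_add_of_le h
      refine ⟨r, fun r' _ h' => add_left_cancel (a := stageShift k s) ?_, ?_, ?_⟩
      · rw [← hr, h', add_comm]
      · by_contra; simp only [toDiff_simps] at *; grind [toDiff_nonneg, diff_le_or]
      · by_contra; simp only [toDiff_simps] at *; grind [toDiff_nonneg, diff_le_or]
    · refine ⟨0, fun r hr h' => ?_, zero_lt_one.trans_le hi,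
        zero_lt_one.trans_le (le_add_self.trans hd)⟩
      by_contra; simp only [toDiff_simps] at *; grind [toDiff_nonneg, diff_le_or]
  -- The second index is the diagonal position i. The last row, i = d + 1, has no diagonal entry,
  -- and d serves as a dummy. Similarly `r₁` is i minus the shift, or 0 if that is not positive.
  have hr₂ : ∃ r₂, r₁ < r₂ ∧ r₂ ≤ d ∧ (i ≤ d → r₂ = i) := by
    rcases le_or_gt i d with h | h
    · exact ⟨i, h2, h, fun _ => rfl⟩
    · exact ⟨d, h3, le_rfl, fun h' => absurd h' h.not_ge⟩
  obtain ⟨r₂, h4, h5, h6⟩ := hr₂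
  refine ⟨r₁, r₂, h4, h5, fun r hr hrd hn1 hn2 => ?_⟩
  rw [toeplitz, if_neg, if_neg]
  · exact fun h => hn1 (h1 r hr h)
  · rintro rfl
    exact hn2 (h6 hrd).symm

/-- Block a of the first row of X^a is the coefficient vector of stage N - 1 - a. For a = 0 this is
the initial part (1, 0) of a row of the identity matrix. -/
theorem exists_isRecursion {n k N : M.Num} (hN : 1 ≤ N) : ∃ Q, IsRecursion n k N Q := by
  classical
  obtain ⟨X, hXi, hX⟩ := exists_blockMat N n k
  obtain ⟨t, ht⟩ := Num.exists_pred (zero_lt_one.trans_le hN).ne'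
  obtain ⟨Y, hY⟩ := exists_matPow (m := N * (N + 1)) (t := t) (X := X)
    fun i j _ hi _ hj => hXi i j hi hj
  obtain ⟨W, hW, -⟩ := matPow_iff.1 hY
  -- The vectors are read off the string `W` of all powers rather than from the last power, each
  -- stage from its own exponent a = N - 1 - s.
  obtain ⟨Q, hQ⟩ := exists_mat (p := fun s i b : M.Num => ∃ a, a ≤ N ∧ s + (a + 1) = N ∧
    npair (npair (npair a 1) (a * (N + 1) + i)) b ∈ W) N (N + 1) (M.len W) (by
      rintro s i b - - ⟨a, -, -, hb⟩
      exact (right_le_npair _ _).trans (Str.le_len hb))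
  have hQ' : ∀ s a i, s + (a + 1) = N → i ≤ N + 1 →
      dMat Q s i = dMatSeq W a 1 (a * (N + 1) + i) := by
    intro s a i hs hi
    rw [hQ s i (by rw [← hs]; exact le_self_add) hi]
    funext b
    refine propext ⟨?_, fun h => ⟨a, ?_, hs, h⟩⟩
    · rintro ⟨a', -, hs', h⟩
      obtain rfl := add_right_cancel (add_left_cancel (hs.trans hs'.symm))
      exact h
    · rw [← hs]; exact le_self_add.trans le_add_self
  have hNN : N + 1 ≤ N * (N + 1) := le_mul_of_one_le_left zero_le hN
  have h1N : 1 ≤ N * (N + 1) := le_add_self.trans hNN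
  refine ⟨Q, fun s hs => ?_, fun s d hs hd i hi hid => ?_⟩
  · have h2N : 1 + 1 ≤ N + 1 := add_le_add_left hN 1
    rw [hQ' s 0 1 (by rw [zero_add, hs]) le_add_self, hQ' s 0 (1 + 1) (by rw [zero_add, hs]) h2N,
      zero_mul, zero_add, zero_add, hW.1 1 1 le_rfl h1N le_rfl h1N,
      hW.1 1 (1 + 1) le_rfl h1N le_add_self (h2N.trans hNN), dIdMat_eq, dIdMat_eq, if_pos rfl,
      if_neg (Num.lt_add_one_iff'.2 le_rfl).ne]
    exact ⟨rfl, rfl⟩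
  · obtain ⟨a, rfl⟩ := exists_add_of_le hd
    rw [add_comm (1 + 1) a] at hs hid ⊢
    have hdN : a + (1 + 1) ≤ N := by rw [← hs]; exact le_add_self
    have hiN : i ≤ N + 1 := hid.trans (add_le_add_left hdN 1)
    have hat : a < t := by
      rw [← ht, ← add_assoc] at hdN
      exact Num.add_one_le_iff.1 (le_of_add_le_add_right hdN)
    have hl : a * (N + 1) + (a + (1 + 1)) ≤ N * (N + 1) := by
      refine le_trans ?_ (mul_le_mul_left hdN (N + 1))
      rw [add_mul]
      refine add_le_add_right (hdN.trans (le_self_add.trans (b := N + 1) ?_)) _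
      exact le_mul_of_one_le_left zero_le le_add_self
    have hq : (a + 1) * (N + 1) + i ≤ N * (N + 1) := by
      refine le_trans ?_ (mul_le_mul_left hdN (N + 1))
      rw [← add_assoc, add_mul (a + 1), one_mul]
      exact add_le_add_right hiN _
    have hrow : ∀ r, 1 ≤ r → r ≤ a + (1 + 1) →
        dMatSeq W a 1 (a * (N + 1) + r) = dMat Q (s + 1) r := fun r _ hr =>
      (hQ' (s + 1) a r (by rw [← hs]; ring) ((hr.trans hdN).trans le_self_add)).symm
    have hstep := hW.2 a hat 1 _ le_rfl h1N (hi.trans le_add_self) hq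
    rw [hQ' s (a + 1) i (by rw [← hs]; ring) hiN]
    obtain ⟨hX1, hX2⟩ := hX s a i hs hi hid
    obtain ⟨r₁, r₂, h12, h2, h0⟩ := exists_support (n := n) (k := k) (s := s)
      (le_add_self : 1 + 1 ≤ a + (1 + 1)) hi hid
    refine (dot_shift_iff h12 h2 hl (fun r => isStr_dMat _ _ _) (fun r hr hr' => ?_) h0 hrow
      (fun q => isStr_dMatSeq _ _ _ _) hX1 (fun q _ hq => hX2 q hq) (isStr_dMatSeq _ _ _ _)).1 hstep
    rw [← hrow r hr hr']
    exact hW.isInt hat.le le_rfl h1N (hr.trans le_add_self) ((add_le_add_right hr' _).trans hl)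

instance Def.swaps {Γ : Type u} [Ctx M Γ] {f g : Γ → M.Num} [DTerm f] [DTerm g] (k : M.Num) :
    Def (fun z => Swaps k (f z) (g z)) := by
  unfold Swaps; infer_instance

theorem posEntry_iff {N k i j : M.Num} :
    PosEntry N k i j ↔ i ≤ N ∧ ∃ h, h ≤ j ∧ 1 ≤ h ∧ j = N + h ∧ Swaps k i h := by
  refine and_congr_right fun _ => exists_congr fun h => ⟨fun H => ⟨?_, H⟩, fun H => H.2⟩
  rw [H.2.1]; exact le_add_self

instance Def.posEntry {Γ : Type u} [Ctx M Γ] {f g : Γ → M.Num} [DTerm f] [DTerm g] (N k : M.Num) :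
    Def (fun z => PosEntry N k (f z) (g z)) := by
  have := DTerm.fst (f := f) inferInstance
  have := DTerm.fst (f := g) inferInstance
  simp only [posEntry_iff]; infer_instance

theorem exists_swapEntry (N k I : M.Num) :
    ∃ A : M.Str, ∀ i j, i ≤ I → j ≤ I → dMat A i j = val (swapEntry N k i j) := by
  classical
  obtain ⟨A, hA⟩ := exists_mat (p := fun i j b : M.Num =>
    (b = 1 ∧ (PosEntry N k i j ∨ (PosEntry N k j i ∧ ¬ PosEntry N k i j))) ∨
    (b = 0 ∧ (PosEntry N k j i ∧ ¬ PosEntry N k i j))) I I 1 (by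
      rintro i j b - - (⟨rfl, -⟩ | ⟨rfl, -⟩)
      · exact le_rfl
      · exact zero_le_one)
  simp only [← val_eq_or] at hA
  refine ⟨A, fun i j hi hj => (hA i j hi hj).trans ?_⟩
  unfold swapEntry
  by_cases h1 : PosEntry N k i j <;> simp [h1]

theorem pfaffianBlockSwap_of_model (M : TwoSorted.{u}) [VModel M] : PfaffianBlockSwap M := by
  intro n k
  simp only [rimp_iff, sameMat_iff, dBlockSwap_eq, and_imp, same_iff, dNegOnePow_eq]
  intro hk hkN
  have hNN : (1 + 1) * ((1 + 1) * n) = (1 + 1) * n + (1 + 1) * n := by ring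
  rw [hNN]
  refine ⟨?_, fun A hA => ?_⟩
  · obtain ⟨A, hA⟩ := exists_swapEntry ((1 + 1) * n) k ((1 + 1) * n + (1 + 1) * n)
    exact ⟨A, fun i j _ hi _ hj => hA i j hi hj⟩
  · have hA' := fun i j h1 h2 h3 h4 => hA i j h1 h2 h3 h4
    simp only [isPfaffian_iff hA' rfl hk hkN]
    constructor
    · obtain ⟨Q, hQ⟩ := exists_isRecursion (n := n) (k := k) (hk.trans hkN.le)
      obtain ⟨Z, hZ⟩ := isStr_dMat Q 0 ((1 + 1) * n + 1)
      exact ⟨Z, Q, hQ, hZ⟩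
    · rintro Z ⟨Q, hQ, hZ⟩
      rw [hZ, hQ.last_eq rfl hk hkN]

end Existence
end BoundedArith

theorem mainTheorem10 :
    BoundedArith.Proves.{u} BoundedArith.VSharpL BoundedArith.pfaffianBlockSwap := by
  intro M hM v w
  have : BoundedArith.VModel M := ⟨hM⟩
  exact (BoundedArith.sat_pfaffianBlockSwap v w).2 (BoundedArith.pfaffianBlockSwap_of_model M)
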